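/- **Setting.** Consider a tabular episodic MDP with finite set $\mathcal X$ of state-action pairs $x=(s,a)$, $|\mathcal X|\ge 2$, states $\mathcal S$ ($S=|\mathcal S|$, every state has at least one action), horizon $H\ge 1$, transition probabilities $P(\cdot\mid x)$ and reward distributions $P_R(x)$ on $[0,1]$ with mean $r(x)$. In episode $k=1,2,\dots$ an initial state $s_{k,1}$ is given (chosen arbitrarily, possibly adversarially, from the past), the agent plays a deterministic time-dependent policy $\pi_k$, and in each step $h\in[H]$ it visits $x_{k,h}=(s_{k,h},\pi_k(s_{k,h},h))$. A directed feedback graph $G_k$ on $\mathcal X$ is drawn in each episode, independently of the past and of $s_{k,1},\pi_k$, from a fixed distribution; $q(x,x')$ is the probability of the edge $x\to x'$. In step $h$ the agent receives one observation $(x,r,s',\epsilon')$ with $r\in[0,1]$ and $\epsilon'\ge 0$ for $x=x_{k,h}$ and for every out-neighbor $x$ of $x_{k,h}$ in $G_k$. The observation for $x_{k,h}$ is the actual transition ($s'=s_{k,h+1}\sim P(x)$, $r\sim P_R(x)$ given the past); the conditional distributions $\tilde P_R,\tilde P$ given the past of the reward and successor state of a side observation satisfy $|\mathbb E_{\tilde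 P_R}[r]-r(x)|\le\epsilon'$ and $\|\tilde P-P(x)\|_1\le\epsilon'$; observations of the same step may be dependent. $Q^\pi_h,V^\pi_h$ are the value functions of $\pi$, $Q^\star_h,V^\star_h$ the optimal ones, and $w_{k,h}(x)$ is the probability that $\pi_k$, started in $s_{k,1}$, visits $x$ at step $h$. **Algorithm.** Inputs: $\delta\in(0,1]$; an integer $\hat S\le S$ with $|\{s':P(s'\mid x)>0\}|\le\hat S$ for all $x$; bounds $Q^{\max}_h(x)\le H$ with $Q^{\max}_h(x)\ge Q^\star_h(x)$, and $1\le V^{\max}_{h+1}(x)\le H$ with $V^{\max}_{h+1}(x)\ge\max_{s':P(s'|x)>0}V^\star_{h+1}(s')$. For each $x$ it keeps the number $n(x)$ of observations of $x$ so far and the averages over them $\hat r(x)$ of $r$, $\widehat{r^2}(x)$ of $r^2$, $\hat\epsilon(x)$ of $\epsilon'$, and $\hat P(x)$ of the indicator vectors $e_{s'}$ (initially $\hat r=\widehat{r^2}=\hat\epsilon=0$, and $\hat P(x)=e_{s_0}$ for some state $s_0$). Let $\phi(0)=1$ and $$\phi(n)=1\wedge\sqrt{\tfrac{0.52}{n}\Big(1.4\ln\ln(e\vee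 2n)+\ln\tfrac{5.2\,|\mathcal X|(4\hat S+5H+7)}{\delta}\Big)}.$$ Before episode $k$ it sets $\widetilde V_{k,H+1}=\underline V_{k,H+1}=0$ and, for $h=H,\dots,1$ and all $x$, $$\eta=\sqrt{\widehat{r^2}(x)-\hat r(x)^2}+2\sqrt{\hat\epsilon(x)}\,H+\sqrt{\hat P(x)\widetilde V_{k,h+1}^2-(\hat P(x)\widetilde V_{k,h+1})^2},$$ $$\psi_h(x)=4\eta\,\phi(n(x))+53\hat S H V^{\max}_{h+1}(x)\phi(n(x))^2+\tfrac1H\hat P(x)(\widetilde V_{k,h+1}-\underline V_{k,h+1})+(H+1)\hat\epsilon(x),$$ $$\widetilde Q_{k,h}(x)=0\vee(\hat r(x)+\hat P(x)\widetilde V_{k,h+1}+\psi_h(x))\wedge Q^{\max}_h(x),\qquad \underline Q_{k,h}(x)=0\vee(\hat r(x)+\hat P(x)\underline V_{k,h+1}-\psi_h(x))\wedge Q^{\max}_h(x),$$ $\pi_k(s,h)\in\operatorname{argmax}_a\widetilde Q_{k,h}(s,a)$ (ties broken arbitrarily), $\widetilde V_{k,h}(s)=\widetilde Q_{k,h}(s,\pi_k(s,h))$,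 $\underline V_{k,h}(s)=\underline Q_{k,h}(s,\pi_k(s,h))$. It then plays $\pi_k$ and updates the statistics with all observations of the episode. **Theorem.** For $\nu\in(0,1]$ let $G_{\ge\nu}$ be the directed graph with an edge $x\to x'$ iff $q(x,x')\ge\nu$; let $M(G)$ be the mas-number of $G$, i.e. the largest number of vertices that induce a subgraph without directed cycles (self-loops disregarded), and $\bar M=\inf_{\nu\in(0,1]}M(G_{\ge\nu})/\nu$. There is an absolute constant $C$ such that, for all MDPs, feedback graph distributions and inputs as above, with probability at least $1-\delta$ the following hold. For all $k$, $$\underline V_{k,1}(s_{k,1})\le V^{\pi_k}_1(s_{k,1})\le V^\star_1(s_{k,1})\le\widetilde V_{k,1}(s_{k,1}),$$ and for all $T\ge 1$, all $Q^{\max}\le H$ with $Q^{\max}\ge Q^{\max}_h(x)$ and $Q^{\max}\ge V^{\max}_{h+1}(x)$ whenever $w_{k,h}(x)>0$ for some $k\in[T]$, $h\in[H]$, and all $\epsilon_{\max}$ that bound every $\epsilon'$ received in the first $T$ episodes, both the cumulative certificate size $\sum_{k=1}^T(\widetilde V_{k,1}(s_{k,1})-\underline V_{k,1}(s_{k,1}))$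 and the regret $R(T)=\sum_{k=1}^T(V^\star_1(s_{k,1})-V^{\pi_k}_1(s_{k,1}))$ are at most $$C\left(\sqrt{\bar M H\sum_{k=1}^T V^{\pi_k}_1(s_{k,1})}\;\ln\frac{|\mathcal X|HT}{\delta}+\bar M\hat S Q^{\max}H\ln^3\frac{|\mathcal X|HT}{\delta}+\sqrt{\bar M H^3T\epsilon_{\max}}\;\ln\frac{|\mathcal X|HT}{\delta}+H^2T\epsilon_{\max}\right).$$ -/

import Mathlib

open MeasureTheory ProbabilityTheory
open scoped BigOperators

noncomputable section

namespace FeedbackRL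

/-! ### Tabular episodic MDPs

Time steps are counted from `0`: step `h < H` here is the step `h + 1` of a one-based count, and
`H` is the terminal time. `A s` is the set of actions available in state `s`. -/

/-- The space of all state-action pairs `x = (s, a)`; `x.1` is the state, `x.2` the action. -/
abbrev StateAction {S : Type*} (A : S → Type*) := Σ s, A s

/-- Deterministic time-dependent policies `a = π h s`. Only the steps `h < H` matter. -/
abbrev Policy {S : Type*} (A : S → Type*) := ℕ → ∀ s, A s

/-- A tabular MDP with transition probabilities `trans x s' = P(s' | x)` and reward distributions
`rewardLaw x = P_R(x)` on `[0, 1]`. -/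
structure TabularMDP (S : Type*) [Fintype S] (A : S → Type*) where
  trans : StateAction A → S → ℝ
  trans_nonneg : ∀ x s', 0 ≤ trans x s'
  trans_sum : ∀ x, ∑ s', trans x s' = 1
  rewardLaw : StateAction A → Measure ℝ
  rewardLaw_prob : ∀ x, IsProbabilityMeasure (rewardLaw x)
  rewardLaw_mem : ∀ x, ∀ᵐ r ∂(rewardLaw x), r ∈ Set.Icc (0 : ℝ) 1

namespace TabularMDP

variable {S : Type*} [Fintype S] {A : S → Type*} [∀ s, Fintype (A s)]

/-- Expected immediate reward `r(x)`. -/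
def meanReward (M : TabularMDP S A) (x : StateAction A) : ℝ := ∫ r, r ∂(M.rewardLaw x)

open Classical in
/-- `occ M π h x n y` is the probability that the state-action pair at time `h + n` is `y`, when the
pair at time `h` is `x` and actions from time `h + 1` on are taken by `π`. -/
def occ (M : TabularMDP S A) (π : Policy A) (h : ℕ) (x : StateAction A) :
    ℕ → StateAction A → ℝ
  | 0 => fun y => if y = x then 1 else 0
  | n + 1 => fun y =>
      (∑ z, occ M π h x n z * M.trans z y.1) * (if π (h + n + 1) y.1 = y.2 then 1 else 0)

/-- `Q^π_h(x)`: expected sum of the rewards of the steps `h, …, H - 1`, starting from the pair `x`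
at time `h` and following `π` afterwards. -/
def qValue (M : TabularMDP S A) (H : ℕ) (π : Policy A) (h : ℕ) (x : StateAction A) : ℝ :=
  ∑ n ∈ Finset.range (H - h), ∑ y, M.occ π h x n y * M.meanReward y

/-- `V^π_h(s) = Q^π_h(s, π_h(s))`. -/
def vValue (M : TabularMDP S A) (H : ℕ) (π : Policy A) (h : ℕ) (s : S) : ℝ :=
  M.qValue H π h ⟨s, π h s⟩

/-- `Q^⋆_h(x)`. -/
def optQ (M : TabularMDP S A) (H h : ℕ) (x : StateAction A) : ℝ :=
  ⨆ π : Policy A, M.qValue H π h x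

/-- `V^⋆_h(s)`. -/
def optV (M : TabularMDP S A) (H h : ℕ) (s : S) : ℝ :=
  ⨆ π : Policy A, M.vValue H π h s

/-- `w_h(x)`: probability of visiting `x` at step `h` of an episode that starts in `s` and is played
with `π`. -/
def visitProb (M : TabularMDP S A) (π : Policy A) (s : S) (h : ℕ) (x : StateAction A) : ℝ :=
  M.occ π 0 ⟨s, π 0 s⟩ h x

end TabularMDP

/-! ### Feedback graphs -/

section Graph

variable {X : Type*}

/-- The vertex set `V` induces a subgraph of `G` without directed cycles; self-loops do not count
(feedback graphs have all self-loops implicitly). -/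
def AcyclicOn (G : Digraph X) (V : Finset X) : Prop :=
  ∀ v, ¬ Relation.TransGen (fun x y => x ∈ V ∧ y ∈ V ∧ x ≠ y ∧ G.Adj x y) v v

/-- The mas-number: size of the largest acyclic induced subgraph. -/
def masNumber (G : Digraph X) : ℕ :=
  sSup {n | ∃ V : Finset X, AcyclicOn G V ∧ V.card = n}

/-- The probability `q(x, y)` of the edge from `x` to `y` in a random feedback graph. -/
def edgeProb (p : PMF (Digraph X)) (x y : X) : ℝ :=
  (p.toOuterMeasure {g | g.Adj x y}).toReal

/-- The graph `G_{≥ ν}` of the edges that have probability at least `ν`. -/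
def thresholdGraph (p : PMF (Digraph X)) (ν : ℝ) : Digraph X where
  Adj x y := ν ≤ edgeProb p x y

/-- `M̄ = inf_{ν ∈ (0, 1]} M(G_{≥ ν}) / ν`. -/
def masBar (p : PMF (Digraph X)) : ℝ :=
  ⨅ ν : Set.Ioc (0 : ℝ) 1, (masNumber (thresholdGraph p ν) : ℝ) / (ν : ℝ)

end Graph

/-! ### The interaction protocol -/

/-- A stochastic process describing the interaction of an agent, playing the policies `π k`, with
the MDP `M` over infinitely many episodes `k = 0, 1, …` of length `H`, with side observations
according to a random feedback graph drawn independently in each episode from `graphLaw`, possibly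
biased.

`ℱ` is the flow of information. Episode `k` occupies the times `k * (H + 1) + j`, `j ≤ H`.
At time `k * (H + 1)` everything about previous episodes, the policy and the initial state of
episode `k` are known, but nothing about its feedback graph. At time `k * (H + 1) + (h + 1)` the
graph, the current state-action pair of step `h` and the reported bias bounds of the observations of
this step are known, but not yet the observations themselves.

`obsR k h x` and `obsS k h x` are the reward and the successor state of the observation for `x` in
step `h` of episode `k`, and `bias k h x` the bound on its bias reported with it; they
are meaningful only if `x` is observed in this step. -/
structure Interaction {S : Type*} [Fintype S] {A : S → Type*} [∀ s, Fintype (A s)]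
    (M : TabularMDP S A) (H : ℕ) (graphLaw : PMF (Digraph (StateAction A)))
    {Ω : Type*} {mΩ : MeasurableSpace Ω} (μ : Measure Ω) where
  ℱ : Filtration ℕ mΩ
  π : ℕ → Ω → Policy A
  s1 : ℕ → Ω → S
  G : ℕ → Ω → Digraph (StateAction A)
  obsR : ℕ → ℕ → StateAction A → Ω → ℝ
  obsS : ℕ → ℕ → StateAction A → Ω → S
  bias : ℕ → ℕ → StateAction A → Ω → ℝ
  /-- The state-action pair visited in step `h` of episode `k`. -/
  pair : ℕ → ℕ → Ω → StateAction A
  pair_zero : ∀ k ω, pair k 0 ω = ⟨s1 k ω, π k ω 0 (s1 k ω)⟩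
  /-- The observation for the current pair is the actual transition. -/
  pair_succ : ∀ k h ω, pair k (h + 1) ω =
    ⟨obsS k h (pair k h ω) ω, π k ω (h + 1) (obsS k h (pair k h ω) ω)⟩
  /- What is known when. -/
  meas_policy : ∀ k h s a, MeasurableSet[ℱ (k * (H + 1))] {ω | π k ω h s = a}
  meas_init : ∀ k s, MeasurableSet[ℱ (k * (H + 1))] {ω | s1 k ω = s}
  meas_graph : ∀ k g, MeasurableSet[ℱ (k * (H + 1) + 1)] {ω | G k ω = g}
  meas_bias : ∀ k, ∀ h < H, ∀ x, Measurable[ℱ (k * (H + 1) + (h + 1))] (bias k h x)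
  meas_obsR : ∀ k, ∀ h < H, ∀ x, Measurable[ℱ (k * (H + 1) + (h + 2))] (obsR k h x)
  meas_obsS : ∀ k, ∀ h < H, ∀ x s',
    MeasurableSet[ℱ (k * (H + 1) + (h + 2))] {ω | obsS k h x ω = s'}
  obsR_mem : ∀ k h x ω, obsR k h x ω ∈ Set.Icc (0 : ℝ) 1
  bias_nonneg : ∀ k h x ω, 0 ≤ bias k h x ω
  /-- `G k` has law `graphLaw` and is independent of the past. -/
  graph_law : ∀ k g (B : Set Ω), MeasurableSet[ℱ (k * (H + 1))] B →
    μ ({ω | G k ω = g} ∩ B) = graphLaw g * μ B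
  /-- The actual transition: `s' ∼ P(x)` and `r ∼ P_R(x)`, given the past. -/
  trans_law : ∀ k, ∀ h < H, ∀ x s', ∀ᵐ ω ∂μ, pair k h ω = x →
    (μ⟦{ω' | obsS k h x ω' = s'} | ℱ (k * (H + 1) + (h + 1))⟧) ω = M.trans x s'
  reward_law : ∀ k, ∀ h < H, ∀ x, ∀ B : Set ℝ, MeasurableSet B → ∀ᵐ ω ∂μ, pair k h ω = x →
    (μ⟦{ω' | obsR k h x ω' ∈ B} | ℱ (k * (H + 1) + (h + 1))⟧) ω = (M.rewardLaw x).real B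
  /-- Side observations: given the past, the distributions `P̃_R`, `P̃` of an observation satisfy
  `|E_{P̃_R} r - r(x)| ≤ ε'` and `‖P̃ - P(x)‖₁ ≤ ε'`. Observations of the same step may be
  dependent. -/
  side_reward : ∀ k, ∀ h < H, ∀ x, ∀ᵐ ω ∂μ, (G k ω).Adj (pair k h ω) x →
    |(μ[obsR k h x | ℱ (k * (H + 1) + (h + 1))]) ω - M.meanReward x| ≤ bias k h x ω
  side_trans : ∀ k, ∀ h < H, ∀ x, ∀ᵐ ω ∂μ, (G k ω).Adj (pair k h ω) x →
    ∑ s', |(μ⟦{ω' | obsS k h x ω' = s'} | ℱ (k * (H + 1) + (h + 1))⟧) ω - M.trans x s'|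
      ≤ bias k h x ω

/-! ### The algorithm -/

/-- Inputs of the algorithm: failure tolerance `δ`, bound `Shat` on the number of successor states,
value bounds `Qmax h x` for `Q^⋆_h(x)` and `VmaxNext h x` for `V^⋆_{h+1}` at the successors
of `x`. -/
structure AlgInput {S : Type*} (A : S → Type*) where
  δ : ℝ
  Shat : ℕ
  Qmax : ℕ → StateAction A → ℝ
  VmaxNext : ℕ → StateAction A → ℝ

/-- The statistics kept for each state-action pair: number of observations, averages of rewards,
squared rewards and bias bounds, and transition frequencies. -/
structure Stats {S : Type*} (A : S → Type*) where
  n : StateAction A → ℕ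
  rHat : StateAction A → ℝ
  r2Hat : StateAction A → ℝ
  epsHat : StateAction A → ℝ
  PHat : StateAction A → S → ℝ

section Algorithm

variable {S : Type*} {A : S → Type*}

open Classical in
/-- Initial statistics; `s₀` is the "first" state, used for the arbitrary initial `P̂(x) = e₁`. -/
def Stats.init (s₀ : S) : Stats A where
  n _ := 0
  rHat _ := 0
  r2Hat _ := 0
  epsHat _ := 0
  PHat _ s' := if s' = s₀ then 1 else 0

/-- `((n' - 1) / n') * old + (1 / n') * new` where `n' = n + 1` is the count after the update. -/
def runAvg (n : ℕ) (old new : ℝ) : ℝ := (n : ℝ) / ((n : ℝ) + 1) * old + 1 / ((n : ℝ) + 1) * new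

open Classical in
/-- Update of the statistics with the observations `(x, r x, s' x, ε x)` of one step, where `x`
ranges over the set `O` of observed pairs. -/
def Stats.update (st : Stats A) (O : Set (StateAction A)) (r : StateAction A → ℝ)
    (s' : StateAction A → S) (ε : StateAction A → ℝ) : Stats A where
  n x := if x ∈ O then st.n x + 1 else st.n x
  rHat x := if x ∈ O then runAvg (st.n x) (st.rHat x) (r x) else st.rHat x
  r2Hat x := if x ∈ O then runAvg (st.n x) (st.r2Hat x) (r x ^ 2) else st.r2Hat x
  epsHat x := if x ∈ O then runAvg (st.n x) (st.epsHat x) (ε x) else st.epsHat x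
  PHat x y := if x ∈ O then runAvg (st.n x) (st.PHat x y) (if y = s' x then 1 else 0)
    else st.PHat x y

variable [Fintype S] [∀ s, Fintype (A s)]

/-- The confidence width `φ(n)`, with `φ(0) = 1`. -/
def AlgInput.phi (inp : AlgInput A) (H n : ℕ) : ℝ :=
  if n = 0 then 1 else
    min 1 (Real.sqrt (0.52 / n *
      (1.4 * Real.log (Real.log (max (Real.exp 1) (2 * n))) +
        Real.log (5.2 * (Fintype.card (StateAction A) * (4 * inp.Shat + 5 * H + 7)) / inp.δ))))

/-- `P̂(x) f`. -/
def Stats.expect (st : Stats A) (x : StateAction A) (f : S → ℝ) : ℝ := ∑ s', st.PHat x s' * f s'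

/-- The reward bonus `ψ_h(x)`, where `U`, `L` are the upper and lower value bounds for step
`h + 1`. -/
def bonus (inp : AlgInput A) (H : ℕ) (st : Stats A) (h : ℕ) (U L : S → ℝ) (x : StateAction A) :
    ℝ :=
  4 * (Real.sqrt (st.r2Hat x - st.rHat x ^ 2) + 2 * Real.sqrt (st.epsHat x) * H +
      Real.sqrt (st.expect x (fun s' => U s' ^ 2) - st.expect x U ^ 2)) * inp.phi H (st.n x)
    + 53 * inp.Shat * H * inp.VmaxNext h x * inp.phi H (st.n x) ^ 2
    + 1 / H * st.expect x (fun s' => U s' - L s')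
    + (H + 1) * st.epsHat x

def upperBackup (inp : AlgInput A) (H : ℕ) (st : Stats A) (h : ℕ) (U L : S → ℝ)
    (x : StateAction A) : ℝ :=
  max 0 (min (st.rHat x + st.expect x U + bonus inp H st h U L x) (inp.Qmax h x))

def lowerBackup (inp : AlgInput A) (H : ℕ) (st : Stats A) (h : ℕ) (U L : S → ℝ)
    (x : StateAction A) : ℝ :=
  max 0 (min (st.rHat x + st.expect x L - bonus inp H st h U L x) (inp.Qmax h x))

/-- Upper and lower value bounds of the planning routine with `m` steps to go, that is, for the step
`H - m`, when it selects the policy `π`. -/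
def planAux (inp : AlgInput A) (H : ℕ) (st : Stats A) (π : Policy A) : ℕ → (S → ℝ) × (S → ℝ)
  | 0 => (fun _ => 0, fun _ => 0)
  | m + 1 =>
    (fun s => upperBackup inp H st (H - (m + 1)) (planAux inp H st π m).1 (planAux inp H st π m).2
        ⟨s, π (H - (m + 1)) s⟩,
      fun s => lowerBackup inp H st (H - (m + 1)) (planAux inp H st π m).1 (planAux inp H st π m).2
        ⟨s, π (H - (m + 1)) s⟩)

/-- The upper confidence bound `Ṽ_h`. -/
def upperV (inp : AlgInput A) (H : ℕ) (st : Stats A) (π : Policy A) (h : ℕ) : S → ℝ :=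
  (planAux inp H st π (H - h)).1

/-- The lower confidence bound on `V^π_h`. -/
def lowerV (inp : AlgInput A) (H : ℕ) (st : Stats A) (π : Policy A) (h : ℕ) : S → ℝ :=
  (planAux inp H st π (H - h)).2

/-- The upper confidence bound `Q̃_h`. -/
def upperQ (inp : AlgInput A) (H : ℕ) (st : Stats A) (π : Policy A) (h : ℕ)
    (x : StateAction A) : ℝ :=
  upperBackup inp H st h (upperV inp H st π (h + 1)) (lowerV inp H st π (h + 1)) x

/-- `π` is an output of the optimistic planning routine: `π_h(s) ∈ argmax_a Q̃_h(s, a)`, with ties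
broken arbitrarily. -/
def IsOptPlan (inp : AlgInput A) (H : ℕ) (st : Stats A) (π : Policy A) : Prop :=
  ∀ h < H, ∀ s a, upperQ inp H st π h ⟨s, a⟩ ≤ upperQ inp H st π h ⟨s, π h s⟩

/-- Admissibility of the inputs of the algorithm for the MDP `M`. -/
structure AlgInput.Valid (inp : AlgInput A) (M : TabularMDP S A) (H : ℕ) : Prop where
  δ_pos : 0 < inp.δ
  δ_le : inp.δ ≤ 1
  support_le : ∀ x, {s' | M.trans x s' ≠ 0}.ncard ≤ inp.Shat
  Shat_le : inp.Shat ≤ Fintype.card S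
  optQ_le : ∀ h < H, ∀ x, M.optQ H h x ≤ inp.Qmax h x
  Qmax_le : ∀ h < H, ∀ x, inp.Qmax h x ≤ H
  optV_le : ∀ h < H, ∀ x s', 0 < M.trans x s' → M.optV H (h + 1) s' ≤ inp.VmaxNext h x
  one_le_VmaxNext : ∀ h < H, ∀ x, 1 ≤ inp.VmaxNext h x
  VmaxNext_le : ∀ h < H, ∀ x, inp.VmaxNext h x ≤ H

end Algorithm

namespace Interaction

variable {S : Type*} [Fintype S] {A : S → Type*} [∀ s, Fintype (A s)]
  {M : TabularMDP S A} {H : ℕ} {graphLaw : PMF (Digraph (StateAction A))}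
  {Ω : Type*} {mΩ : MeasurableSpace Ω} {μ : Measure Ω}

/-- The pairs observed in step `h` of episode `k`: the current one and its out-neighbors. -/
def observed (I : Interaction M H graphLaw μ) (k h : ℕ) (ω : Ω) : Set (StateAction A) :=
  {x | x = I.pair k h ω ∨ (I.G k ω).Adj (I.pair k h ω) x}

/-- Statistics after the first `h` steps of episode `k`, which begins with statistics `st`. -/
def episodeStats (I : Interaction M H graphLaw μ) (k : ℕ) (ω : Ω) (st : Stats A) : ℕ → Stats A
  | 0 => st
  | h + 1 => (episodeStats I k ω st h).update (I.observed k h ω) (fun x => I.obsR k h x ω)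
      (fun x => I.obsS k h x ω) (fun x => I.bias k h x ω)

/-- Statistics at the beginning of episode `k`. -/
def stats (I : Interaction M H graphLaw μ) (s₀ : S) : ℕ → Ω → Stats A
  | 0, _ => Stats.init s₀
  | k + 1, ω => I.episodeStats k ω (stats I s₀ k ω) H

/-- The agent runs the algorithm: in every episode it plays an output of the planning routine. -/
def RunsAlgorithm (I : Interaction M H graphLaw μ) (inp : AlgInput A) (s₀ : S) : Prop :=
  ∀ k ω, IsOptPlan inp H (I.stats s₀ k ω) (I.π k ω)

/-- Upper end `Ṽ_{k,1}(s_{k,1})` of the certificate of episode `k`. -/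
def certUpper (I : Interaction M H graphLaw μ) (inp : AlgInput A) (s₀ : S) (k : ℕ) (ω : Ω) : ℝ :=
  upperV inp H (I.stats s₀ k ω) (I.π k ω) 0 (I.s1 k ω)

/-- Lower end of the certificate of episode `k`. -/
def certLower (I : Interaction M H graphLaw μ) (inp : AlgInput A) (s₀ : S) (k : ℕ) (ω : Ω) : ℝ :=
  lowerV inp H (I.stats s₀ k ω) (I.π k ω) 0 (I.s1 k ω)

/-- The expected return `V^{π_k}_1(s_{k,1})` of episode `k`. -/
def return1 (I : Interaction M H graphLaw μ) (k : ℕ) (ω : Ω) : ℝ :=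
  M.vValue H (I.π k ω) 0 (I.s1 k ω)

/-- The optimal return `V^⋆_1(s_{k,1})` of episode `k`. -/
def optReturn (I : Interaction M H graphLaw μ) (k : ℕ) (ω : Ω) : ℝ :=
  M.optV H 0 (I.s1 k ω)

end Interaction

/-- The right-hand side of the bound without the numerical constant: `cardX = |𝒳|`,
`sumV = ∑_{k ≤ T} V^{π_k}_1(s_{k,1})`. -/
def ipocBound (Mbar : ℝ) (H cardX Shat T : ℕ) (δ Q ε sumV : ℝ) : ℝ :=
  Real.sqrt (Mbar * H * sumV) * Real.log (cardX * H * T / δ)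
    + Mbar * Shat * Q * H * Real.log (cardX * H * T / δ) ^ 3
    + Real.sqrt (Mbar * H ^ 3 * T * ε) * Real.log (cardX * H * T / δ)
    + H ^ 2 * T * ε

end FeedbackRL

end

open MeasureTheory ProbabilityTheory
open scoped BigOperators

noncomputable section

set_option linter.unusedSectionVars false

namespace FeedbackRL

/-! ### Exponential supermartingales -/

section Supermartingale

open scoped ENNReal

variable {Ω : Type*} {mΩ : MeasurableSpace Ω} {μ : Measure Ω}

/-! The proof is optimism with certificates: upper and lower value bounds enclose the optimal value
and the value of the played policy, so the regret is at most the cumulative certificate size, and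
only the latter has to be summed.

Concentration. For each pair, the observations are compared with their conditional means given the
past, and the reported bias bounds control the distance of these means from the truth. Observations
of different pairs in one step may be dependent, so every pair has its own martingale, on a common
clock with H + 1 slots per episode. An exponential supermartingale and Ville's inequality give a
deviation bound that holds for all times and all dyadic parameters at once
(`measure_exists_dyadic_deviation`). Choosing the parameter afterwards (`deviation_le_of_dyadic`)
yields an empirical Bernstein bound whose width is the φ of the algorithm. It is used for the
rewards, for the H fixed functions min(V⋆, Vmax), for the single states of the support, and for the
total mass outside the support; `ConcAt` records the result.

Validity. The upper backup needs concentration of fixed functions only (`ConcAt.upper_backup_ge`).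
The value of the played policy depends on the data, so the lower backup splits it into V⋆ and a
remainder that is treated state by state (`ConcAt.lower_backup_le`). Backward induction gives
`confidence_bounds`.

Size. By `ConcAt.gap_le`, the gap between the bounds at a pair is at most (1 + 21/H) times the
expected gap at the next step plus φ times true standard deviations plus terms of order φ² and of
the bias. Unrolling costs only e²¹ (`certificate_le`). Cauchy–Schwarz then separates the
visit-weighted sum of φ² from the sums of mean rewards and of one-step variances. The former of
these is the sum of the values of the played policies, the latter at most 2H times that sum
(`sum_visitProb_nextVar_le`); hence the leading square root.

Graphs. A threshold ν is fixed with M(G_≥ν)/ν ≤ 2M̄. By `exists_count_event`, n(x) is at least a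
constant times ν times the expected visits to the in-neighbourhood of x, once these are numerous
enough. A greedy choice of vertices shows that the weight put on vertices whose in-neighbourhoods
have little cumulative weight is controlled by the mas-number (`sum_weight_small_le`), and a dyadic
decomposition turns this into a bound for the sum of φ² (`sum_weight_div_le`,
`sum_visit_width_sq_le`). -/

lemma exp_sub_sq_le {u : ℝ} (hu : |u| ≤ 1 / 2) : Real.exp (u - u ^ 2) ≤ 1 + u := by
  have h1 : -(1 / 2) ≤ u := (abs_le.1 hu).1
  have hpos : 0 < 1 + u := by linarith
  have hz : ‖(u : ℂ)‖ < 1 := by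
    rw [Complex.norm_real, Real.norm_eq_abs]; linarith
  -- The complex Taylor estimate gives |log(1 + u) − u| ≤ u² / (2(1 − |u|)), which is at most u² for
  -- |u| ≤ 1/2.
  have h := Complex.norm_log_one_add_sub_self_le hz
  have e : Complex.log (1 + (u : ℂ)) - u = ((Real.log (1 + u) - u : ℝ) : ℂ) := by
    rw [Complex.ofReal_sub, Complex.ofReal_log hpos.le]; push_cast; rfl
  rw [e, Complex.norm_real, Complex.norm_real, Real.norm_eq_abs, Real.norm_eq_abs, sq_abs] at h
  have h2 : (1 - |u|)⁻¹ ≤ 2 := by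
    rw [inv_le_comm₀ (by linarith) (by norm_num)]; linarith
  have h3 : u ^ 2 * (1 - |u|)⁻¹ / 2 ≤ u ^ 2 := by nlinarith [sq_nonneg u]
  have h4 := (abs_le.1 (h.trans h3)).1
  rw [← Real.le_log_iff_exp_le hpos]
  linarith

/-- Nonnegative weights that are measurable with respect to a sub-σ-algebra preserve inequalities
between set integrals over that σ-algebra. -/
lemma lintegral_mul_le_of_setLIntegral_le {Ω : Type*} {m mΩ : MeasurableSpace Ω} {μ : Measure Ω}
    (hm : m ≤ mΩ)
    {f f' g : Ω → ℝ≥0∞} (hf : Measurable f) (hf' : Measurable f') (hg : Measurable[m] g)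
    (h : ∀ C, MeasurableSet[m] C → ∫⁻ ω in C, f ω ∂μ ≤ ∫⁻ ω in C, f' ω ∂μ) :
    ∫⁻ ω, f ω * g ω ∂μ ≤ ∫⁻ ω, f' ω * g ω ∂μ := by
  -- The hypothesis says that the densities f and f' define ordered measures on the sub-σ-algebra,
  -- and g is a function on that σ-algebra.
  have hle : (μ.withDensity f).trim hm ≤ (μ.withDensity f').trim hm := by
    refine Measure.le_iff.2 fun C hC => ?_
    rw [trim_measurableSet_eq hm hC, trim_measurableSet_eq hm hC,
      withDensity_apply _ (hm _ hC), withDensity_apply _ (hm _ hC)]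
    exact h C hC
  have hg' : Measurable g := hg.mono hm le_rfl
  have e1 := lintegral_withDensity_eq_lintegral_mul μ hf hg'
  have e2 := lintegral_withDensity_eq_lintegral_mul μ hf' hg'
  simp only [Pi.mul_apply] at e1 e2
  rw [← e1, ← e2, ← lintegral_trim hm hg, ← lintegral_trim hm hg]
  exact lintegral_mono' hle le_rfl

/-- Ville's maximal inequality. -/
lemma ville (ℱ : Filtration ℕ mΩ) [IsProbabilityMeasure μ] (Z : ℕ → Ω → ℝ≥0∞)
    (hZ : ∀ n, Measurable[ℱ n] (Z n))
    (hsup : ∀ n A, MeasurableSet[ℱ n] A →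
      ∫⁻ ω in A, Z (n + 1) ω ∂μ ≤ ∫⁻ ω in A, Z n ω ∂μ)
    (h0 : ∫⁻ ω, Z 0 ω ∂μ ≤ 1) (c : ℝ≥0∞) : c * μ {ω | ∃ n, c ≤ Z n ω} ≤ 1 := by
  set N : ℕ → Set Ω := fun n => {ω | ∀ i < n, Z i ω < c} with hN
  have hNm : ∀ n, MeasurableSet[ℱ n] (N (n + 1)) := by
    intro n
    have : N (n + 1) = ⋂ i ∈ Set.Iio (n + 1), {ω | Z i ω < c} := by ext; simp [hN]
    rw [this]
    refine MeasurableSet.biInter (Set.to_countable _) fun i hi => ?_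
    exact ℱ.mono (Nat.lt_succ_iff.1 hi) _ ((hZ i) measurableSet_Iio)
  -- On `N n` the process has stayed below c before time n. The left side never increases: the mass
  -- that leaves `N n` carries Z n ≥ c, and on the rest the supermartingale property applies.
  have key : ∀ n, c * μ (N n)ᶜ + ∫⁻ ω in N n, Z n ω ∂μ ≤ 1 := by
    intro n
    induction n with
    | zero => simpa [hN] using h0
    | succ n ih =>
      refine le_trans ?_ ih
      have hsub : N (n + 1) ⊆ N n := fun ω h i hi => h i (by omega)
      have hmN : MeasurableSet (N n) := by
        cases n with
        | zero => simp [hN]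
        | succ n => exact ℱ.le _ _ (hNm n)
      have hm1 : MeasurableSet (N (n + 1)) := ℱ.le _ _ (hNm n)
      have hsplit : (N (n + 1))ᶜ = (N n)ᶜ ∪ (N n \ N (n + 1)) := by
        ext ω; constructor
        · intro h; by_cases h' : ω ∈ N n
          · exact Or.inr ⟨h', h⟩
          · exact Or.inl h'
        · rintro (h | h)
          · exact fun h' => h (hsub h')
          · exact h.2
      have hlow : c * μ (N n \ N (n + 1)) ≤ ∫⁻ ω in N n \ N (n + 1), Z n ω ∂μ := by
        rw [← setLIntegral_const]
        refine setLIntegral_mono' (hmN.diff hm1) fun ω hω => ?_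
        by_contra hlt
        refine hω.2 fun i hi => ?_
        rcases Nat.lt_succ_iff_lt_or_eq.1 hi with h | rfl
        · exact hω.1 i h
        · exact not_le.1 hlt
      have hint : ∫⁻ ω in N n, Z n ω ∂μ =
          ∫⁻ ω in N (n + 1), Z n ω ∂μ + ∫⁻ ω in N n \ N (n + 1), Z n ω ∂μ := by
        rw [← lintegral_inter_add_sdiff _ (N n) hm1, Set.inter_eq_right.2 hsub]
      calc c * μ (N (n + 1))ᶜ + ∫⁻ ω in N (n + 1), Z (n + 1) ω ∂μ
          ≤ c * (μ (N n)ᶜ + μ (N n \ N (n + 1))) + ∫⁻ ω in N (n + 1), Z n ω ∂μ := by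
            refine add_le_add (mul_le_mul_right ?_ c) (hsup n _ (hNm n))
            rw [hsplit]; exact measure_union_le _ _
        _ ≤ c * μ (N n)ᶜ + (∫⁻ ω in N (n + 1), Z n ω ∂μ
              + ∫⁻ ω in N n \ N (n + 1), Z n ω ∂μ) := by
            rw [mul_add, add_assoc, add_comm (c * μ (N n \ N (n + 1)))]
            gcongr
        _ = _ := by rw [hint]
  have hU : {ω | ∃ n, c ≤ Z n ω} = ⋃ n, (N n)ᶜ := by
    ext ω
    simp only [hN, Set.mem_ofPred_eq, Set.mem_iUnion, Set.mem_compl_iff, not_forall, not_lt]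
    constructor
    · rintro ⟨n, h⟩; exact ⟨n + 1, n, Nat.lt_succ_self n, h⟩
    · rintro ⟨_, i, _, h⟩; exact ⟨i, h⟩
  have hmono : Monotone fun n => (N n)ᶜ := fun i j hij =>
    Set.compl_subset_compl.2 fun ω h l hl => h l (lt_of_lt_of_le hl hij)
  rw [hU, hmono.measure_iUnion, ENNReal.mul_iSup]
  exact iSup_le fun n => le_trans le_self_add (key n)

/-- Maximal inequality for sums whose exponential increments have conditional mean at most one. -/
lemma measure_exists_le_sum (ℱ : Filtration ℕ mΩ) [IsProbabilityMeasure μ] (ξ : ℕ → Ω → ℝ)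
    (hξ : ∀ t, Measurable[ℱ (t + 1)] (ξ t))
    (hexp : ∀ t A, MeasurableSet[ℱ t] A →
      ∫⁻ ω in A, ENNReal.ofReal (Real.exp (ξ t ω)) ∂μ ≤ μ A)
    {p : ℝ} (hp : 0 < p) :
    μ {ω | ∃ t, Real.log (1 / p) ≤ ∑ i ∈ Finset.range t, ξ i ω} ≤ ENNReal.ofReal p := by
  set Z : ℕ → Ω → ℝ≥0∞ :=
    fun t ω => ENNReal.ofReal (Real.exp (∑ i ∈ Finset.range t, ξ i ω)) with hZdef
  have hZ : ∀ n, Measurable[ℱ n] (Z n) := by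
    intro n
    refine ENNReal.measurable_ofReal.comp (Real.measurable_exp.comp ?_)
    refine Finset.measurable_sum _ fun i hi => ?_
    exact (hξ i).mono (ℱ.mono (Finset.mem_range.1 hi)) le_rfl
  have hv := ville (μ := μ) ℱ Z hZ ?_ ?_ (ENNReal.ofReal (1 / p))
  · have hset : {ω | ∃ t, Real.log (1 / p) ≤ ∑ i ∈ Finset.range t, ξ i ω} =
        {ω | ∃ n, ENNReal.ofReal (1 / p) ≤ Z n ω} := by
      ext ω
      simp only [Set.mem_ofPred_eq, hZdef]
      refine exists_congr fun t => ?_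
      rw [ENNReal.ofReal_le_ofReal_iff (Real.exp_pos _).le,
        Real.log_le_iff_le_exp (by positivity)]
    rw [hset]
    calc μ {ω | ∃ n, ENNReal.ofReal (1 / p) ≤ Z n ω}
        = ENNReal.ofReal p * (ENNReal.ofReal (1 / p) *
            μ {ω | ∃ n, ENNReal.ofReal (1 / p) ≤ Z n ω}) := by
          rw [← mul_assoc, ← ENNReal.ofReal_mul hp.le, mul_one_div_cancel hp.ne']; simp
      _ ≤ ENNReal.ofReal p * 1 := by gcongr
      _ = _ := mul_one _
  · intro n A hA
    have hmeas : Measurable fun ω => ENNReal.ofReal (Real.exp (ξ n ω)) :=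
      ENNReal.measurable_ofReal.comp (Real.measurable_exp.comp ((hξ n).mono (ℱ.le _) le_rfl))
    have h := lintegral_mul_le_of_setLIntegral_le (μ := μ) (ℱ.le n) hmeas
      (measurable_const (a := (1 : ℝ≥0∞))) (g := A.indicator (Z n)) ((hZ n).indicator hA)
      (by intro C hC; simpa using hexp n C hC)
    rw [← lintegral_indicator (ℱ.le _ _ hA), ← lintegral_indicator (ℱ.le _ _ hA)]
    refine le_trans (le_of_eq (lintegral_congr fun ω => ?_))
      (h.trans (le_of_eq (lintegral_congr fun ω => ?_)))
    · by_cases hω : ω ∈ A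
      · simp only [Set.indicator_of_mem hω, hZdef]
        rw [Finset.sum_range_succ, add_comm, Real.exp_add, ENNReal.ofReal_mul (Real.exp_pos _).le]
      · simp [Set.indicator_of_notMem hω]
    · simp
  · simp [hZdef]

/-- One step of the self-normalised supermartingale. -/
lemma setLIntegral_exp_selfNormalized_le {Ω : Type*} {m mΩ : MeasurableSpace Ω} {μ : Measure Ω}
    [IsProbabilityMeasure μ] (hm : m ≤ mΩ) {Y : Ω → ℝ} (hY : Measurable Y) {z : ℝ} (hYz : ∀ ω, |Y ω - z| ≤ 1)
    {lam : ℝ} (h0 : 0 ≤ lam) (h1 : lam ≤ 1 / 2) {B : Set Ω} (hB : MeasurableSet[m] B)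
    {A : Set Ω} (hA : MeasurableSet[m] A) :
    ∫⁻ ω in A, ENNReal.ofReal (Real.exp (B.indicator
      (fun ω => lam * (Y ω - (μ[Y | m]) ω) - lam ^ 2 * (Y ω - z) ^ 2) ω)) ∂μ ≤ μ A := by
  have hYint : Integrable Y μ := by
    refine Integrable.of_bound hY.aestronglyMeasurable (1 + |z|) (ae_of_all _ fun ω => ?_)
    rw [Real.norm_eq_abs]
    calc |Y ω| = |(Y ω - z) + z| := by ring_nf
      _ ≤ |Y ω - z| + |z| := abs_add_le _ _
      _ ≤ _ := by linarith [hYz ω]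
  set W : Ω → ℝ := μ[Y | m] with hW
  have hWm : Measurable[m] W := stronglyMeasurable_condExp.measurable
  have hWint : Integrable W μ := integrable_condExp
  have hWlow : ∀ᵐ ω ∂μ, z - 1 ≤ W ω := by
    have h := condExp_mono (μ := μ) (m := m) (integrable_const (z - 1)) hYint
      (ae_of_all _ fun ω => by have := (abs_le.1 (hYz ω)).1; linarith)
    rw [condExp_const hm] at h
    exact h
  -- With W the conditional mean, `exp_sub_sq_le` at u = lam (Y − z) bounds the exponential by f g,
  -- where g is known in advance. The conditional mean of f is f', and f' g ≤ 1 because 1 + x ≤ exp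
  -- x.
  set f : Ω → ℝ≥0∞ := fun ω => ENNReal.ofReal (1 + lam * (Y ω - z)) with hf
  set f' : Ω → ℝ≥0∞ := fun ω => ENNReal.ofReal (1 + lam * (W ω - z)) with hf'
  set g : Ω → ℝ≥0∞ := fun ω => ENNReal.ofReal (Real.exp (-(lam * (W ω - z)))) with hg
  have hfm : Measurable f :=
    ENNReal.measurable_ofReal.comp (measurable_const.add ((hY.sub_const z).const_mul lam))
  have hf'm : Measurable f' :=
    ENNReal.measurable_ofReal.comp (measurable_const.add
      (((hWm.mono hm le_rfl).sub_const z).const_mul lam))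
  have hgm : Measurable[m] g :=
    ENNReal.measurable_ofReal.comp (Real.measurable_exp.comp ((hWm.sub_const z).const_mul lam).neg)
  have hset : ∀ C, MeasurableSet[m] C → ∫⁻ ω in C, f ω ∂μ ≤ ∫⁻ ω in C, f' ω ∂μ := by
    intro C hC
    have i1 : Integrable (fun ω => 1 + lam * (Y ω - z)) (μ.restrict C) :=
      ((integrable_const _).add ((hYint.sub (integrable_const z)).const_mul lam)).restrict
    have i2 : Integrable (fun ω => 1 + lam * (W ω - z)) (μ.restrict C) :=
      ((integrable_const _).add ((hWint.sub (integrable_const z)).const_mul lam)).restrict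
    rw [hf, hf', ← ofReal_integral_eq_lintegral_ofReal i1, ← ofReal_integral_eq_lintegral_ofReal i2]
    · apply le_of_eq
      congr 1
      have hlin : ∀ F : Ω → ℝ, Integrable F μ → ∫ ω in C, (1 + lam * (F ω - z)) ∂μ =
          ∫ ω in C, (1 - lam * z) ∂μ + lam * ∫ ω in C, F ω ∂μ := by
        intro F hF
        rw [← integral_const_mul, ← integral_add (integrable_const _) (hF.restrict.const_mul lam)]
        exact integral_congr_ae (ae_of_all _ fun ω => by ring)
      rw [hlin Y hYint, hlin W hWint, hW, setIntegral_condExp hm hYint hC]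
    · refine ae_restrict_of_ae (hWlow.mono fun ω hω => ?_)
      show (0 : ℝ) ≤ 1 + lam * (W ω - z)
      nlinarith
    · refine ae_of_all _ fun ω => ?_
      have := (abs_le.1 (hYz ω)).1
      show (0 : ℝ) ≤ 1 + lam * (Y ω - z)
      nlinarith
  have hmain := lintegral_mul_le_of_setLIntegral_le (μ := μ) hm hfm hf'm
    (g := (A ∩ B).indicator g) (hgm.indicator (hA.inter hB)) hset
  have hAB : MeasurableSet (A ∩ B) := hm _ (hA.inter hB)
  have hpart : ∫⁻ ω in A ∩ B, ENNReal.ofReal (Real.exp (B.indicator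
      (fun ω => lam * (Y ω - W ω) - lam ^ 2 * (Y ω - z) ^ 2) ω)) ∂μ ≤ μ (A ∩ B) := by
    calc _ ≤ ∫⁻ ω, f ω * (A ∩ B).indicator g ω ∂μ := by
          rw [← lintegral_indicator hAB]
          refine lintegral_mono fun ω => ?_
          by_cases hω : ω ∈ A ∩ B
          · simp only [Set.indicator_of_mem hω, Set.indicator_of_mem hω.2, hf, hg]
            have hnn : 0 ≤ 1 + lam * (Y ω - z) := by
              have := (abs_le.1 (hYz ω)).1
              nlinarith
            rw [← ENNReal.ofReal_mul hnn]
            refine ENNReal.ofReal_le_ofReal ?_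
            have e : lam * (Y ω - W ω) - lam ^ 2 * (Y ω - z) ^ 2 =
              (lam * (Y ω - z) - (lam * (Y ω - z)) ^ 2) + -(lam * (W ω - z)) := by ring
            rw [e, Real.exp_add]
            refine mul_le_mul_of_nonneg_right (exp_sub_sq_le ?_) (Real.exp_pos _).le
            rw [abs_mul, abs_of_nonneg h0]
            nlinarith [hYz ω, abs_nonneg (Y ω - z)]
          · simp [Set.indicator_of_notMem hω]
      _ ≤ ∫⁻ ω, f' ω * (A ∩ B).indicator g ω ∂μ := hmain
      _ ≤ ∫⁻ ω, (A ∩ B).indicator 1 ω ∂μ := by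
          refine lintegral_mono_ae (hWlow.mono fun ω hω => ?_)
          by_cases hωA : ω ∈ A ∩ B
          · simp only [Set.indicator_of_mem hωA, hf', hg, Pi.one_apply]
            have hnn : 0 ≤ 1 + lam * (W ω - z) := by nlinarith
            rw [← ENNReal.ofReal_mul hnn, ← ENNReal.ofReal_one]
            refine ENNReal.ofReal_le_ofReal ?_
            have := Real.add_one_le_exp (lam * (W ω - z))
            rw [Real.exp_neg, ← div_eq_mul_inv, div_le_one (Real.exp_pos _)]
            linarith
          · simp [Set.indicator_of_notMem hωA]
      _ = μ (A ∩ B) := by rw [lintegral_indicator_one hAB]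
  rw [← lintegral_inter_add_sdiff _ A (hm _ hB), ← measure_inter_add_sdiff A (hm _ hB)]
  refine add_le_add hpart (le_of_eq ?_)
  rw [setLIntegral_congr_fun (g := fun _ => 1) ((hm _ hA).diff (hm _ hB))
    (fun ω hω => by simp [Set.indicator_of_notMem hω.2])]
  simp

/-- Time-uniform self-normalised deviation bound, simultaneously for the dyadic parameters
`2⁻¹, 2⁻², …`. -/
lemma measure_exists_dyadic_deviation (ℱ : Filtration ℕ mΩ) [IsProbabilityMeasure μ]
    (Y : ℕ → Ω → ℝ) (hY : ∀ t, Measurable[ℱ (t + 1)] (Y t)) {z : ℝ}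
    (hYz : ∀ t ω, |Y t ω - z| ≤ 1) (B : ℕ → Set Ω) (hB : ∀ t, MeasurableSet[ℱ t] (B t))
    {p : ℝ} (hp : 0 < p) :
    μ {ω | ¬ ∀ t, ∀ j : ℕ,
      ∑ i ∈ Finset.range t, (B i).indicator (fun ω => Y i ω - (μ[Y i | ℱ i]) ω) ω ≤
        (1 / 2) ^ (j + 1) * ∑ i ∈ Finset.range t, (B i).indicator (fun ω => (Y i ω - z) ^ 2) ω
          + Real.log ((j + 1) * (j + 2) / p) * 2 ^ (j + 1)} ≤ ENNReal.ofReal p := by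
  set ξ : ℕ → ℕ → Ω → ℝ := fun j t => (B t).indicator
      (fun ω => (1 / 2 : ℝ) ^ (j + 1) * (Y t ω - (μ[Y t | ℱ t]) ω)
        - ((1 / 2 : ℝ) ^ (j + 1)) ^ 2 * (Y t ω - z) ^ 2) with hξ
  -- Share of the tolerance given to the parameter 2^-(j+1); these shares telescope to at most p.
  have hpj : ∀ j : ℕ, 0 < p / ((j + 1) * (j + 2) : ℝ) := fun j => by positivity
  have hj : ∀ j : ℕ, μ {ω | ∃ t, Real.log (1 / (p / ((j + 1) * (j + 2) : ℝ))) ≤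
      ∑ i ∈ Finset.range t, ξ j i ω} ≤ ENNReal.ofReal (p / ((j + 1) * (j + 2) : ℝ)) := by
    intro j
    refine measure_exists_le_sum ℱ (ξ j) (fun t => ?_) (fun t A hA => ?_) (hpj j)
    · have hc : Measurable[ℱ (t + 1)] (μ[Y t | ℱ t]) :=
        (stronglyMeasurable_condExp.measurable).mono (ℱ.mono (Nat.le_succ t)) le_rfl
      refine Measurable.indicator ?_ (ℱ.mono (Nat.le_succ t) _ (hB t))
      exact (((hY t).sub hc).const_mul _).sub ((((hY t).sub_const z).pow_const 2).const_mul _)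
    · have hlam : (1 / 2 : ℝ) ^ (j + 1) ≤ 1 / 2 := by
        have := pow_le_one₀ (a := (1 / 2 : ℝ)) (n := j) (by norm_num) (by norm_num)
        rw [pow_succ]; linarith
      exact setLIntegral_exp_selfNormalized_le (ℱ.le t) ((hY t).mono (ℱ.le _) le_rfl)
        (hYz t) (by positivity) hlam (hB t) hA
  have hsum : ∑' j : ℕ, ENNReal.ofReal (p / ((j + 1) * (j + 2) : ℝ)) ≤ ENNReal.ofReal p := by
    refine ENNReal.tsum_le_of_sum_range_le fun n => ?_
    rw [← ENNReal.ofReal_sum_of_nonneg fun j _ => (hpj j).le]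
    refine ENNReal.ofReal_le_ofReal ?_
    have e : ∑ j ∈ Finset.range n, p / (((j : ℝ) + 1) * (j + 2)) = p * (1 - 1 / ((n : ℝ) + 1)) := by
      induction n with
      | zero => simp
      | succ n ih =>
        rw [Finset.sum_range_succ, ih]; push_cast; field_simp; ring
    rw [e]
    have : 0 ≤ 1 / ((n : ℝ) + 1) := by positivity
    nlinarith
  refine le_trans (measure_mono ?_) ((measure_iUnion_le _).trans
    ((ENNReal.tsum_le_tsum hj).trans hsum))
  intro ω hω
  simp only [Set.mem_ofPred_eq, not_forall, not_le] at hω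
  obtain ⟨t, j, h⟩ := hω
  simp only [Set.mem_iUnion, Set.mem_ofPred_eq]
  refine ⟨j, t, ?_⟩
  have e : ∑ i ∈ Finset.range t, ξ j i ω = (1 / 2 : ℝ) ^ (j + 1) *
      (∑ i ∈ Finset.range t, (B i).indicator (fun ω => Y i ω - (μ[Y i | ℱ i]) ω) ω
      - (1 / 2 : ℝ) ^ (j + 1) *
        ∑ i ∈ Finset.range t, (B i).indicator (fun ω => (Y i ω - z) ^ 2) ω) := by
    rw [Finset.mul_sum, ← Finset.sum_sub_distrib, Finset.mul_sum]
    refine Finset.sum_congr rfl fun i _ => ?_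
    by_cases hi : ω ∈ B i
    · simp only [hξ, Set.indicator_of_mem hi]; ring
    · simp [hξ, Set.indicator_of_notMem hi]
  have h2 : (0 : ℝ) < (1 / 2) ^ (j + 1) := by positivity
  have h3 : (1 / 2 : ℝ) ^ (j + 1) * 2 ^ (j + 1) = 1 := by rw [← mul_pow]; norm_num
  rw [e, one_div_div]
  have h4 := mul_lt_mul_of_pos_left h h2
  calc Real.log (((j : ℝ) + 1) * (j + 2) / p)
      = (1 / 2 : ℝ) ^ (j + 1) * (Real.log (((j : ℝ) + 1) * (j + 2) / p) * 2 ^ (j + 1)) := by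
        rw [mul_left_comm, h3, mul_one]
    _ ≤ _ := by
      rw [mul_add] at h4
      rw [mul_sub]
      linarith

end Supermartingale

/-! ### From dyadic deviation bounds to the confidence width -/

section Width

/-- The logarithmic factor of the confidence width at tolerance `p`. -/
def lilLog (p : ℝ) (n : ℕ) : ℝ :=
  1.4 * Real.log (Real.log (max (Real.exp 1) (2 * n))) + Real.log (5.2 / p)

lemma one_le_log_max (n : ℕ) : 1 ≤ Real.log (max (Real.exp 1) (2 * n)) := by
  rw [Real.le_log_iff_exp_le (lt_of_lt_of_le (Real.exp_pos 1) (le_max_left _ _))]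
  exact le_max_left _ _

lemma log_log_max_nonneg (n : ℕ) : 0 ≤ Real.log (Real.log (max (Real.exp 1) (2 * n))) :=
  Real.log_nonneg (one_le_log_max n)

lemma two_le_lilLog {p : ℝ} (hp : 0 < p) (hp' : p ≤ 1 / 32) (n : ℕ) : 2 ≤ lilLog p n := by
  have h1 : Real.log 8 ≤ Real.log (5.2 / p) := by
    refine Real.log_le_log (by norm_num) ?_
    rw [le_div_iff₀ hp]; linarith
  have h2 : Real.log 8 = 3 * Real.log 2 := by
    rw [show (8 : ℝ) = 2 ^ 3 by norm_num, Real.log_pow]; norm_num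
  have h3 := Real.log_two_gt_d9
  have h4 := log_log_max_nonneg n
  unfold lilLog
  linarith

lemma log_two_div_le_lilLog {p : ℝ} (hp : 0 < p) (n : ℕ) : Real.log (2 / p) ≤ lilLog p n := by
  have h1 : Real.log (2 / p) ≤ Real.log (5.2 / p) :=
    Real.log_le_log (by positivity) (by gcongr; norm_num)
  have h4 := log_log_max_nonneg n
  unfold lilLog
  linarith

/-- As long as 4^(j+1) ≤ n, the index j + 1 is at most log (2n), so the union over dyadic parameters
costs only log 2 + 2 log log (2n). The factor 1.456 = 2.8 · 0.52 is at least 2/1.4, as the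
coefficient 1.4 in `lilLog` requires. -/
lemma log_dyadic_le_lilLog {p : ℝ} (hp : 0 < p) (hp' : p ≤ 1 / 32) {n j : ℕ}
    (hj : 4 ^ (j + 1) ≤ n) :
    Real.log ((j + 1) * (j + 2) / p) ≤ 1.456 * lilLog p n := by
  have hn : (4 : ℝ) ≤ n := by
    have : 4 ^ 1 ≤ n := le_trans (Nat.pow_le_pow_right (by norm_num) (by omega)) hj
    exact_mod_cast this
  set l := Real.log (max (Real.exp 1) (2 * n)) with hl
  have hl1 : 1 ≤ l := one_le_log_max n
  have hjl : (j : ℝ) + 1 ≤ l := by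
    have h1 : Real.log ((4 : ℝ) ^ (j + 1)) ≤ l := by
      refine Real.log_le_log (by positivity) (le_trans ?_ (le_max_right _ _))
      have : ((4 : ℝ) ^ (j + 1)) ≤ n := by exact_mod_cast hj
      linarith
    rw [Real.log_pow, show (4 : ℝ) = 2 ^ 2 by norm_num, Real.log_pow] at h1
    push_cast at h1
    have := Real.log_two_gt_d9
    have hj0 : (0 : ℝ) ≤ j := Nat.cast_nonneg j
    nlinarith
  have hj0 : (0 : ℝ) ≤ j := Nat.cast_nonneg j
  have h2 : ((j : ℝ) + 1) * (j + 2) ≤ 2 * l ^ 2 := by nlinarith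
  have hlog : Real.log (((j : ℝ) + 1) * (j + 2)) ≤ Real.log 2 + 2 * Real.log l := by
    refine (Real.log_le_log (by positivity) h2).trans (le_of_eq ?_)
    rw [Real.log_mul (by norm_num) (by positivity), Real.log_pow]; norm_num
  have hl0 : 0 ≤ Real.log l := Real.log_nonneg hl1
  have hp1 : 0 ≤ Real.log (1 / p) := Real.log_nonneg (by rw [le_div_iff₀ hp]; linarith)
  have h52 : Real.log 2 ≤ Real.log 5.2 := Real.log_le_log (by norm_num) (by norm_num)
  have h20 := Real.log_two_gt_d9
  rw [div_eq_mul_one_div, Real.log_mul (by positivity) (by positivity)]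
  unfold lilLog
  have h5 : Real.log (5.2 / p) = Real.log 5.2 + Real.log (1 / p) := by
    rw [div_eq_mul_one_div (5.2 : ℝ), Real.log_mul (by norm_num) (by positivity)]
  rw [h5, ← hl]
  linarith

/-- Optimisation of the dyadic deviation bounds. -/
lemma deviation_le_of_dyadic {p : ℝ} (hp : 0 < p) (hp' : p ≤ 1 / 32) {n : ℕ} {D V K : ℝ}
    (hK : K = 1.456 * lilLog p n) (hV : 0 ≤ V) (hVn : V ≤ n)
    (h : ∀ j : ℕ, D ≤ (1 / 2) ^ (j + 1) * V + Real.log ((j + 1) * (j + 2) / p) * 2 ^ (j + 1)) :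
    D ≤ 13 / 6 * Real.sqrt (K * V) + 2 * K := by
  have hL := two_le_lilLog hp hp' n
  have hK2 : 2.9 ≤ K := by rw [hK]; linarith
  have hK0 : 0 < K := by linarith
  -- The expression lam V + K/lam is smallest at s = √(K/V). For V < 9K the coarsest parameter 1/2
  -- is good enough; otherwise s ≤ 1/3 and a dyadic parameter is found near s.
  by_cases hc : V < 9 * K
  · have h0 := h 0
    have hlog : Real.log (2 / p) ≤ K := by
      have := log_two_div_le_lilLog hp n
      rw [hK]; linarith
    norm_num at h0
    have hs : V / 2 ≤ 3 / 2 * Real.sqrt (K * V) := by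
      have : V / 3 ≤ Real.sqrt (K * V) := Real.le_sqrt_of_sq_le (by nlinarith)
      linarith
    have := Real.sqrt_nonneg (K * V)
    linarith
  · push Not at hc
    have hVpos : 0 < V := by linarith
    set q := Real.sqrt (K * V) with hq
    have hqpos : 0 < q := Real.sqrt_pos.2 (mul_pos hK0 hVpos)
    have hqq : q ^ 2 = K * V := Real.sq_sqrt (by positivity)
    set s := q / V with hs
    have hspos : 0 < s := div_pos hqpos hVpos
    have hsV : s * V = q := div_mul_cancel₀ _ hVpos.ne'
    have hsq : s * q = K := by
      rw [hs, div_mul_eq_mul_div, div_eq_iff hVpos.ne', ← sq, hqq]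
    have ht1 : 3 / 2 * s ≤ 1 := by
      have : s * q * 9 ≤ q * s⁻¹ := by
        have : q * s⁻¹ = V := by rw [hs]; field_simp
        rw [hsq, this]; linarith
      have h9 : (s * 9) * s ≤ 1 := by
        have h5 : s * 9 ≤ s⁻¹ := by nlinarith
        calc (s * 9) * s ≤ s⁻¹ * s := by gcongr
          _ = 1 := inv_mul_cancel₀ hspos.ne'
      nlinarith
    -- This gives lam between 3s/4 and 3s/2. On that range u = lam/s satisfies u + 1/u ≤ 13/6, the
    -- value at u = 3/2.
    obtain ⟨j, hj1, hj2⟩ := exists_nat_pow_near_of_lt_one (x := 3 / 2 * s) (y := (1 / 2 : ℝ))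
      (by positivity) ht1 (by norm_num) (by norm_num)
    set lam := (1 / 2 : ℝ) ^ (j + 1) with hlam
    have hlampos : 0 < lam := by positivity
    have hlow : 3 / 4 * s ≤ lam := by rw [hlam, pow_succ]; linarith
    have h2lam : (2 : ℝ) ^ (j + 1) * lam = 1 := by rw [hlam, ← mul_pow]; norm_num
    -- Since K exceeds 16/9, 4^(j+1) = lam⁻² ≤ (16/9) V/K ≤ n, so K covers the logarithmic cost of
    -- this j.
    have h4 : 4 ^ (j + 1) ≤ n := by
      have h5 : (4 : ℝ) ^ (j + 1) ≤ n := by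
        refine le_trans ?_ hVn
        have e4 : (4 : ℝ) ^ (j + 1) = (2 ^ (j + 1)) ^ 2 := by
          rw [← pow_mul, mul_comm, pow_mul]; norm_num
        have h6 : (2 : ℝ) ^ (j + 1) * s ≤ 4 / 3 := by
          have := mul_le_mul_of_nonneg_left hlow (by positivity : (0 : ℝ) ≤ 2 ^ (j + 1))
          linarith
        have h7 : ((2 : ℝ) ^ (j + 1)) ^ 2 * (s ^ 2) ≤ 16 / 9 := by
          have h8 : (0 : ℝ) ≤ 2 ^ (j + 1) * s := by positivity
          rw [← mul_pow]; nlinarith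
        have hs2 : s ^ 2 * V = K := by rw [sq, mul_assoc, hsV, hsq]
        rw [e4]
        have h9 : ((2 : ℝ) ^ (j + 1)) ^ 2 * K ≤ 16 / 9 * V := by
          rw [← hs2, ← mul_assoc]; gcongr
        have h10 : (0 : ℝ) ≤ (2 ^ (j + 1)) ^ 2 := by positivity
        nlinarith
      exact_mod_cast h5
    have hlog := log_dyadic_le_lilLog hp hp' h4
    rw [← hK] at hlog
    have hmain := h j
    rw [← hlam] at hmain
    set u := lam / s with hu
    have hlu : lam = u * s := (div_mul_cancel₀ _ hspos.ne').symm
    have hu1 : 3 / 4 ≤ u := by rw [hu, le_div_iff₀ hspos]; exact hlow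
    have hu2 : u ≤ 3 / 2 := by rw [hu, div_le_iff₀ hspos]; exact hj1.le
    have hupos : 0 < u := by linarith
    have e1 : lam * V = u * q := by rw [hlu, mul_assoc, hsV]
    have e2 : K * 2 ^ (j + 1) = u⁻¹ * q := by
      have : (2 : ℝ) ^ (j + 1) = lam⁻¹ := eq_inv_of_mul_eq_one_left h2lam
      rw [this, hlu, ← hsq, mul_inv]
      field_simp
    have e3 : u + u⁻¹ ≤ 13 / 6 := by
      have : u + u⁻¹ = (u ^ 2 + 1) / u := by field_simp
      rw [this, div_le_iff₀ hupos]; nlinarith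
    calc D ≤ lam * V + K * 2 ^ (j + 1) := by
            refine hmain.trans ?_; gcongr
      _ = (u + u⁻¹) * q := by rw [e1, e2]; ring
      _ ≤ 13 / 6 * q := by gcongr
      _ ≤ _ := by linarith

/-- The confidence width with tolerance `p`. -/
def width (p : ℝ) (n : ℕ) : ℝ := if n = 0 then 1 else min 1 (Real.sqrt (0.52 / n * lilLog p n))

lemma width_nonneg (p : ℝ) (n : ℕ) : 0 ≤ width p n := by
  unfold width; split_ifs <;> positivity

lemma width_sq_cases {p : ℝ} (hp : 0 < p) (hp' : p ≤ 1 / 32) {n : ℕ} (hn : 0 < n) :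
    width p n = 1 ∨ width p n ^ 2 * n = 0.52 * lilLog p n := by
  have hL := two_le_lilLog hp hp' n
  have hn' : (0 : ℝ) < n := by exact_mod_cast hn
  unfold width
  rw [if_neg hn.ne']
  rcases le_total 1 (Real.sqrt (0.52 / n * lilLog p n)) with h | h
  · left; exact min_eq_left h
  · right
    rw [min_eq_right h, Real.sq_sqrt (by positivity)]
    field_simp

lemma width_sq_mul_le {p : ℝ} (hp : 0 < p) (hp' : p ≤ 1 / 32) {n : ℕ} (hn : 0 < n) :
    width p n ^ 2 * n ≤ 0.52 * lilLog p n := by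
  have hL := two_le_lilLog hp hp' n
  have hn' : (0 : ℝ) < n := by exact_mod_cast hn
  have h1 : width p n ≤ Real.sqrt (0.52 / n * lilLog p n) := by
    unfold width; rw [if_neg hn.ne']; exact min_le_right _ _
  have h2 : width p n ^ 2 ≤ 0.52 / n * lilLog p n := by
    rw [← Real.sq_sqrt (by positivity : 0 ≤ 0.52 / n * lilLog p n)]
    exact pow_le_pow_left₀ (width_nonneg p n) h1 2
  calc width p n ^ 2 * n ≤ 0.52 / n * lilLog p n * n := by gcongr
    _ = _ := by field_simp

lemma AlgInput.phi_eq_width {S : Type*} {A : S → Type*} [Fintype S] [∀ s, Fintype (A s)]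
    (inp : AlgInput A) (H n : ℕ) :
    inp.phi H n =
      width (inp.δ / (Fintype.card (StateAction A) * (4 * inp.Shat + 5 * H + 7))) n := by
  unfold AlgInput.phi width lilLog
  rw [div_div_eq_mul_div]

/-- A width clipped at 1 makes the claim trivial. Otherwise `deviation_le_of_dyadic` applies with K
= 2.8 φ² n, which is 1.456 times `lilLog`; then 13/6 · √2.8 ≤ 3.63 and 2 · 2.8 = 5.6. -/
lemma deviation_le_width {p : ℝ} (hp : 0 < p) (hp' : p ≤ 1 / 32) {n : ℕ} (hn : 0 < n) {D V : ℝ}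
    (hD : D ≤ 2 * n) (hV : 0 ≤ V) (hVn : V ≤ n)
    (h : ∀ j : ℕ, D ≤ (1 / 2) ^ (j + 1) * V + Real.log ((j + 1) * (j + 2) / p) * 2 ^ (j + 1)) :
    D / n ≤ 3.63 * width p n * Real.sqrt (V / n) + 5.6 * width p n ^ 2 := by
  have hn' : (0 : ℝ) < n := by exact_mod_cast hn
  have hw := width_nonneg p n
  rcases width_sq_cases hp hp' hn with h1 | h1
  · rw [h1]
    have : D / n ≤ 2 := by rw [div_le_iff₀ hn']; exact hD
    have := Real.sqrt_nonneg (V / n)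
    linarith
  · have hdev := deviation_le_of_dyadic hp hp' (K := 2.8 * (width p n ^ 2 * n))
      (by rw [h1]; ring) hV hVn h
    have e : Real.sqrt (2.8 * (width p n ^ 2 * n) * V) =
        n * (Real.sqrt 2.8 * width p n * Real.sqrt (V / n)) := by
      rw [Real.sqrt_eq_iff_mul_self_eq (by positivity) (by positivity)]
      symm
      have e1 := Real.mul_self_sqrt (by norm_num : (0 : ℝ) ≤ 2.8)
      have e2 := Real.mul_self_sqrt (by positivity : (0 : ℝ) ≤ V / n)
      calc _ = n * n * (Real.sqrt 2.8 * Real.sqrt 2.8) * (width p n ^ 2) *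
            (Real.sqrt (V / n) * Real.sqrt (V / n)) := by ring
        _ = _ := by rw [e1, e2]; field_simp
    have h28 : 13 / 6 * Real.sqrt 2.8 ≤ 3.63 := by
      have : Real.sqrt 2.8 ≤ 1.675 := by
        rw [Real.sqrt_le_left (by norm_num)]; norm_num
      linarith
    rw [div_le_iff₀ hn']
    calc D ≤ 13 / 6 * (n * (Real.sqrt 2.8 * width p n * Real.sqrt (V / n)))
            + 2 * (2.8 * (width p n ^ 2 * n)) := by rw [← e]; exact hdev
      _ = (13 / 6 * Real.sqrt 2.8) * (width p n * Real.sqrt (V / n) * n)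
            + 5.6 * width p n ^ 2 * n := by ring
      _ ≤ 3.63 * (width p n * Real.sqrt (V / n) * n) + 5.6 * width p n ^ 2 * n := by gcongr
      _ = _ := by ring

/-- Only the coarsest dyadic parameter is used. For an indicator centred at 0, V is the number of
hits, so the term V/2 can be absorbed; this produces `ConcAt.dev_out`. -/
lemma deviation_le_half_add_width {p : ℝ} (hp : 0 < p) (hp' : p ≤ 1 / 32) {n : ℕ} (hn : 0 < n)
    {D V : ℝ} (hD : D ≤ 2 * n) (hV : 0 ≤ V)
    (h : ∀ j : ℕ, D ≤ (1 / 2) ^ (j + 1) * V + Real.log ((j + 1) * (j + 2) / p) * 2 ^ (j + 1)) :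
    D / n ≤ V / n / 2 + 4 * width p n ^ 2 := by
  have hn' : (0 : ℝ) < n := by exact_mod_cast hn
  have hVn : 0 ≤ V / n := by positivity
  rcases width_sq_cases hp hp' hn with h1 | h1
  · rw [h1]
    have : D / n ≤ 2 := by rw [div_le_iff₀ hn']; exact hD
    linarith
  · have h0 := h 0
    norm_num at h0
    have hlog := log_two_div_le_lilLog hp n
    have hL := two_le_lilLog hp hp' n
    rw [div_le_iff₀ hn']
    have : (V / n / 2 + 4 * width p n ^ 2) * n = V / 2 + 4 * (width p n ^ 2 * n) := by
      field_simp
    rw [this, h1]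
    linarith

end Width

/-! ### Value functions -/

namespace TabularMDP

variable {S : Type*} [Fintype S] {A : S → Type*} [∀ s, Fintype (A s)] (M : TabularMDP S A)

lemma meanReward_nonneg (x : StateAction A) : 0 ≤ M.meanReward x :=
  integral_nonneg_of_ae ((M.rewardLaw_mem x).mono fun _ h => h.1)

lemma meanReward_le_one (x : StateAction A) : M.meanReward x ≤ 1 := by
  have := M.rewardLaw_prob x
  have hint : Integrable (fun r : ℝ => r) (M.rewardLaw x) :=
    Integrable.of_bound aestronglyMeasurable_id 1 ((M.rewardLaw_mem x).mono fun r h => by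
      rw [Real.norm_eq_abs, abs_of_nonneg h.1]; exact h.2)
  have := integral_mono_ae hint (integrable_const 1) ((M.rewardLaw_mem x).mono fun _ h => h.2)
  simpa [meanReward] using this

lemma occ_nonneg (π : Policy A) (h : ℕ) (x : StateAction A) (n : ℕ) (y : StateAction A) :
    0 ≤ M.occ π h x n y := by
  induction n generalizing y with
  | zero => unfold occ; split_ifs <;> norm_num
  | succ n ih =>
    unfold occ
    refine mul_nonneg (Finset.sum_nonneg fun z _ => mul_nonneg (ih z) (M.trans_nonneg _ _)) ?_
    split_ifs <;> norm_num

lemma occ_sum_succ (π : Policy A) (h : ℕ) (x : StateAction A) (n : ℕ) (F : StateAction A → ℝ) :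
    ∑ y, M.occ π h x (n + 1) y * F y =
      ∑ z, M.occ π h x n z * ∑ s', M.trans z s' * F ⟨s', π (h + n + 1) s'⟩ := by
  classical
  have e : ∀ y : StateAction A, M.occ π h x (n + 1) y * F y =
      ∑ z, M.occ π h x n z * (M.trans z y.1 *
        ((if π (h + n + 1) y.1 = y.2 then 1 else 0) * F y)) := by
    intro y
    simp only [occ]
    rw [Finset.sum_mul, Finset.sum_mul]
    exact Finset.sum_congr rfl fun z _ => by ring
  rw [Finset.sum_congr rfl fun y _ => e y, Finset.sum_comm]
  refine Finset.sum_congr rfl fun z _ => ?_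
  rw [← Finset.mul_sum, Fintype.sum_sigma]
  congr 1
  refine Finset.sum_congr rfl fun s' _ => ?_
  simp

lemma occ_sum_eq_one (π : Policy A) (h : ℕ) (x : StateAction A) (n : ℕ) :
    ∑ y, M.occ π h x n y = 1 := by
  classical
  induction n with
  | zero => simp [occ]
  | succ n ih =>
    have := M.occ_sum_succ π h x n (fun _ => 1)
    simpa [M.trans_sum, ih] using this

/-- `occ` appends a last step, whereas Bellman's equation needs the decomposition at the first one.
-/
lemma occ_succ_first (π : Policy A) (h : ℕ) (x : StateAction A) (n : ℕ) (y : StateAction A) :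
    M.occ π h x (n + 1) y =
      ∑ s', M.trans x s' * M.occ π (h + 1) ⟨s', π (h + 1) s'⟩ n y := by
  classical
  induction n generalizing y with
  | zero =>
    obtain ⟨s, a⟩ := y
    have e : ∀ s', (if (⟨s, a⟩ : StateAction A) = ⟨s', π (h + 1) s'⟩ then (1 : ℝ) else 0) =
        if s' = s then (if π (h + 1) s = a then 1 else 0) else 0 := by
      intro s'
      by_cases hs : s' = s
      · subst hs; simp [eq_comm]
      · rw [if_neg hs, if_neg]
        intro h'; exact hs (congrArg Sigma.fst h').symm
    simp only [occ, e]
    simp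
  | succ n ih =>
    have e1 : M.occ π h x (n + 1 + 1) y = (∑ z, M.occ π h x (n + 1) z * M.trans z y.1) *
      (if π (h + (n + 1) + 1) y.1 = y.2 then 1 else 0) := rfl
    have e2 : ∀ s', M.occ π (h + 1) ⟨s', π (h + 1) s'⟩ (n + 1) y =
      (∑ z, M.occ π (h + 1) ⟨s', π (h + 1) s'⟩ n z * M.trans z y.1) *
      (if π (h + (n + 1) + 1) y.1 = y.2 then 1 else 0) := by
      intro s'
      rw [show h + (n + 1) + 1 = h + 1 + n + 1 by ring]
      rfl
    rw [e1]
    simp only [e2, ih, ← mul_assoc, Finset.sum_mul, Finset.mul_sum]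
    rw [Finset.sum_comm]

lemma qValue_eq_zero {H h : ℕ} (hh : H ≤ h) (π : Policy A) (x : StateAction A) :
    M.qValue H π h x = 0 := by
  simp [qValue, Nat.sub_eq_zero_of_le hh]

lemma vValue_eq_zero {H h : ℕ} (hh : H ≤ h) (π : Policy A) (s : S) : M.vValue H π h s = 0 :=
  M.qValue_eq_zero hh π _

/-- Bellman equation for the value functions of a policy. -/
lemma qValue_eq {H h : ℕ} (hh : h < H) (π : Policy A) (x : StateAction A) :
    M.qValue H π h x = M.meanReward x + ∑ s', M.trans x s' * M.vValue H π (h + 1) s' := by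
  classical
  have e : H - h = (H - (h + 1)) + 1 := by omega
  unfold vValue qValue
  rw [e, Finset.sum_range_succ', add_comm]
  congr 1
  · simp [occ]
  · simp only [occ_succ_first, Finset.sum_mul, Finset.mul_sum]
    rw [Finset.sum_comm' (t' := Finset.univ) (s' := fun _ => Finset.range (H - (h + 1)))]
    · rw [Finset.sum_congr rfl fun y _ => Finset.sum_comm]
      rw [Finset.sum_comm]
      refine Finset.sum_congr rfl fun s' _ => ?_
      rw [Finset.sum_comm]
      exact Finset.sum_congr rfl fun n _ => Finset.sum_congr rfl fun y _ => by ring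
    · simp

lemma qValue_nonneg (H : ℕ) (π : Policy A) (h : ℕ) (x : StateAction A) : 0 ≤ M.qValue H π h x :=
  Finset.sum_nonneg fun _ _ => Finset.sum_nonneg fun _ _ =>
    mul_nonneg (M.occ_nonneg _ _ _ _ _) (M.meanReward_nonneg _)

lemma qValue_le (H : ℕ) (π : Policy A) (h : ℕ) (x : StateAction A) : M.qValue H π h x ≤ H := by
  calc M.qValue H π h x ≤ ∑ n ∈ Finset.range (H - h), (1 : ℝ) := by
        refine Finset.sum_le_sum fun n _ => ?_
        rw [← M.occ_sum_eq_one π h x n]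
        exact Finset.sum_le_sum fun y _ =>
          mul_le_of_le_one_right (M.occ_nonneg _ _ _ _ _) (M.meanReward_le_one _)
    _ = ((H - h : ℕ) : ℝ) := by simp
    _ ≤ H := by exact_mod_cast Nat.sub_le H h

lemma vValue_nonneg (H : ℕ) (π : Policy A) (h : ℕ) (s : S) : 0 ≤ M.vValue H π h s :=
  M.qValue_nonneg _ _ _ _

lemma vValue_le (H : ℕ) (π : Policy A) (h : ℕ) (s : S) : M.vValue H π h s ≤ H :=
  M.qValue_le _ _ _ _

lemma vValue_le_optV (H : ℕ) (π : Policy A) (h : ℕ) (s : S) :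
    M.vValue H π h s ≤ M.optV H h s :=
  le_ciSup (f := fun π => M.vValue H π h s) ⟨H, by rintro _ ⟨π, rfl⟩; exact M.vValue_le H π h s⟩ π

lemma qValue_le_optQ (H : ℕ) (π : Policy A) (h : ℕ) (x : StateAction A) :
    M.qValue H π h x ≤ M.optQ H h x :=
  le_ciSup (f := fun π => M.qValue H π h x) ⟨H, by rintro _ ⟨π, rfl⟩; exact M.qValue_le H π h x⟩ π

/-! ### Optimal values -/

section Optimal

variable [∀ s, Nonempty (A s)]

lemma optV_le_of_forall {H h : ℕ} {s : S} {c : ℝ} (hc : ∀ π, M.vValue H π h s ≤ c) :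
    M.optV H h s ≤ c :=
  ciSup_le hc

lemma optV_nonneg (H h : ℕ) (s : S) : 0 ≤ M.optV H h s :=
  (M.vValue_nonneg H (Classical.arbitrary _) h s).trans (M.vValue_le_optV H _ h s)

lemma optV_le (H h : ℕ) (s : S) : M.optV H h s ≤ H :=
  M.optV_le_of_forall fun π => M.vValue_le H π h s

lemma optV_eq_zero {H h : ℕ} (hh : H ≤ h) (s : S) : M.optV H h s = 0 :=
  le_antisymm (M.optV_le_of_forall fun π => (M.vValue_eq_zero hh π s).le) (M.optV_nonneg H h s)

/-- Only this half of the optimality equation is needed, so no optimal policy has to be constructed: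
each policy satisfies Bellman's equation, and its next values lie below the suprema. -/
lemma optQ_le_backup {H h : ℕ} (hh : h < H) (x : StateAction A) :
    M.optQ H h x ≤ M.meanReward x + ∑ s', M.trans x s' * M.optV H (h + 1) s' := by
  refine ciSup_le fun π => ?_
  rw [M.qValue_eq hh]
  gcongr with s' _
  · exact M.trans_nonneg x s'
  · exact M.vValue_le_optV H π (h + 1) s'

end Optimal

/-! ### Visitation probabilities -/

lemma visitProb_nonneg (π : Policy A) (s : S) (h : ℕ) (x : StateAction A) :
    0 ≤ M.visitProb π s h x := M.occ_nonneg _ _ _ _ _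

lemma visitProb_sum (π : Policy A) (s : S) (h : ℕ) : ∑ x, M.visitProb π s h x = 1 :=
  M.occ_sum_eq_one _ _ _ _

lemma visitProb_sum_succ (π : Policy A) (s : S) (h : ℕ) (F : StateAction A → ℝ) :
    ∑ x, M.visitProb π s (h + 1) x * F x =
      ∑ x, M.visitProb π s h x * ∑ s', M.trans x s' * F ⟨s', π (h + 1) s'⟩ := by
  have := M.occ_sum_succ π 0 ⟨s, π 0 s⟩ h F
  rwa [zero_add] at this

lemma visitProb_zero_sum (π : Policy A) (s : S) (F : StateAction A → ℝ) :
    ∑ x, M.visitProb π s 0 x * F x = F ⟨s, π 0 s⟩ := by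
  classical
  simp [visitProb, occ]

lemma policy_of_visitProb_pos {π : Policy A} {s : S} {h : ℕ} {x : StateAction A}
    (hx : 0 < M.visitProb π s h x) : x = ⟨x.1, π h x.1⟩ := by
  classical
  cases h with
  | zero =>
    simp only [visitProb, occ] at hx
    split_ifs at hx with h'
    · subst h'; rfl
    · exact absurd hx (lt_irrefl _)
  | succ h =>
    simp only [visitProb, occ, zero_add] at hx
    split_ifs at hx with h'
    · obtain ⟨s', a⟩ := x
      simp only at h'
      rw [h']
    · simp at hx

lemma visitProb_succ_pos {π : Policy A} {s : S} {h : ℕ} {x : StateAction A}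
    (hx : 0 < M.visitProb π s h x) {s' : S} (hs' : 0 < M.trans x s') :
    0 < M.visitProb π s (h + 1) ⟨s', π (h + 1) s'⟩ := by
  simp only [visitProb, occ, zero_add, if_true, mul_one]
  refine lt_of_lt_of_le (mul_pos hx hs') ?_
  exact Finset.single_le_sum (f := fun z => M.occ π 0 ⟨s, π 0 s⟩ h z * M.trans z s')
    (fun z _ => mul_nonneg (M.occ_nonneg _ _ _ _ _) (M.trans_nonneg _ _)) (Finset.mem_univ x)

lemma visitProb_zero_pos (π : Policy A) (s : S) : 0 < M.visitProb π s 0 ⟨s, π 0 s⟩ := by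
  simp [visitProb, occ]

lemma vValue_eq_sum_visitProb (H : ℕ) (π : Policy A) (s : S) :
    M.vValue H π 0 s = ∑ h ∈ Finset.range H, ∑ x, M.visitProb π s h x * M.meanReward x := rfl

/-- Unrolling of a backward recursion along the visitation probabilities. -/
lemma le_sum_visitProb_of_recursion {H : ℕ} (π : Policy A) (s : S) (Δ : ℕ → S → ℝ)
    (B : ℕ → StateAction A → ℝ) {κ : ℝ} (hκ : 0 ≤ κ) (hH : ∀ s', Δ H s' ≤ 0)
    (hrec : ∀ h < H, ∀ x, 0 < M.visitProb π s h x →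
      Δ h x.1 ≤ κ * ∑ s', M.trans x s' * Δ (h + 1) s' + B h x) :
    Δ 0 s ≤ ∑ h ∈ Finset.range H, κ ^ h * ∑ x, M.visitProb π s h x * B h x := by
  have key : ∀ m ≤ H, Δ 0 s ≤ ∑ h ∈ Finset.range m, κ ^ h * ∑ x, M.visitProb π s h x * B h x
      + κ ^ m * ∑ x, M.visitProb π s m x * Δ m x.1 := by
    intro m hm
    induction m with
    | zero => rw [M.visitProb_zero_sum π s (fun x => Δ 0 x.1)]; simp
    | succ m ih =>
      refine (ih (by omega)).trans ?_
      rw [Finset.sum_range_succ, add_assoc]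
      gcongr
      rw [M.visitProb_sum_succ π s m (fun x => Δ (m + 1) x.1), pow_succ, mul_assoc, ← mul_add]
      refine mul_le_mul_of_nonneg_left ?_ (pow_nonneg hκ m)
      rw [Finset.mul_sum, ← Finset.sum_add_distrib]
      refine Finset.sum_le_sum fun x _ => ?_
      rcases (M.visitProb_nonneg π s m x).eq_or_lt with h0 | h0
      · simp [← h0]
      · have := mul_le_mul_of_nonneg_left (hrec m (by omega) x h0) h0.le
        simp only
        linarith
  refine (key H le_rfl).trans ?_
  have : κ ^ H * ∑ x, M.visitProb π s H x * Δ H x.1 ≤ 0 :=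
    mul_nonpos_of_nonneg_of_nonpos (pow_nonneg hκ H) (Finset.sum_nonpos fun x _ =>
      mul_nonpos_of_nonneg_of_nonpos (M.visitProb_nonneg _ _ _ _) (hH _))
  linarith

/-- The variance of `V^π_{h+1}` under the transition probabilities of `x`. -/
def nextVar (H : ℕ) (π : Policy A) (h : ℕ) (x : StateAction A) : ℝ :=
  ∑ s', M.trans x s' * (M.vValue H π (h + 1) s') ^ 2
    - (∑ s', M.trans x s' * M.vValue H π (h + 1) s') ^ 2

/-- The expected sum of the one-step variances along an episode. -/
lemma sum_visitProb_nextVar_le (H : ℕ) (π : Policy A) (s : S) :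
    ∑ h ∈ Finset.range H, ∑ x, M.visitProb π s h x * M.nextVar H π h x
      ≤ 2 * H * M.vValue H π 0 s := by
  -- A potential argument replaces the law of total variance; the potential is the expected square
  -- of V at step m. With r the mean reward and a the mean next value, (r + a)² − a² ≤ 2r(r + a) ≤
  -- 2Hr.
  have key : ∀ m ≤ H, ∑ h ∈ Finset.range m, ∑ x, M.visitProb π s h x * M.nextVar H π h x ≤
      2 * H * ∑ h ∈ Finset.range m, ∑ x, M.visitProb π s h x * M.meanReward x
        + ∑ x, M.visitProb π s m x * M.vValue H π m x.1 ^ 2 := by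
    intro m hm
    induction m with
    | zero =>
      simp only [Finset.range_zero, Finset.sum_empty, mul_zero, zero_add]
      exact Finset.sum_nonneg fun x _ => mul_nonneg (M.visitProb_nonneg _ _ _ _) (sq_nonneg _)
    | succ m ih =>
      have ih := ih (by omega)
      rw [Finset.sum_range_succ, Finset.sum_range_succ, mul_add,
        M.visitProb_sum_succ π s m (fun x => M.vValue H π (m + 1) x.1 ^ 2)]
      have hstep : ∑ x, M.visitProb π s m x * M.vValue H π m x.1 ^ 2 +
          ∑ x, M.visitProb π s m x * M.nextVar H π m x ≤
          2 * H * ∑ x, M.visitProb π s m x * M.meanReward x +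
          ∑ x, M.visitProb π s m x * ∑ s', M.trans x s' * M.vValue H π (m + 1) s' ^ 2 := by
        rw [Finset.mul_sum, ← Finset.sum_add_distrib, ← Finset.sum_add_distrib]
        refine Finset.sum_le_sum fun x _ => ?_
        rcases (M.visitProb_nonneg π s m x).eq_or_lt with h0 | h0
        · simp [← h0]
        · have hx := M.policy_of_visitProb_pos h0
          have hV : M.vValue H π m x.1 = M.meanReward x +
              ∑ s', M.trans x s' * M.vValue H π (m + 1) s' := by
            rw [← M.qValue_eq (by omega), vValue, ← hx]
          have hr := M.meanReward_nonneg x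
          have hVH := M.vValue_le H π m x.1
          have hV0 : 0 ≤ ∑ s', M.trans x s' * M.vValue H π (m + 1) s' :=
            Finset.sum_nonneg fun s' _ => mul_nonneg (M.trans_nonneg _ _) (M.vValue_nonneg _ _ _ _)
          unfold nextVar
          set a := ∑ s', M.trans x s' * M.vValue H π (m + 1) s'
          set b := ∑ s', M.trans x s' * M.vValue H π (m + 1) s' ^ 2
          rw [hV] at hVH ⊢
          have : (M.meanReward x + a) ^ 2 + (b - a ^ 2) ≤ 2 * H * M.meanReward x + b := by nlinarith
          have := mul_le_mul_of_nonneg_left this h0.le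
          linarith
      simp only
      linarith
  have h := key H le_rfl
  rw [← M.vValue_eq_sum_visitProb] at h
  have h0 : ∑ x, M.visitProb π s H x * M.vValue H π H x.1 ^ 2 = 0 :=
    Finset.sum_eq_zero fun x _ => by rw [M.vValue_eq_zero le_rfl]; simp
  linarith

end TabularMDP

/-! ### Weighted second moments -/

section Weighted

variable {S : Type*} [Fintype S]

/-- Minkowski's inequality in weighted ℓ², by Cauchy–Schwarz for √p f and √p g. -/
lemma sqrt_sum_weighted_add_le {p : S → ℝ} (hp : ∀ s, 0 ≤ p s) (f g : S → ℝ) :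
    Real.sqrt (∑ s, p s * (f s + g s) ^ 2) ≤
      Real.sqrt (∑ s, p s * f s ^ 2) + Real.sqrt (∑ s, p s * g s ^ 2) := by
  have hf : 0 ≤ ∑ s, p s * f s ^ 2 :=
    Finset.sum_nonneg fun s _ => mul_nonneg (hp s) (sq_nonneg _)
  have hg : 0 ≤ ∑ s, p s * g s ^ 2 :=
    Finset.sum_nonneg fun s _ => mul_nonneg (hp s) (sq_nonneg _)
  have hcs : ∑ s, p s * (f s * g s) ≤
      Real.sqrt (∑ s, p s * f s ^ 2) * Real.sqrt (∑ s, p s * g s ^ 2) := by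
    rw [← Real.sqrt_mul hf]
    refine Real.le_sqrt_of_sq_le ?_
    have h := Finset.sum_mul_sq_le_sq_mul_sq Finset.univ (fun s => Real.sqrt (p s) * f s)
      (fun s => Real.sqrt (p s) * g s)
    refine le_trans (le_of_eq ?_) (h.trans (le_of_eq ?_))
    · congr 1
      refine Finset.sum_congr rfl fun s _ => ?_
      have := Real.mul_self_sqrt (hp s)
      linear_combination (-(f s * g s)) * this
    · congr 1 <;> refine Finset.sum_congr rfl fun s _ => ?_ <;>
        rw [mul_pow, Real.sq_sqrt (hp s)]
  rw [Real.sqrt_le_left (by positivity), add_sq, Real.sq_sqrt hf, Real.sq_sqrt hg]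
  calc ∑ s, p s * (f s + g s) ^ 2
      = ∑ s, p s * f s ^ 2 + 2 * ∑ s, p s * (f s * g s) + ∑ s, p s * g s ^ 2 := by
        rw [Finset.mul_sum, ← Finset.sum_add_distrib, ← Finset.sum_add_distrib]
        exact Finset.sum_congr rfl fun s _ => by ring
    _ ≤ _ := by linarith

/-- Bias–variance decomposition around an arbitrary centre. -/
lemma sum_weighted_sub_sq {p : S → ℝ} (hp1 : ∑ s, p s = 1) (f : S → ℝ) (z : ℝ) :
    ∑ s, p s * (f s - z) ^ 2 =
      (∑ s, p s * f s ^ 2 - (∑ s, p s * f s) ^ 2) + (∑ s, p s * f s - z) ^ 2 := by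
  have : ∑ s, p s * (f s - z) ^ 2 =
      ∑ s, p s * f s ^ 2 - 2 * z * ∑ s, p s * f s + z ^ 2 * ∑ s, p s := by
    rw [Finset.mul_sum, Finset.mul_sum, ← Finset.sum_sub_distrib, ← Finset.sum_add_distrib]
    exact Finset.sum_congr rfl fun s _ => by ring
  rw [this, hp1]; ring

lemma variance_le_sum_sub_sq {p : S → ℝ} (hp1 : ∑ s, p s = 1) (f : S → ℝ) (z : ℝ) :
    ∑ s, p s * f s ^ 2 - (∑ s, p s * f s) ^ 2 ≤ ∑ s, p s * (f s - z) ^ 2 := by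
  rw [sum_weighted_sub_sq hp1 f z]
  linarith [sq_nonneg (∑ s, p s * f s - z)]

lemma variance_nonneg' {p : S → ℝ} (hp : ∀ s, 0 ≤ p s) (hp1 : ∑ s, p s = 1) (f : S → ℝ) :
    0 ≤ ∑ s, p s * f s ^ 2 - (∑ s, p s * f s) ^ 2 := by
  have h := sum_weighted_sub_sq hp1 f (∑ s, p s * f s)
  have : 0 ≤ ∑ s, p s * (f s - ∑ s, p s * f s) ^ 2 :=
    Finset.sum_nonneg fun s _ => mul_nonneg (hp s) (sq_nonneg _)
  rw [h] at this
  simpa using this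

/-- The standard deviation of a truncation of `W` is controlled by that of an upper bound `U`
of `W`. -/
lemma sqrt_variance_min_le {p : S → ℝ} (hp : ∀ s, 0 ≤ p s) (hp1 : ∑ s, p s = 1) {W U : S → ℝ}
    (hW : ∀ s, 0 ≤ W s) (hWU : ∀ s, W s ≤ U s) {c : ℝ} (hc : 0 ≤ c) :
    Real.sqrt (∑ s, p s * min (W s) c ^ 2 - (∑ s, p s * min (W s) c) ^ 2) ≤
      Real.sqrt (∑ s, p s * U s ^ 2 - (∑ s, p s * U s) ^ 2)
        + Real.sqrt (c * ∑ s, p s * (U s - W s)) := by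
  set m := ∑ s, p s * U s with hm
  have h1 : Real.sqrt (∑ s, p s * min (W s) c ^ 2 - (∑ s, p s * min (W s) c) ^ 2) ≤
      Real.sqrt (∑ s, p s * ((min (U s) c - min m c) + (min (W s) c - min (U s) c)) ^ 2) := by
    -- With the centre min(m, c), the 1-Lipschitz truncation is compared with U − m. The remainder
    -- min(U, c) − min(W, c) lies in [0, c] and is at most U − W, so its square is at most c (U −
    -- W).
    refine Real.sqrt_le_sqrt ((variance_le_sum_sub_sq hp1 _ (min m c)).trans (le_of_eq ?_))
    exact Finset.sum_congr rfl fun s _ => by ring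
  refine h1.trans ((sqrt_sum_weighted_add_le hp _ _).trans (add_le_add ?_ ?_))
  · refine Real.sqrt_le_sqrt ?_
    have e := sum_weighted_sub_sq hp1 U m
    rw [← hm, sub_self, zero_pow two_ne_zero, add_zero] at e
    rw [← e]
    refine Finset.sum_le_sum fun s _ => mul_le_mul_of_nonneg_left ?_ (hp s)
    rw [← sq_abs, ← sq_abs (U s - m)]
    exact pow_le_pow_left₀ (abs_nonneg _) (by
      have := abs_min_sub_min_le_max (U s) c m c
      simpa using this) 2
  · refine Real.sqrt_le_sqrt ?_
    rw [Finset.mul_sum]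
    refine Finset.sum_le_sum fun s _ => ?_
    rw [mul_left_comm]
    refine mul_le_mul_of_nonneg_left ?_ (hp s)
    have h2 := hWU s
    have h3 := hW s
    rcases le_total (W s) c with a | a <;> rcases le_total (U s) c with b | b
    · rw [min_eq_left a, min_eq_left b]; nlinarith
    · rw [min_eq_left a, min_eq_right b]; nlinarith
    · rw [min_eq_right a, min_eq_left b]; nlinarith
    · rw [min_eq_right a, min_eq_right b, sub_self, zero_pow two_ne_zero]
      nlinarith

/-- Two weight vectors of equal total mass, integrated against a bounded function. -/
lemma sum_sub_mul_le_of_l1 {p q : S → ℝ} (hpq : ∑ s, p s = ∑ s, q s) {ε : ℝ}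
    (hε : ∑ s, |p s - q s| ≤ ε) {F : S → ℝ} {b : ℝ} (hb : 0 ≤ b) (hF0 : ∀ s, 0 ≤ F s)
    (hFb : ∀ s, F s ≤ 2 * b) : |∑ s, (p s - q s) * F s| ≤ b * ε := by
  -- Equal masses allow the midpoint b of the range to be subtracted, which gains a factor 2.
  have e : ∑ s, (p s - q s) * F s = ∑ s, (p s - q s) * (F s - b) := by
    have : ∑ s, (p s - q s) * b = 0 := by
      rw [← Finset.sum_mul, Finset.sum_sub_distrib, hpq, sub_self, zero_mul]
    rw [← sub_eq_zero, ← Finset.sum_sub_distrib, ← this]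
    exact Finset.sum_congr rfl fun s _ => by ring
  rw [e]
  calc |∑ s, (p s - q s) * (F s - b)| ≤ ∑ s, |(p s - q s) * (F s - b)| :=
        Finset.abs_sum_le_sum_abs _ _
    _ ≤ ∑ s, |p s - q s| * b := by
        refine Finset.sum_le_sum fun s _ => ?_
        rw [abs_mul]
        refine mul_le_mul_of_nonneg_left ?_ (abs_nonneg _)
        rw [abs_le]; constructor <;> linarith [hF0 s, hFb s]
    _ = b * ∑ s, |p s - q s| := by rw [← Finset.sum_mul, mul_comm]
    _ ≤ b * ε := mul_le_mul_of_nonneg_left hε hb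

end Weighted

/-! ### One-step confidence bounds -/

section OneStep

/-- Absorption of the deviation in a self-normalised bound. -/
lemma selfNormalized_absorb {φ c v mh mb m β : ℝ} (hφ : 0 ≤ φ) (hφ' : φ ^ 2 ≤ 2 / 53)
    (hc : 0 ≤ c) (hv : 0 ≤ v) (hvc : v + (mh - m) ^ 2 ≤ c ^ 2) (hβ : |mb - m| ≤ β)
    (h : |mh - mb| ≤ 3.63 * φ * Real.sqrt (v + (mh - m) ^ 2) + 5.6 * c * φ ^ 2) :
    |mh - mb| ≤ 3.63 * φ * Real.sqrt v + 3.63 * φ * β + 23 * c * φ ^ 2 := by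
  have hφ2 : φ ≤ 0.1943 := by
    by_contra hlt
    push Not at hlt
    nlinarith
  have h1 : Real.sqrt (v + (mh - m) ^ 2) ≤ c := Real.sqrt_le_iff.2 ⟨hc, hvc⟩
  have h2 : Real.sqrt (v + (mh - m) ^ 2) ≤ Real.sqrt v + |mh - m| := by
    refine Real.sqrt_le_iff.2 ⟨by positivity, ?_⟩
    rw [add_sq, Real.sq_sqrt hv, sq_abs]
    have : 0 ≤ Real.sqrt v * |mh - m| := by positivity
    linarith
  -- The crude bound c for the root gives a first estimate of |mh − m|, which is fed back into the
  -- root. The resulting coefficient 3.63² + 5.6 + 3.63 · 5.6 · 0.1943 is below 23.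
  have h3 : |mh - m| ≤ β + 3.63 * φ * c + 5.6 * c * φ ^ 2 := by
    calc |mh - m| = |(mh - mb) + (mb - m)| := by ring_nf
      _ ≤ |mh - mb| + |mb - m| := abs_add_le _ _
      _ ≤ (3.63 * φ * c + 5.6 * c * φ ^ 2) + β := by
        refine add_le_add (h.trans ?_) hβ
        gcongr
      _ = _ := by ring
  have h4 : φ * φ ^ 2 * c ≤ 0.1943 * (φ ^ 2 * c) := by
    rw [mul_assoc]; gcongr
  have h5 : 0 ≤ φ ^ 2 * c := by positivity
  calc |mh - mb| ≤ 3.63 * φ * Real.sqrt (v + (mh - m) ^ 2) + 5.6 * c * φ ^ 2 := h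
    _ ≤ 3.63 * φ * (Real.sqrt v + (β + 3.63 * φ * c + 5.6 * c * φ ^ 2)) + 5.6 * c * φ ^ 2 := by
        gcongr
        linarith
    _ = 3.63 * φ * Real.sqrt v + 3.63 * φ * β + (3.63 ^ 2 + 5.6) * (φ ^ 2 * c)
          + 3.63 * 5.6 * (φ * φ ^ 2 * c) := by ring
    _ ≤ _ := by nlinarith

/-- AM–GM with a free parameter; 3.3 exceeds 3.63²/4. With τ of order 1/H it trades a root for a 1/H
fraction of the quantity itself and a φ² term. -/
lemma width_mul_sqrt_le {φ p τ : ℝ} (hp : 0 ≤ p) (hτ : 0 < τ) :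
    3.63 * φ * Real.sqrt p ≤ τ * p + 3.3 / τ * φ ^ 2 := by
  set q := Real.sqrt p with hq
  have hq2 : q ^ 2 = p := Real.sq_sqrt hp
  have h2 : 0 ≤ τ * (q - 3.63 / 2 * (φ / τ)) ^ 2 := by positivity
  have h3 : τ * (q - 3.63 / 2 * (φ / τ)) ^ 2 =
      τ * q ^ 2 - 3.63 * φ * q + (3.63 / 2) ^ 2 * (φ ^ 2 / τ) := by
    field_simp
    ring
  have h4 : 0 ≤ φ ^ 2 / τ := by positivity
  have h5 : 3.3 / τ * φ ^ 2 = 3.3 * (φ ^ 2 / τ) := by ring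
  rw [h5, ← hq2]
  linarith

lemma upper_const_le {c H Sh : ℝ} (hc : 1 ≤ c) (hH : 1 ≤ H) (hSh : 1 ≤ Sh) :
    23 + 23 * c + 3.3 * c * H ≤ 53 * Sh * H * c := by
  have a1 : c ≤ c * H := by nlinarith
  have a2 : c * H ≤ Sh * (c * H) := by nlinarith
  linarith

/-- The φ² coefficients collected in `ConcAt.lower_backup_le` must fit below that of the bonus. At c
= H = Sh = 1 the left side is 66.2, so H = 1 has to be excluded. -/
lemma lower_const_le {c H Sh : ℝ} (hc : 1 ≤ c) (hH : 2 ≤ H) (hSh : 1 ≤ Sh) :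
    23 + 23 * c + 3.3 * c * H + 8 * H + Sh * (c * (3.3 * H + 5.6)) ≤ 53 * Sh * H * c := by
  have a1 : 2 * c ≤ c * H := by nlinarith
  have a2 : c * H ≤ Sh * (c * H) := by nlinarith
  have a3 : H ≤ c * H := by nlinarith
  have a4 : Sh * (2 * c) ≤ Sh * (c * H) := by gcongr
  linarith

variable {S : Type*} [Fintype S]

open Classical in
/-- The confidence statements for one state-action pair: `P`, `r` are the true quantities, `Pb`,
`rb` the averages of the conditional expectations of the observations and `Ph`, `rh`, `r2` the
averages of the observations. -/
structure ConcAt (P Pb Ph : S → ℝ) (r rb rh r2 ε φ c : ℝ) (f : S → ℝ) : Prop where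
  P_nonneg : ∀ s, 0 ≤ P s
  P_sum : ∑ s, P s = 1
  Ph_nonneg : ∀ s, 0 ≤ Ph s
  Ph_sum : ∑ s, Ph s = 1
  Pb_sum : ∑ s, Pb s = 1
  r_nonneg : 0 ≤ r
  r_le : r ≤ 1
  rh_nonneg : 0 ≤ rh
  rh_le : rh ≤ 1
  sq_le : rh ^ 2 ≤ r2
  r2_le : r2 ≤ rh
  ε_nonneg : 0 ≤ ε
  φ_nonneg : 0 ≤ φ
  bias_r : |rb - r| ≤ ε
  bias_P : ∑ s, |Pb s - P s| ≤ ε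
  dev_r : |rh - rb| ≤ 3.63 * φ * Real.sqrt ((r2 - rh ^ 2) + (rh - r) ^ 2) + 5.6 * φ ^ 2
  dev_f : |∑ s, Ph s * f s - ∑ s, Pb s * f s| ≤
    3.63 * φ * Real.sqrt (∑ s, Ph s * (f s - ∑ s, P s * f s) ^ 2) + 5.6 * c * φ ^ 2
  dev_P : ∀ s, P s ≠ 0 → |Ph s - Pb s| ≤ 3.63 * φ * Real.sqrt (Ph s) + 5.6 * φ ^ 2
  dev_out : ∑ s, (if P s = 0 then Ph s else 0) ≤
    2 * ∑ s, (if P s = 0 then Pb s else 0) + 8 * φ ^ 2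

namespace ConcAt

variable {P Pb Ph : S → ℝ} {r rb rh r2 ε φ c : ℝ} {f : S → ℝ}

/-- The self-normalised bound measures the spread around the unknown mean r; absorption replaces it
by the sample variance, which the algorithm can compute. -/
lemma dev_reward (h : ConcAt P Pb Ph r rb rh r2 ε φ c f) (hφ : φ ^ 2 ≤ 2 / 53) (hε : ε ≤ 1) :
    |rh - r| ≤ 4 * φ * Real.sqrt (r2 - rh ^ 2) + 4 * φ * Real.sqrt ε + 23 * φ ^ 2 + ε := by
  have hv : 0 ≤ r2 - rh ^ 2 := by linarith [h.sq_le]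
  have hb : (r2 - rh ^ 2) + (rh - r) ^ 2 ≤ 1 ^ 2 := by
    have h1 := h.r2_le
    have h2 := h.rh_le
    have h3 := h.rh_nonneg
    have h4 := h.r_le
    have h5 := h.r_nonneg
    nlinarith
  have h1 := selfNormalized_absorb (c := 1) h.φ_nonneg hφ zero_le_one hv hb h.bias_r
    (by simpa using h.dev_r)
  have h2 : |rh - r| ≤ |rh - rb| + |rb - r| := by
    calc |rh - r| = |(rh - rb) + (rb - r)| := by ring_nf
      _ ≤ _ := abs_add_le _ _
  have h3 : ε ≤ Real.sqrt ε := by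
    refine Real.le_sqrt_of_sq_le ?_
    nlinarith [h.ε_nonneg]
  have h4 := h.bias_r
  have h5 := mul_le_mul_of_nonneg_left h3 h.φ_nonneg
  have h6 := mul_nonneg h.φ_nonneg (Real.sqrt_nonneg (r2 - rh ^ 2))
  have h7 := mul_nonneg h.φ_nonneg (Real.sqrt_nonneg ε)
  linarith

/-- Deviation of the truncated optimal values, relative to the average conditional law. -/
lemma dev_truncated {W U : S → ℝ} (h : ConcAt P Pb Ph r rb rh r2 ε φ c (fun s => min (W s) c))
    (hφ : φ ^ 2 ≤ 2 / 53) (hε : ε ≤ 1) (hc : 1 ≤ c) {H : ℝ} (hcH : c ≤ H)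
    (hW : ∀ s, 0 ≤ W s) (hWU : ∀ s, W s ≤ U s) :
    |∑ s, Ph s * min (W s) c - ∑ s, Pb s * min (W s) c| ≤
      4 * φ * Real.sqrt (∑ s, Ph s * U s ^ 2 - (∑ s, Ph s * U s) ^ 2)
        + 1 / H * ∑ s, Ph s * (U s - W s) + 2 * H * φ * Real.sqrt ε
        + (23 * c + 3.3 * c * H) * φ ^ 2 := by
  have hH : 0 < H := by linarith
  have hφ0 := h.φ_nonneg
  have hf0 : ∀ s, 0 ≤ min (W s) c := fun s => le_min (hW s) (by linarith)
  have hfc : ∀ s, min (W s) c ≤ c := fun s => min_le_right _ _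
  have hm0 : 0 ≤ ∑ s, P s * min (W s) c :=
    Finset.sum_nonneg fun s _ => mul_nonneg (h.P_nonneg s) (hf0 s)
  have hmc : ∑ s, P s * min (W s) c ≤ c := by
    calc ∑ s, P s * min (W s) c ≤ ∑ s, P s * c :=
          Finset.sum_le_sum fun s _ => mul_le_mul_of_nonneg_left (hfc s) (h.P_nonneg s)
      _ = c := by rw [← Finset.sum_mul, h.P_sum, one_mul]
  have hbias : |∑ s, Pb s * min (W s) c - ∑ s, P s * min (W s) c| ≤ c / 2 * ε := by
    rw [← Finset.sum_sub_distrib]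
    simp only [← sub_mul]
    exact sum_sub_mul_le_of_l1 (by rw [h.Pb_sum, h.P_sum]) h.bias_P (by linarith) hf0
      (fun s => by linarith [hfc s])
  have e := sum_weighted_sub_sq h.Ph_sum (fun s => min (W s) c) (∑ s, P s * min (W s) c)
  have hsq : ∑ s, Ph s * (min (W s) c - ∑ s, P s * min (W s) c) ^ 2 ≤ c ^ 2 := by
    calc _ ≤ ∑ s, Ph s * c ^ 2 := by
          refine Finset.sum_le_sum fun s _ => mul_le_mul_of_nonneg_left ?_ (h.Ph_nonneg s)
          refine sq_le_sq' ?_ ?_ <;> linarith [hf0 s, hfc s]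
      _ = c ^ 2 := by rw [← Finset.sum_mul, h.Ph_sum, one_mul]
  have hdev := h.dev_f
  rw [e] at hdev hsq
  have h1 := selfNormalized_absorb hφ0 hφ (by linarith)
    (variance_nonneg' h.Ph_nonneg h.Ph_sum _) hsq hbias hdev
  have h2 := sqrt_variance_min_le h.Ph_nonneg h.Ph_sum hW hWU (c := c) (by linarith)
  set σ := Real.sqrt (∑ s, Ph s * U s ^ 2 - (∑ s, Ph s * U s) ^ 2) with hσ
  set g := ∑ s, Ph s * (U s - W s) with hg
  have hg0 : 0 ≤ g := Finset.sum_nonneg fun s _ =>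
    mul_nonneg (h.Ph_nonneg s) (by linarith [hWU s])
  -- With τ = 1/(cH), the price of replacing the truncated W by U in the standard deviation becomes
  -- a 1/H fraction of the gap plus a φ² term.
  have h3 : 3.63 * φ * Real.sqrt (c * g) ≤ 1 / H * g + 3.3 * c * H * φ ^ 2 := by
    have hcpos : 0 < c := by linarith
    have := width_mul_sqrt_le (φ := φ) (p := c * g) (τ := 1 / (c * H)) (by positivity)
      (by positivity)
    refine this.trans (le_of_eq ?_)
    field_simp
  have hse : ε ≤ Real.sqrt ε := by
    refine Real.le_sqrt_of_sq_le ?_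
    nlinarith [h.ε_nonneg]
  have h4 : 3.63 * φ * (c / 2 * ε) ≤ 2 * H * φ * Real.sqrt ε := by
    have : c * ε ≤ H * Real.sqrt ε := mul_le_mul hcH hse h.ε_nonneg hH.le
    have h7 := mul_le_mul_of_nonneg_left this hφ0
    have h8 : 0 ≤ φ * (H * Real.sqrt ε) := by positivity
    nlinarith
  have h5 := mul_le_mul_of_nonneg_left h2 hφ0
  have h6 : 0 ≤ φ * σ := mul_nonneg hφ0 (Real.sqrt_nonneg _)
  nlinarith

/-- Optimism. The function min(W, c) does not depend on the data, so a single deviation bound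
suffices. It agrees with W wherever P has mass and lies below U everywhere, so truncation loses
nothing; the bonus pays for the deviations and the bias. -/
lemma upper_backup_ge {W U L : S → ℝ} {H Sh : ℝ}
    (h : ConcAt P Pb Ph r rb rh r2 ε φ c (fun s => min (W s) c))
    (hφ : φ ^ 2 ≤ 2 / 53) (hε : ε ≤ 1) (hc : 1 ≤ c) (hcH : c ≤ H) (hSh : 1 ≤ Sh)
    (hW : ∀ s, 0 ≤ W s) (hWU : ∀ s, W s ≤ U s) (hLW : ∀ s, L s ≤ W s)
    (hWc : ∀ s, 0 < P s → W s ≤ c) :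
    r + ∑ s, P s * W s ≤ rh + ∑ s, Ph s * U s +
      (4 * (Real.sqrt (r2 - rh ^ 2) + 2 * Real.sqrt ε * H +
        Real.sqrt (∑ s, Ph s * U s ^ 2 - (∑ s, Ph s * U s) ^ 2)) * φ
      + 53 * Sh * H * c * φ ^ 2 + 1 / H * ∑ s, Ph s * (U s - L s) + (H + 1) * ε) := by
  have hH : 1 ≤ H := by linarith
  have hφ0 := h.φ_nonneg
  have h1 := (abs_le.1 (h.dev_reward hφ hε)).1
  have h2 := (abs_le.1 (h.dev_truncated hφ hε hc hcH hW hWU)).1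
  have hf0 : ∀ s, 0 ≤ min (W s) c := fun s => le_min (hW s) (by linarith)
  have hbias := (abs_le.1 (sum_sub_mul_le_of_l1 (b := c / 2) (by rw [h.Pb_sum, h.P_sum]) h.bias_P
    (by linarith) hf0 (fun s => by linarith [min_le_right (W s) c]))).1
  simp only [sub_mul, Finset.sum_sub_distrib] at hbias
  have h3 : ∑ s, P s * W s = ∑ s, P s * min (W s) c := by
    refine Finset.sum_congr rfl fun s _ => ?_
    rcases (h.P_nonneg s).eq_or_lt with h0 | h0
    · simp [← h0]
    · rw [min_eq_left (hWc s h0)]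
  have h4 : ∑ s, Ph s * min (W s) c ≤ ∑ s, Ph s * U s :=
    Finset.sum_le_sum fun s _ => mul_le_mul_of_nonneg_left
      ((min_le_left _ _).trans (hWU s)) (h.Ph_nonneg s)
  have h5 : 1 / H * ∑ s, Ph s * (U s - W s) ≤ 1 / H * ∑ s, Ph s * (U s - L s) := by
    gcongr with s _
    · exact h.Ph_nonneg s
    · exact hLW s
  have h6 : (23 + 23 * c + 3.3 * c * H) * φ ^ 2 ≤ 53 * Sh * H * c * φ ^ 2 := by
    refine mul_le_mul_of_nonneg_right ?_ (sq_nonneg _)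
    exact upper_const_le hc hH hSh
  have h7 : 4 * φ * Real.sqrt ε ≤ 4 * (φ * Real.sqrt ε * H) := by
    have : 0 ≤ φ * Real.sqrt ε := by positivity
    nlinarith
  have h8 : 0 ≤ φ * Real.sqrt ε * H := by positivity
  have h9 : c / 2 * ε ≤ H * ε := by
    have := h.ε_nonneg
    gcongr
    linarith
  rw [h3]
  linarith

open Classical in
/-- Deviation of the transition frequencies on the support, uniformly over functions. -/
lemma sum_support_sub_le {W V : S → ℝ} {H Sh : ℝ} (h : ConcAt P Pb Ph r rb rh r2 ε φ c f)
    (hc : 0 ≤ c) (hH0 : 0 < H) (hSh : ((Finset.univ.filter fun s => P s ≠ 0).card : ℝ) ≤ Sh)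
    (hV : ∀ s, 0 ≤ V s) (hVW : ∀ s, V s ≤ W s) (hWc : ∀ s, 0 < P s → W s ≤ c) :
    ∑ s, (1 - if P s = 0 then 1 else 0) * Pb s * (W s - V s)
        - ∑ s, (1 - if P s = 0 then 1 else 0) * Ph s * (W s - V s) ≤
      1 / H * ∑ s, Ph s * (W s - V s) + Sh * (c * (3.3 * H + 5.6) * φ ^ 2) := by
  have hterm : ∀ s, (1 - if P s = 0 then 1 else 0) * Pb s * (W s - V s)
      - (1 - if P s = 0 then 1 else 0) * Ph s * (W s - V s) ≤
      1 / H * (Ph s * (W s - V s)) + (if P s ≠ 0 then c * (3.3 * H + 5.6) * φ ^ 2 else 0) := by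
    intro s
    have hg0 : 0 ≤ W s - V s := by linarith [hVW s]
    have hph := h.Ph_nonneg s
    by_cases hs : P s = 0
    · simp only [hs, ne_eq, not_true_eq_false, if_false, if_true]
      have : 0 ≤ 1 / H * (Ph s * (W s - V s)) := by positivity
      linarith
    · simp only [ne_eq, hs, not_false_eq_true, if_true, if_false]
      have hd := (abs_le.1 (h.dev_P s hs)).1
      have hpos : 0 < P s := lt_of_le_of_ne (h.P_nonneg s) (Ne.symm hs)
      have hgc : W s - V s ≤ c := by linarith [hWc s hpos, hV s]
      -- Each support state takes a 1/H share of its own empirical mass and a term of order Hφ²; the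
      -- latter is summed over at most Sh states.
      have k1 := width_mul_sqrt_le (φ := φ) hph (τ := 1 / H) (by positivity)
      have k2 : 3.3 / (1 / H) = 3.3 * H := by field_simp
      rw [k2] at k1
      have k5 : Pb s - Ph s ≤ 1 / H * Ph s + (3.3 * H + 5.6) * φ ^ 2 := by linarith
      have k6 := mul_le_mul_of_nonneg_right k5 hg0
      have k7 : (3.3 * H + 5.6) * φ ^ 2 * (W s - V s) ≤ (3.3 * H + 5.6) * φ ^ 2 * c := by
        gcongr
      linarith
  rw [← Finset.sum_sub_distrib, Finset.mul_sum]
  refine (Finset.sum_le_sum fun s _ => hterm s).trans ?_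
  rw [Finset.sum_add_distrib, ← Finset.sum_filter, Finset.sum_const, nsmul_eq_mul]
  gcongr

open Classical in
-- The value V of the played policy depends on the data, so no deviation bound for it is available.
-- It is written as W − (W − V): the truncation of W is fixed, W − V is handled state by state on
-- the support by `sum_support_sub_le`, and a state off the support costs at most H − c times its
-- mass. The gaps U − W and W − V add up to at most U − L, so the one 1/H term of the bonus pays for
-- both.
lemma lower_backup_le {W V U L : S → ℝ} {H Sh : ℝ}
    (h : ConcAt P Pb Ph r rb rh r2 ε φ c (fun s => min (W s) c))
    (hφ : φ ^ 2 ≤ 2 / 53) (hε : ε ≤ 1) (hc : 1 ≤ c) (hcH : c ≤ H) (hH2 : 2 ≤ H) (hSh1 : 1 ≤ Sh)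
    (hSh : ((Finset.univ.filter fun s => P s ≠ 0).card : ℝ) ≤ Sh)
    (hV : ∀ s, 0 ≤ V s) (hLV : ∀ s, L s ≤ V s) (hVW : ∀ s, V s ≤ W s) (hWU : ∀ s, W s ≤ U s)
    (hWH : ∀ s, W s ≤ H) (hWc : ∀ s, 0 < P s → W s ≤ c) :
    rh + ∑ s, Ph s * L s -
      (4 * (Real.sqrt (r2 - rh ^ 2) + 2 * Real.sqrt ε * H +
        Real.sqrt (∑ s, Ph s * U s ^ 2 - (∑ s, Ph s * U s) ^ 2)) * φ
      + 53 * Sh * H * c * φ ^ 2 + 1 / H * ∑ s, Ph s * (U s - L s) + (H + 1) * ε)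
      ≤ r + ∑ s, P s * V s := by
  have hH0 : 0 < H := by linarith
  have hφ0 := h.φ_nonneg
  have hW : ∀ s, 0 ≤ W s := fun s => (hV s).trans (hVW s)
  have h1 := (abs_le.1 (h.dev_reward hφ hε)).2
  have h2 := (abs_le.1 (h.dev_truncated hφ hε hc hcH hW hWU)).2
  set a : S → ℝ := fun s => if P s = 0 then 1 else 0 with ha
  -- One function with values in [0, 2H] collects all biases, so that a single estimate bounds them
  -- by Hε. The 2(H − c) off the support matches the factor 2 in `dev_out`.
  set F : S → ℝ := fun s => min (W s) c - (1 - a s) * (W s - V s) + 2 * (H - c) * a s with hF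
  have hpos : ∀ s, P s ≠ 0 → 0 < P s := fun s hs => lt_of_le_of_ne (h.P_nonneg s) (Ne.symm hs)
  have hFeq : ∀ s, P s ≠ 0 → F s = V s := by
    intro s hs
    simp only [hF, ha, if_neg hs]
    rw [min_eq_left (hWc s (hpos s hs))]; ring
  have hFeq' : ∀ s, P s = 0 → F s = min (W s) c + 2 * (H - c) := by
    intro s hs
    simp only [hF, ha, if_pos hs]; ring
  have hbias := (abs_le.1 (sum_sub_mul_le_of_l1 (F := F) (b := H) (by rw [h.Pb_sum, h.P_sum])
    h.bias_P (by linarith) (fun s => by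
      by_cases hs : P s = 0
      · rw [hFeq' s hs]
        have := le_min (hW s) (by linarith : 0 ≤ c)
        linarith
      · rw [hFeq s hs]; exact hV s) (fun s => by
      by_cases hs : P s = 0
      · rw [hFeq' s hs]
        have := min_le_right (W s) c
        linarith
      · rw [hFeq s hs]
        linarith [hVW s, hWH s]))).2
  have hPF : ∑ s, P s * F s = ∑ s, P s * V s := by
    refine Finset.sum_congr rfl fun s _ => ?_
    by_cases hs : P s = 0
    · simp [hs]
    · rw [hFeq s hs]
  have hPbF : ∑ s, Pb s * F s = ∑ s, Pb s * min (W s) c - ∑ s, (1 - a s) * Pb s * (W s - V s)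
      + 2 * (H - c) * ∑ s, (if P s = 0 then Pb s else 0) := by
    rw [Finset.mul_sum, ← Finset.sum_sub_distrib, ← Finset.sum_add_distrib]
    refine Finset.sum_congr rfl fun s _ => ?_
    by_cases hs : P s = 0
    · simp only [hF, ha, if_pos hs]; ring
    · simp only [hF, ha, if_neg hs]; ring
  simp only [sub_mul, Finset.sum_sub_distrib] at hbias
  rw [hPF, hPbF] at hbias
  have hout := h.dev_out
  have hPhV : ∑ s, Ph s * V s ≤ ∑ s, Ph s * min (W s) c - ∑ s, (1 - a s) * Ph s * (W s - V s)
      + (H - c) * ∑ s, (if P s = 0 then Ph s else 0) := by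
    rw [Finset.mul_sum, ← Finset.sum_sub_distrib, ← Finset.sum_add_distrib]
    refine Finset.sum_le_sum fun s _ => ?_
    by_cases hs : P s = 0
    · simp only [ha, if_pos hs]
      have : V s ≤ min (W s) c + (H - c) := by
        rcases le_total (W s) c with b | b
        · rw [min_eq_left b]; linarith [hVW s]
        · rw [min_eq_right b]; linarith [hVW s, hWH s]
      have := mul_le_mul_of_nonneg_left this (h.Ph_nonneg s)
      linarith
    · simp only [ha, if_neg hs]
      rw [min_eq_left (hWc s (hpos s hs))]
      linarith
  have hstates := h.sum_support_sub_le (by linarith) hH0 hSh hV hVW hWc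
  have hL : ∑ s, Ph s * L s ≤ ∑ s, Ph s * V s :=
    Finset.sum_le_sum fun s _ => mul_le_mul_of_nonneg_left (hLV s) (h.Ph_nonneg s)
  have hcomb : 1 / H * ∑ s, Ph s * (U s - W s) + 1 / H * ∑ s, Ph s * (W s - V s) ≤
      1 / H * ∑ s, Ph s * (U s - L s) := by
    rw [← mul_add, ← Finset.sum_add_distrib]
    gcongr with s _
    have := mul_le_mul_of_nonneg_left (hLV s) (h.Ph_nonneg s)
    linarith
  have hout' : (H - c) * ∑ s, (if P s = 0 then Ph s else 0) ≤
      2 * (H - c) * ∑ s, (if P s = 0 then Pb s else 0) + 8 * H * φ ^ 2 := by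
    have k1 := mul_le_mul_of_nonneg_left hout (by linarith : 0 ≤ H - c)
    have k2 : (H - c) * φ ^ 2 ≤ H * φ ^ 2 := by gcongr; linarith
    linarith
  have h6 : (23 + 23 * c + 3.3 * c * H + 8 * H + Sh * (c * (3.3 * H + 5.6))) * φ ^ 2
      ≤ 53 * Sh * H * c * φ ^ 2 := by
    refine mul_le_mul_of_nonneg_right ?_ (sq_nonneg _)
    exact lower_const_le hc hH2 hSh1
  have h7 : 4 * φ * Real.sqrt ε ≤ 4 * (φ * Real.sqrt ε * H) := by
    have : 0 ≤ φ * Real.sqrt ε := by positivity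
    nlinarith
  have h8 : 0 ≤ φ * Real.sqrt ε * H := by positivity
  linarith

end ConcAt

end OneStep

/-! ### One-step bound on the gap between upper and lower values -/

section Gap

lemma sqrt_add_le' {a b : ℝ} (ha : 0 ≤ a) (hb : 0 ≤ b) :
    Real.sqrt (a + b) ≤ Real.sqrt a + Real.sqrt b := by
  refine Real.sqrt_le_iff.2 ⟨by positivity, ?_⟩
  rw [add_sq, Real.sq_sqrt ha, Real.sq_sqrt hb]
  have : 0 ≤ Real.sqrt a * Real.sqrt b := by positivity
  linarith

lemma sqrt_second_moment_le {σ2 ε φ H Q Sh : ℝ} (hσ : 0 ≤ σ2) (hε : 0 ≤ ε) (hφ : 0 ≤ φ)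
    (hH : 0 ≤ H) (hQ : 0 ≤ Q) (hSh : 1 ≤ Sh) :
    Real.sqrt (2 * σ2 + 4 * H ^ 2 * ε
      + (2 * Sh * Q ^ 2 * (3.3 / (1 / 2) + 5.6) + 8 * H ^ 2) * φ ^ 2) ≤
    1.5 * Real.sqrt σ2 + 2 * (H * Real.sqrt ε) + (5 * Sh * Q + 3 * H) * φ := by
  refine Real.sqrt_le_iff.2 ⟨by positivity, ?_⟩
  have e1 := Real.sq_sqrt hσ
  have e2 := Real.sq_sqrt hε
  set x := Real.sqrt σ2
  set y := Real.sqrt ε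
  have hx : 0 ≤ x := Real.sqrt_nonneg _
  have hy : 0 ≤ y := Real.sqrt_nonneg _
  have b1 : 0 ≤ x * (H * y) := by positivity
  have b2 : 0 ≤ x * ((5 * Sh * Q + 3 * H) * φ) := by positivity
  have b3 : 0 ≤ H * y * ((5 * Sh * Q + 3 * H) * φ) := by positivity
  have b4 : 0 ≤ Sh * Q * H * φ ^ 2 := by positivity
  have b7 : 0 ≤ Sh * Q ^ 2 * φ ^ 2 := by positivity
  have b5 : Sh * Q ^ 2 * φ ^ 2 ≤ Sh * (Sh * Q ^ 2 * φ ^ 2) := le_mul_of_one_le_left b7 hSh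
  have b6 : 0 ≤ H ^ 2 * φ ^ 2 := by positivity
  have e3 : (1.5 * x + 2 * (H * y) + (5 * Sh * Q + 3 * H) * φ) ^ 2 =
    2.25 * x ^ 2 + 4 * (H ^ 2 * y ^ 2) + 25 * (Sh * (Sh * Q ^ 2 * φ ^ 2)) + 9 * (H ^ 2 * φ ^ 2)
    + 30 * (Sh * Q * H * φ ^ 2)
    + 6 * (x * (H * y)) + 3 * (x * ((5 * Sh * Q + 3 * H) * φ))
    + 4 * (H * y * ((5 * Sh * Q + 3 * H) * φ)) := by ring
  rw [e3, e1, e2]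
  clear_value x y
  generalize hA : Sh * (Sh * Q ^ 2 * φ ^ 2) = A at *
  generalize hB : x * ((5 * Sh * Q + 3 * H) * φ) = B at *
  generalize hC : H * y * ((5 * Sh * Q + 3 * H) * φ) = C at *
  linarith

variable {S : Type*} [Fintype S]

namespace ConcAt

variable {P Pb Ph : S → ℝ} {r rb rh r2 ε φ c : ℝ} {f : S → ℝ}

open Classical in
lemma out_le (h : ConcAt P Pb Ph r rb rh r2 ε φ c f) :
    ∑ s, (if P s = 0 then Ph s else 0) ≤ 2 * ε + 8 * φ ^ 2 := by
  have h1 : ∑ s, (if P s = 0 then Pb s else 0) ≤ ε := by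
    refine le_trans (Finset.sum_le_sum fun s _ => ?_) h.bias_P
    split_ifs with hs
    · rw [hs, sub_zero]; exact le_abs_self _
    · exact abs_nonneg _
  linarith [h.dev_out]

open Classical in
/-- Empirical expectations of nonnegative functions are controlled by true ones. -/
lemma expect_le (h : ConcAt P Pb Ph r rb rh r2 ε φ c f) {G : S → ℝ} {q b τ Sh : ℝ}
    (hG : ∀ s, 0 ≤ G s) (hq : ∀ s, 0 < P s → G s ≤ q) (hb : ∀ s, G s ≤ b) (hq0 : 0 ≤ q)
    (hτ : 0 < τ) (hτ' : τ ≤ 1 / 2)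
    (hSh : ((Finset.univ.filter fun s => P s ≠ 0).card : ℝ) ≤ Sh) (hb0 : 0 ≤ b) :
    ∑ s, Ph s * G s ≤ (1 + 2 * τ) * ∑ s, P s * G s + 4 * b * ε
      + (2 * Sh * q * (3.3 / τ + 5.6) + 8 * b) * φ ^ 2 := by
  set k := 3.3 / τ + 5.6 with hk
  have hk0 : 0 ≤ k := by positivity
  have hterm : ∀ s, Ph s * G s ≤ (1 + 2 * τ) * (P s * G s) + 2 * b * |Pb s - P s|
      + 2 * (if P s ≠ 0 then q * k * φ ^ 2 else 0) + b * (if P s = 0 then Ph s else 0) := by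
    intro s
    have hph := h.Ph_nonneg s
    have hg := hG s
    have habs := abs_nonneg (Pb s - P s)
    by_cases hs : P s = 0
    · simp only [hs, ne_eq, not_true_eq_false, if_false, if_true]
      have h1 : Ph s * G s ≤ Ph s * b := mul_le_mul_of_nonneg_left (hb s) hph
      rw [hs] at habs
      have h2 : 0 ≤ 2 * b * |Pb s - 0| := by positivity
      linarith
    · have hpos : 0 < P s := lt_of_le_of_ne (h.P_nonneg s) (Ne.symm hs)
      simp only [ne_eq, hs, not_false_eq_true, if_true, if_false]
      have hd := (abs_le.1 (h.dev_P s hs)).2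
      have h1 := width_mul_sqrt_le (φ := φ) hph hτ
      have h2 : (1 - τ) * Ph s ≤ Pb s + k * φ ^ 2 := by rw [hk]; linarith
      -- For τ ≤ 1/2, (1 + 2τ)(1 − τ) ≥ 1, so the factor 1 − τ can be inverted.
      have h3 : Ph s ≤ (1 + 2 * τ) * (Pb s + k * φ ^ 2) := by
        have h4 : (1 + 2 * τ) * ((1 - τ) * Ph s) ≤ (1 + 2 * τ) * (Pb s + k * φ ^ 2) := by gcongr
        have h5 : 1 ≤ (1 + 2 * τ) * (1 - τ) := by nlinarith
        nlinarith
      have h6 : Pb s ≤ P s + |Pb s - P s| := by linarith [le_abs_self (Pb s - P s)]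
      have h7 : Ph s * G s ≤ (1 + 2 * τ) * (P s + |Pb s - P s| + k * φ ^ 2) * G s := by
        refine mul_le_mul_of_nonneg_right (h3.trans ?_) hg
        gcongr
      have h8 : |Pb s - P s| * G s ≤ |Pb s - P s| * b := by gcongr; exact hb s
      have h9 : k * φ ^ 2 * G s ≤ k * φ ^ 2 * q := by gcongr; exact hq s hpos
      have h10 : (1 + 2 * τ) * (|Pb s - P s| * b) ≤ 2 * (|Pb s - P s| * b) := by
        gcongr; linarith
      have h11 : (1 + 2 * τ) * (k * φ ^ 2 * q) ≤ 2 * (k * φ ^ 2 * q) := by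
        gcongr; linarith
      have h12 : (1 + 2 * τ) * (|Pb s - P s| * G s) ≤ (1 + 2 * τ) * (|Pb s - P s| * b) := by
        gcongr
      have h13 : (1 + 2 * τ) * (k * φ ^ 2 * G s) ≤ (1 + 2 * τ) * (k * φ ^ 2 * q) := by
        gcongr
      linarith
  refine (Finset.sum_le_sum fun s _ => hterm s).trans ?_
  rw [Finset.sum_add_distrib, Finset.sum_add_distrib, Finset.sum_add_distrib, ← Finset.mul_sum,
    ← Finset.mul_sum, ← Finset.mul_sum, ← Finset.mul_sum, ← Finset.sum_filter, Finset.sum_const,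
    nsmul_eq_mul]
  have h1 : 2 * b * ∑ s, |Pb s - P s| ≤ 2 * b * ε := by gcongr; exact h.bias_P
  have h2 : ((Finset.univ.filter fun s => P s ≠ 0).card : ℝ) * (q * k * φ ^ 2)
      ≤ Sh * (q * k * φ ^ 2) := by gcongr
  have h3 := mul_le_mul_of_nonneg_left h.out_le hb0
  linarith

/-- Rewards in [0, 1] have second moment at most their mean, so the sample deviation is governed by
√r up to lower order. Keeping r instead of 1 is what lets the final bound depend on the values of
the played policies. -/
lemma width_mul_reward_std_le (h : ConcAt P Pb Ph r rb rh r2 ε φ c f) :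
    φ * Real.sqrt (r2 - rh ^ 2) ≤ 2 * (φ * Real.sqrt r) + 2 * (φ * Real.sqrt ε) + 5 * φ ^ 2 := by
  have hr := h.r_nonneg
  have hr1 := h.r_le
  have hrh := h.rh_nonneg
  have hφ := h.φ_nonneg
  have hε := h.ε_nonneg
  have h1 : Real.sqrt ((r2 - rh ^ 2) + (rh - r) ^ 2) ≤ Real.sqrt (rh + r) := by
    refine Real.sqrt_le_sqrt ?_
    have a1 := h.r2_le
    have a2 : r ^ 2 ≤ r := by nlinarith
    have a3 : 0 ≤ rh * r := by positivity
    linarith [a3, (by ring : (rh - r) ^ 2 = rh ^ 2 - 2 * (rh * r) + r ^ 2)]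
  have h2 := (abs_le.1 h.dev_r).2
  have h3 := (abs_le.1 h.bias_r).2
  have h4 := width_mul_sqrt_le (φ := φ) (p := rh + r) (by linarith) (τ := 1 / 2) (by norm_num)
  have h5 : 3.63 * φ * Real.sqrt ((r2 - rh ^ 2) + (rh - r) ^ 2) ≤
      3.63 * φ * Real.sqrt (rh + r) := by gcongr
  have h6 : rh ≤ 3 * r + 2 * ε + 25 * φ ^ 2 := by
    have : (3.3 : ℝ) / (1 / 2) * φ ^ 2 = 6.6 * φ ^ 2 := by ring
    rw [this] at h4
    linarith [sq_nonneg φ]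
  have h7 : Real.sqrt (r2 - rh ^ 2) ≤ 2 * Real.sqrt r + 2 * Real.sqrt ε + 5 * φ := by
    have a1 : Real.sqrt (r2 - rh ^ 2) ≤ Real.sqrt (3 * r + 2 * ε + 25 * φ ^ 2) :=
      Real.sqrt_le_sqrt (by linarith [h.r2_le, sq_nonneg rh])
    refine a1.trans (Real.sqrt_le_iff.2 ⟨by positivity, ?_⟩)
    have e1 := Real.sq_sqrt hr
    have e2 := Real.sq_sqrt hε
    have b1 : 0 ≤ Real.sqrt r * Real.sqrt ε := by positivity
    have b2 : 0 ≤ Real.sqrt r * φ := by positivity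
    have b3 : 0 ≤ Real.sqrt ε * φ := by positivity
    have e3 : (2 * Real.sqrt r + 2 * Real.sqrt ε + 5 * φ) ^ 2 = 4 * Real.sqrt r ^ 2 +
      4 * Real.sqrt ε ^ 2 + 25 * φ ^ 2 + 8 * (Real.sqrt r * Real.sqrt ε) +
      20 * (Real.sqrt r * φ) + 20 * (Real.sqrt ε * φ) := by ring
    rw [e3, e1, e2]
    linarith
  have := mul_le_mul_of_nonneg_left h7 hφ
  linarith

open Classical in
-- In the L² norm of Ph, U − m splits into U − V and V − m. On the support (U − V)² ≤ Q (U − L),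
-- which AM–GM turns into a 1/H fraction of the gap; off the support the mass is small by `out_le`.
-- The second part is moved from Ph to P by `expect_le`, which leaves the true variance of V.
lemma width_mul_value_std_le (h : ConcAt P Pb Ph r rb rh r2 ε φ c f) {V U L : S → ℝ}
    {H Q Sh : ℝ} (hH : 1 ≤ H) (hQ : 1 ≤ Q) (hSh1 : 1 ≤ Sh)
    (hSh : ((Finset.univ.filter fun s => P s ≠ 0).card : ℝ) ≤ Sh)
    (hL : ∀ s, 0 ≤ L s) (hLV : ∀ s, L s ≤ V s) (hVU : ∀ s, V s ≤ U s) (hUH : ∀ s, U s ≤ H)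
    (hUQ : ∀ s, 0 < P s → U s ≤ Q) :
    φ * Real.sqrt (∑ s, Ph s * U s ^ 2 - (∑ s, Ph s * U s) ^ 2) ≤
      1 / H * ∑ s, Ph s * (U s - L s)
        + 1.5 * (φ * Real.sqrt (∑ s, P s * V s ^ 2 - (∑ s, P s * V s) ^ 2))
        + 3.5 * (H * (φ * Real.sqrt ε)) + 12 * (Sh * Q * H * φ ^ 2) := by
  have hφ := h.φ_nonneg
  have hε := h.ε_nonneg
  have hH0 : 0 < H := by linarith
  have hV : ∀ s, 0 ≤ V s := fun s => (hL s).trans (hLV s)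
  set m := ∑ s, P s * V s with hm
  have hm0 : 0 ≤ m := Finset.sum_nonneg fun s _ => mul_nonneg (h.P_nonneg s) (hV s)
  have hmle : ∀ b, (∀ s, 0 < P s → V s ≤ b) → m ≤ b := by
    intro b hb
    calc m ≤ ∑ s, P s * b := by
          refine Finset.sum_le_sum fun s _ => ?_
          rcases (h.P_nonneg s).eq_or_lt with h0 | h0
          · simp [← h0]
          · exact mul_le_mul_of_nonneg_left (hb s h0) h0.le
      _ = b := by rw [← Finset.sum_mul, h.P_sum, one_mul]
  have hmQ : m ≤ Q := hmle Q fun s hs => (hVU s).trans (hUQ s hs)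
  have hmH : m ≤ H := hmle H fun s _ => (hVU s).trans (hUH s)
  set o := ∑ s, (if P s = 0 then Ph s else 0) with ho
  have ho0 : 0 ≤ o := Finset.sum_nonneg fun s _ => by
    split_ifs
    · exact h.Ph_nonneg s
    · exact le_rfl
  set g := ∑ s, Ph s * (U s - L s) with hg
  have hg0 : 0 ≤ g := Finset.sum_nonneg fun s _ =>
    mul_nonneg (h.Ph_nonneg s) (by linarith [hVU s, hLV s])
  set σ2 := ∑ s, P s * V s ^ 2 - m ^ 2 with hσ2
  have hσ0 : 0 ≤ σ2 := variance_nonneg' h.P_nonneg h.P_sum V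
  have h1 : Real.sqrt (∑ s, Ph s * U s ^ 2 - (∑ s, Ph s * U s) ^ 2) ≤
      Real.sqrt (∑ s, Ph s * (U s - V s) ^ 2) + Real.sqrt (∑ s, Ph s * (V s - m) ^ 2) := by
    refine le_trans (Real.sqrt_le_sqrt ((variance_le_sum_sub_sq h.Ph_sum U m).trans
      (le_of_eq ?_))) (sqrt_sum_weighted_add_le h.Ph_nonneg (fun s => U s - V s) fun s => V s - m)
    exact Finset.sum_congr rfl fun s _ => by ring
  have h2 : ∑ s, Ph s * (U s - V s) ^ 2 ≤ Q * g + H ^ 2 * o := by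
    rw [hg, ho, Finset.mul_sum, Finset.mul_sum, ← Finset.sum_add_distrib]
    refine Finset.sum_le_sum fun s _ => ?_
    have hph := h.Ph_nonneg s
    have a1 := hV s
    have a2 := hVU s
    have a3 := hLV s
    have a5 := hUH s
    by_cases hs : P s = 0
    · rw [if_pos hs]
      have b1 : (U s - V s) ^ 2 ≤ H ^ 2 := by
        refine pow_le_pow_left₀ (by linarith) (by linarith) 2
      have b2 := mul_le_mul_of_nonneg_left b1 hph
      have b3 : 0 ≤ Q * (Ph s * (U s - L s)) :=
        mul_nonneg (by linarith) (mul_nonneg hph (by linarith))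
      linarith
    · rw [if_neg hs]
      have a4 := hUQ s (lt_of_le_of_ne (h.P_nonneg s) (Ne.symm hs))
      have b1 : (U s - V s) ^ 2 ≤ Q * (U s - L s) := by
        rw [sq]
        exact mul_le_mul (by linarith) (by linarith) (by linarith) (by linarith)
      have b2 := mul_le_mul_of_nonneg_left b1 hph
      linarith
  have h3 : Real.sqrt (∑ s, Ph s * (U s - V s) ^ 2) ≤ Real.sqrt (Q * g) + H * Real.sqrt o := by
    refine (Real.sqrt_le_sqrt h2).trans ((sqrt_add_le' (by positivity) (by positivity)).trans ?_)
    rw [Real.sqrt_mul (sq_nonneg H), Real.sqrt_sq hH0.le]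
  have h4 : Real.sqrt o ≤ 1.5 * Real.sqrt ε + 3 * φ := by
    refine (Real.sqrt_le_sqrt h.out_le).trans (Real.sqrt_le_iff.2 ⟨by positivity, ?_⟩)
    have e2 := Real.sq_sqrt hε
    have b3 : 0 ≤ Real.sqrt ε * φ := by positivity
    have e3 : (1.5 * Real.sqrt ε + 3 * φ) ^ 2 = 2.25 * Real.sqrt ε ^ 2 + 9 * φ ^ 2 +
      9 * (Real.sqrt ε * φ) := by ring
    rw [e3, e2]
    linarith [sq_nonneg φ]
  have h5 : φ * Real.sqrt (Q * g) ≤ 1 / H * g + Q * H * φ ^ 2 := by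
    have a1 := width_mul_sqrt_le (φ := φ) (p := Q * g) (by positivity) (τ := 1 / (Q * H))
      (by positivity)
    have a2 : 1 / (Q * H) * (Q * g) = 1 / H * g := by field_simp
    have a3 : 3.3 / (1 / (Q * H)) * φ ^ 2 = 3.3 * (Q * H * φ ^ 2) := by field_simp
    rw [a2, a3] at a1
    have a4 : 0 ≤ 1 / H * g := by positivity
    have a5 : 0 ≤ Q * H * φ ^ 2 := by positivity
    linarith
  have h6 : ∑ s, Ph s * (V s - m) ^ 2 ≤ 2 * σ2 + 4 * H ^ 2 * ε
      + (2 * Sh * Q ^ 2 * (3.3 / (1 / 2) + 5.6) + 8 * H ^ 2) * φ ^ 2 := by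
    have a1 := h.expect_le (G := fun s => (V s - m) ^ 2) (q := Q ^ 2) (b := H ^ 2) (τ := 1 / 2)
      (fun s => sq_nonneg _)
      (fun s hs => sq_le_sq' (by linarith [hV s]) (by linarith [hVU s, hUQ s hs]))
      (fun s => sq_le_sq' (by linarith [hV s]) (by linarith [hVU s, hUH s]))
      (by positivity) (by norm_num) le_rfl hSh (by positivity)
    have a2 := sum_weighted_sub_sq h.P_sum V m
    rw [← hm, sub_self, zero_pow two_ne_zero, add_zero, ← hσ2] at a2
    rw [a2] at a1
    norm_num at a1 ⊢
    linarith
  have h7 : Real.sqrt (∑ s, Ph s * (V s - m) ^ 2) ≤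
      1.5 * Real.sqrt σ2 + 2 * (H * Real.sqrt ε) + (5 * Sh * Q + 3 * H) * φ := by
    exact (Real.sqrt_le_sqrt h6).trans (sqrt_second_moment_le hσ0 hε hφ hH0.le (by linarith) hSh1)
  have h8 : Real.sqrt (∑ s, Ph s * U s ^ 2 - (∑ s, Ph s * U s) ^ 2) ≤
      Real.sqrt (Q * g) + H * (1.5 * Real.sqrt ε + 3 * φ) +
      (1.5 * Real.sqrt σ2 + 2 * (H * Real.sqrt ε) + (5 * Sh * Q + 3 * H) * φ) := by
    have := mul_le_mul_of_nonneg_left h4 hH0.le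
    linarith
  have h9 := mul_le_mul_of_nonneg_left h8 hφ
  have c1 : Q * H * φ ^ 2 ≤ Sh * (Q * H * φ ^ 2) := le_mul_of_one_le_left (by positivity) hSh1
  have c2 : H * φ ^ 2 ≤ Q * (H * φ ^ 2) := le_mul_of_one_le_left (by positivity) hQ
  have c3 : Sh * Q * φ ^ 2 ≤ H * (Sh * Q * φ ^ 2) := le_mul_of_one_le_left (by positivity) hH
  clear h1 h2 h3 h4 h6 h7 h8
  linarith

open Classical in
/-- Bound on the difference of the upper and lower backups. -/
lemma gap_le (h : ConcAt P Pb Ph r rb rh r2 ε φ c f) {V U L : S → ℝ}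
    {H Q Sh : ℝ} (hH : 1 ≤ H) (hQ : 1 ≤ Q) (hcQ : c ≤ Q) (hSh1 : 1 ≤ Sh)
    (hSh : ((Finset.univ.filter fun s => P s ≠ 0).card : ℝ) ≤ Sh)
    (hL : ∀ s, 0 ≤ L s) (hLV : ∀ s, L s ≤ V s) (hVU : ∀ s, V s ≤ U s) (hUH : ∀ s, U s ≤ H)
    (hUQ : ∀ s, 0 < P s → U s ≤ Q) :
    ∑ s, Ph s * (U s - L s) + 2 *
      (4 * (Real.sqrt (r2 - rh ^ 2) + 2 * Real.sqrt ε * H +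
        Real.sqrt (∑ s, Ph s * U s ^ 2 - (∑ s, Ph s * U s) ^ 2)) * φ
      + 53 * Sh * H * c * φ ^ 2 + 1 / H * ∑ s, Ph s * (U s - L s) + (H + 1) * ε) ≤
    (1 + 21 / H) * ∑ s, P s * (U s - L s) + 16 * (φ * Real.sqrt r)
      + 12 * (φ * Real.sqrt (∑ s, P s * V s ^ 2 - (∑ s, P s * V s) ^ 2))
      + 60 * (H * (φ * Real.sqrt ε)) + 605 * (Sh * Q * H * φ ^ 2) + 48 * (H * ε) := by
  have hφ := h.φ_nonneg
  have hε := h.ε_nonneg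
  have hH0 : 0 < H := by linarith
  have h1 := h.width_mul_reward_std_le
  have h2 := h.width_mul_value_std_le hH hQ hSh1 hSh hL hLV hVU hUH hUQ
  -- The choice τ = 1/(2H) costs only a factor 1 + 1/H, harmless over H steps.
  have h3 := h.expect_le (G := fun s => U s - L s) (q := Q) (b := H) (τ := 1 / (2 * H))
    (fun s => by linarith [hLV s, hVU s]) (fun s hs => by linarith [hUQ s hs, hL s])
    (fun s => by linarith [hUH s, hL s]) (by linarith) (by positivity)
    (by rw [div_le_div_iff₀ (by positivity) (by norm_num)]; linarith) hSh hH0.le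
  set g := ∑ s, Ph s * (U s - L s)
  set g0 := ∑ s, P s * (U s - L s) with hg0d
  have hg0 : 0 ≤ g0 := Finset.sum_nonneg fun s _ =>
    mul_nonneg (h.P_nonneg s) (by linarith [hVU s, hLV s])
  set ρ := Real.sqrt (∑ s, Ph s * U s ^ 2 - (∑ s, Ph s * U s) ^ 2)
  set σ := Real.sqrt (∑ s, P s * V s ^ 2 - (∑ s, P s * V s) ^ 2)
  set z := Sh * Q * H * φ ^ 2 with hz
  have hzz : 0 ≤ z := by positivity
  have c1 : Q * H * φ ^ 2 ≤ Sh * (Q * H * φ ^ 2) := le_mul_of_one_le_left (by positivity) hSh1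
  have c2 : H * φ ^ 2 ≤ Q * (H * φ ^ 2) := le_mul_of_one_le_left (by positivity) hQ
  have c3 : Sh * Q * φ ^ 2 ≤ H * (Sh * Q * φ ^ 2) := le_mul_of_one_le_left (by positivity) hH
  have c4 : φ ^ 2 ≤ H * φ ^ 2 := le_mul_of_one_le_left (by positivity) hH
  have c5 : Sh * H * φ ^ 2 * c ≤ Sh * H * φ ^ 2 * Q :=
    mul_le_mul_of_nonneg_left hcQ (by positivity)
  have c6 : φ * Real.sqrt ε ≤ H * (φ * Real.sqrt ε) := le_mul_of_one_le_left (by positivity) hH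
  have c7 : ε ≤ H * ε := le_mul_of_one_le_left (by positivity) hH
  have e1 : (1 + 2 * (1 / (2 * H))) * g0 = g0 + 1 / H * g0 := by field_simp
  have e2 : (2 * Sh * Q * (3.3 / (1 / (2 * H)) + 5.6) + 8 * H) * φ ^ 2 =
      13.2 * z + 11.2 * (Sh * Q * φ ^ 2) + 8 * (H * φ ^ 2) := by
    rw [hz]; field_simp; ring
  rw [e1, e2] at h3
  have h4 : g ≤ g0 + 1 / H * g0 + 4 * (H * ε) + 33 * z := by linarith
  have hi : 0 ≤ 1 / H := by positivity
  have hi1 : 1 / H ≤ 1 := by rw [div_le_one hH0]; exact hH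
  have h5 : 1 / H * g ≤ 1 / H * g0 + 1 / H * g0 + 4 * (H * ε) + 33 * z := by
    have a1 := mul_le_mul_of_nonneg_left h4 hi
    have a2 : 1 / H * (1 / H * g0) ≤ 1 * (1 / H * g0) := by gcongr
    have a3 : 1 / H * (4 * (H * ε) + 33 * z) ≤ 1 * (4 * (H * ε) + 33 * z) := by gcongr
    linarith
  have e3 : (1 + 21 / H) * g0 = g0 + 21 * (1 / H * g0) := by field_simp
  rw [e3]
  -- The doubled bonus holds two shares g/H directly and eight through the standard deviation of U.
  -- Each is at most 2 g0/H up to lower order; with the g0/H from g itself this makes 21.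
  have h6 : g + 10 * (1 / H * g) ≤ g0 + 21 * (1 / H * g0) + 44 * (H * ε) + 363 * z := by
    linarith
  linarith

end ConcAt

end Gap

/-! ### Validity of the confidence bounds -/

section Planning

variable {S : Type*} [Fintype S] {A : S → Type*} [∀ s, Fintype (A s)]

lemma upperV_of_lt (inp : AlgInput A) {H h : ℕ} (hh : h < H) (st : Stats A) (π : Policy A) (s : S) :
    upperV inp H st π h s = upperBackup inp H st h (upperV inp H st π (h + 1))
      (lowerV inp H st π (h + 1)) ⟨s, π h s⟩ := by
  obtain ⟨m, rfl⟩ := Nat.exists_eq_add_of_lt hh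
  have e1 : h + m + 1 - h = m + 1 := by omega
  have e2 : h + m + 1 - (h + 1) = m := by omega
  have e3 : h + m + 1 - (m + 1) = h := by omega
  simp only [upperV, lowerV, e1, e2, planAux, e3]

lemma lowerV_of_lt (inp : AlgInput A) {H h : ℕ} (hh : h < H) (st : Stats A) (π : Policy A) (s : S) :
    lowerV inp H st π h s = lowerBackup inp H st h (upperV inp H st π (h + 1))
      (lowerV inp H st π (h + 1)) ⟨s, π h s⟩ := by
  obtain ⟨m, rfl⟩ := Nat.exists_eq_add_of_lt hh
  have e1 : h + m + 1 - h = m + 1 := by omega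
  have e2 : h + m + 1 - (h + 1) = m := by omega
  have e3 : h + m + 1 - (m + 1) = h := by omega
  simp only [upperV, lowerV, e1, e2, planAux, e3]

lemma upperV_self (inp : AlgInput A) (H : ℕ) (st : Stats A) (π : Policy A) (s : S) :
    upperV inp H st π H s = 0 := by
  simp [upperV, planAux]

lemma lowerV_self (inp : AlgInput A) (H : ℕ) (st : Stats A) (π : Policy A) (s : S) :
    lowerV inp H st π H s = 0 := by
  simp [lowerV, planAux]

/-- Statistics that are averages of observations in the right ranges. -/
structure Stats.Admissible (st : Stats A) : Prop where
  P_nonneg : ∀ x s, 0 ≤ st.PHat x s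
  P_sum : ∀ x, ∑ s, st.PHat x s = 1
  r_nonneg : ∀ x, 0 ≤ st.rHat x
  r_le : ∀ x, st.rHat x ≤ 1
  sq_le : ∀ x, st.rHat x ^ 2 ≤ st.r2Hat x
  r2_le : ∀ x, st.r2Hat x ≤ st.rHat x
  eps_nonneg : ∀ x, 0 ≤ st.epsHat x

/-- The confidence statements hold for all observed pairs. -/
def Stats.Concentrated (st : Stats A) (inp : AlgInput A) (M : TabularMDP S A) (H : ℕ) : Prop :=
  ∀ x, 0 < st.n x → ∀ h < H, ∃ Pb rb, ConcAt (M.trans x) Pb (st.PHat x) (M.meanReward x) rb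
    (st.rHat x) (st.r2Hat x) (st.epsHat x) (inp.phi H (st.n x)) (inp.VmaxNext h x)
    (fun s => min (M.optV H (h + 1) s) (inp.VmaxNext h x))

lemma AlgInput.phi_nonneg (inp : AlgInput A) (H n : ℕ) : 0 ≤ inp.phi H n := by
  rw [inp.phi_eq_width]; exact width_nonneg _ _

lemma AlgInput.phi_zero (inp : AlgInput A) (H : ℕ) : inp.phi H 0 = 1 := by
  simp [AlgInput.phi]

open Classical in
lemma AlgInput.Valid.card_support_le {inp : AlgInput A} {M : TabularMDP S A} {H : ℕ}
    (hv : inp.Valid M H) (x : StateAction A) :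
    ((Finset.univ.filter fun s => M.trans x s ≠ 0).card : ℝ) ≤ inp.Shat := by
  have h := hv.support_le x
  rw [← Set.ncard_coe_finset]
  have e : ((Finset.univ.filter fun s => M.trans x s ≠ 0 : Finset S) : Set S) =
      {s' | M.trans x s' ≠ 0} := by ext; simp
  rw [e]
  exact_mod_cast h

lemma AlgInput.Valid.one_le_Shat {inp : AlgInput A} {M : TabularMDP S A} {H : ℕ}
    (hv : inp.Valid M H) (x : StateAction A) : 1 ≤ inp.Shat := by
  classical
  have h := hv.card_support_le x
  by_contra hlt
  have h0 : inp.Shat = 0 := by omega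
  rw [h0] at h
  have hc : (Finset.univ.filter fun s => M.trans x s ≠ 0).card = 0 := by
    have : ((Finset.univ.filter fun s => M.trans x s ≠ 0).card : ℝ) ≤ 0 := by simpa using h
    exact_mod_cast le_antisymm this (by positivity)
  rw [Finset.card_eq_zero, Finset.filter_eq_empty_iff] at hc
  have hs := M.trans_sum x
  rw [Finset.sum_eq_zero fun s _ => by simpa using hc (Finset.mem_univ s)] at hs
  exact zero_ne_one hs

lemma sum_weighted_mem {p : S → ℝ} (hp : ∀ s, 0 ≤ p s) (hp1 : ∑ s, p s = 1) {f : S → ℝ} {b : ℝ}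
    (hf : ∀ s, 0 ≤ f s) (hfb : ∀ s, f s ≤ b) :
    0 ≤ ∑ s, p s * f s ∧ ∑ s, p s * f s ≤ b := by
  refine ⟨Finset.sum_nonneg fun s _ => mul_nonneg (hp s) (hf s), ?_⟩
  calc ∑ s, p s * f s ≤ ∑ s, p s * b :=
        Finset.sum_le_sum fun s _ => mul_le_mul_of_nonneg_left (hfb s) (hp s)
    _ = b := by rw [← Finset.sum_mul, hp1, one_mul]

/-! ### A single backup with the bonus -/

section Backup

variable {inp : AlgInput A} {M : TabularMDP S A} {H : ℕ} {st : Stats A} {h : ℕ} {U L : S → ℝ}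
  {x : StateAction A}

lemma bonus_parts_nonneg (hv : inp.Valid M H) (hh : h < H) (ha : st.Admissible)
    (hLU : ∀ s, L s ≤ U s) :
    0 ≤ 4 * (Real.sqrt (st.r2Hat x - st.rHat x ^ 2) + 2 * Real.sqrt (st.epsHat x) * H +
      Real.sqrt (st.expect x (fun s' => U s' ^ 2) - st.expect x U ^ 2)) * inp.phi H (st.n x) ∧
    0 ≤ 53 * inp.Shat * H * inp.VmaxNext h x * inp.phi H (st.n x) ^ 2 ∧
    0 ≤ 1 / (H : ℝ) * st.expect x (fun s' => U s' - L s') ∧ 0 ≤ (H + 1) * st.epsHat x := by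
  have h1 := inp.phi_nonneg H (st.n x)
  have h2 := hv.one_le_VmaxNext h hh x
  have h3 := ha.eps_nonneg x
  have h4 : 0 ≤ inp.VmaxNext h x := by linarith
  have h5 : 0 ≤ st.expect x (fun s' => U s' - L s') :=
    Finset.sum_nonneg fun s _ => mul_nonneg (ha.P_nonneg x s) (by linarith [hLU s])
  refine ⟨?_, ?_, ?_, ?_⟩ <;> positivity

/-- Either the bonus is so large that the confidence bounds are trivial, or the pair has been
observed and its confidence width and bias are small. -/
lemma bonus_large_or (hv : inp.Valid M H) (hh : h < H) (ha : st.Admissible)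
    (hLU : ∀ s, L s ≤ U s) :
    (H + 1 : ℝ) ≤ bonus inp H st h U L x ∨
      (0 < st.n x ∧ inp.phi H (st.n x) ^ 2 ≤ 2 / 53 ∧ st.epsHat x ≤ 1) := by
  obtain ⟨p1, p2, p3, p4⟩ := bonus_parts_nonneg (x := x) hv hh ha hLU
  have hH : (1 : ℝ) ≤ H := by exact_mod_cast (by omega : 1 ≤ H)
  have hS : (1 : ℝ) ≤ inp.Shat := by exact_mod_cast hv.one_le_Shat x
  have hc := hv.one_le_VmaxNext h hh x
  by_cases hε : 1 < st.epsHat x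
  · left
    have : (H + 1 : ℝ) ≤ (H + 1) * st.epsHat x := by nlinarith
    unfold bonus; linarith
  -- Beyond this threshold the φ² part of the bonus alone is at least 2H ≥ H + 1.
  by_cases hφ : 2 / 53 < inp.phi H (st.n x) ^ 2
  · left
    have k1 : (1 : ℝ) ≤ inp.Shat * inp.VmaxNext h x := by nlinarith
    have k2 : (H : ℝ) ≤ H * (inp.Shat * inp.VmaxNext h x) := by nlinarith
    have k3 : (H : ℝ) * (2 / 53) ≤ H * (inp.Shat * inp.VmaxNext h x) * inp.phi H (st.n x) ^ 2 :=
      mul_le_mul k2 hφ.le (by norm_num) (by linarith)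
    unfold bonus; linarith
  · right
    push Not at hε hφ
    refine ⟨Nat.pos_of_ne_zero fun h0 => ?_, hφ, hε⟩
    rw [h0, inp.phi_zero] at hφ
    norm_num at hφ

variable [∀ s, Nonempty (A s)]

lemma optQ_le_upperBackup (hv : inp.Valid M H) (hh : h < H) (ha : st.Admissible)
    (hc : st.Concentrated inp M H) (hL : ∀ s, L s ≤ M.optV H (h + 1) s)
    (hU : ∀ s, M.optV H (h + 1) s ≤ U s) :
    M.optQ H h x ≤ upperBackup inp H st h U L x := by
  refine le_max_of_le_right (le_min ?_ (hv.optQ_le h hh x))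
  have hLU : ∀ s, L s ≤ U s := fun s => (hL s).trans (hU s)
  rcases bonus_large_or (x := x) hv hh ha hLU with hb | ⟨hn, hφ, hε⟩
  · have h1 : 0 ≤ st.expect x U := Finset.sum_nonneg fun s _ =>
      mul_nonneg (ha.P_nonneg x s) ((M.optV_nonneg H (h + 1) s).trans (hU s))
    have h2 := ha.r_nonneg x
    have h3 := (hv.optQ_le h hh x).trans (hv.Qmax_le h hh x)
    linarith
  · obtain ⟨Pb, rb, hconc⟩ := hc x hn h hh
    refine (M.optQ_le_backup hh x).trans ?_
    have := hconc.upper_backup_ge (U := U) (L := L) (H := H) (Sh := inp.Shat) hφ hε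
      (hv.one_le_VmaxNext h hh x) (hv.VmaxNext_le h hh x) (by exact_mod_cast hv.one_le_Shat x)
      (M.optV_nonneg H (h + 1)) hU hL (hv.optV_le h hh x)
    exact this

lemma lowerBackup_le_qValue (hv : inp.Valid M H) (hh : h < H) (ha : st.Admissible)
    (hc : st.Concentrated inp M H) {π : Policy A} (hL : ∀ s, L s ≤ M.vValue H π (h + 1) s)
    (hU : ∀ s, M.optV H (h + 1) s ≤ U s) (hlast : h + 1 = H → ∀ s, U s = 0 ∧ L s = 0) :
    lowerBackup inp H st h U L x ≤ M.qValue H π h x := by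
  classical
  refine max_le (M.qValue_nonneg H π h x) ((min_le_left _ _).trans ?_)
  have hVW := fun s => M.vValue_le_optV H π (h + 1) s
  have hLU : ∀ s, L s ≤ U s := fun s => (hL s).trans ((hVW s).trans (hU s))
  rcases bonus_large_or (x := x) hv hh ha hLU with hb | ⟨hn, hφ, hε⟩
  · have h1 : st.expect x L ≤ H := by
      calc st.expect x L ≤ ∑ s, st.PHat x s * H := Finset.sum_le_sum fun s _ =>
            mul_le_mul_of_nonneg_left ((hL s).trans (M.vValue_le _ _ _ _)) (ha.P_nonneg x s)
        _ = H := by rw [← Finset.sum_mul, ha.P_sum, one_mul]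
    have h2 := ha.r_le x
    have h3 := M.qValue_nonneg H π h x
    linarith
  · obtain ⟨Pb, rb, hconc⟩ := hc x hn h hh
    rw [M.qValue_eq hh]
    have hS : (1 : ℝ) ≤ inp.Shat := by exact_mod_cast hv.one_le_Shat x
    have hH : (1 : ℝ) ≤ H := by exact_mod_cast (by omega : 1 ≤ H)
    by_cases hH2 : 2 ≤ H
    · exact hconc.lower_backup_le (V := M.vValue H π (h + 1)) (U := U) (L := L) (H := H)
        (Sh := inp.Shat) hφ hε (hv.one_le_VmaxNext h hh x) (hv.VmaxNext_le h hh x)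
        (by exact_mod_cast hH2) hS (hv.card_support_le x) (M.vValue_nonneg H π (h + 1)) hL hVW hU
        (M.optV_le H (h + 1)) (hv.optV_le h hh x)
    -- For H = 1, where `lower_const_le` fails, the next values vanish and only the reward deviates.
    · have hH1 : h + 1 = H := by omega
      obtain ⟨p1, p2, p3, p4⟩ := bonus_parts_nonneg (x := x) hv hh ha hLU
      have hr := (abs_le.1 (hconc.dev_reward hφ hε)).2
      have e1 : st.expect x L = 0 :=
        Finset.sum_eq_zero fun s _ => by rw [(hlast hH1 s).2, mul_zero]
      have e2 : ∑ s', M.trans x s' * M.vValue H π (h + 1) s' = 0 :=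
        Finset.sum_eq_zero fun s _ => by rw [M.vValue_eq_zero hH1.ge, mul_zero]
      have hc1 := hv.one_le_VmaxNext h hh x
      have hφ0 := inp.phi_nonneg H (st.n x)
      have hε0 := ha.eps_nonneg x
      have k1 : (1 : ℝ) ≤ inp.Shat * H * inp.VmaxNext h x := by
        have : (1 : ℝ) ≤ inp.Shat * H := by nlinarith
        nlinarith
      have k2 : inp.phi H (st.n x) ^ 2 ≤
          inp.Shat * H * inp.VmaxNext h x * inp.phi H (st.n x) ^ 2 :=
        le_mul_of_one_le_left (sq_nonneg _) k1
      have k3 : st.epsHat x ≤ (H + 1) * st.epsHat x := le_mul_of_one_le_left hε0 (by linarith)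
      have k4 : inp.phi H (st.n x) * Real.sqrt (st.epsHat x) ≤
          H * (inp.phi H (st.n x) * Real.sqrt (st.epsHat x)) :=
        le_mul_of_one_le_left (by positivity) hH
      have k5 : 0 ≤ Real.sqrt (st.expect x (fun s' => U s' ^ 2) - st.expect x U ^ 2) *
        inp.phi H (st.n x) := by positivity
      have k6 : 0 ≤ inp.phi H (st.n x) * Real.sqrt (st.epsHat x) := by positivity
      have k7 := sq_nonneg (inp.phi H (st.n x))
      rw [e1, e2]
      unfold bonus
      linarith

end Backup

variable [∀ s, Nonempty (A s)]

/-- All confidence bounds computed from concentrated statistics are valid. -/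
lemma confidence_bounds {inp : AlgInput A} {M : TabularMDP S A} {H : ℕ} {st : Stats A}
    {π : Policy A} (hv : inp.Valid M H) (ha : st.Admissible) (hc : st.Concentrated inp M H)
    (hπ : IsOptPlan inp H st π) {h : ℕ} (hh : h ≤ H) (s : S) :
    0 ≤ lowerV inp H st π h s ∧ lowerV inp H st π h s ≤ M.vValue H π h s ∧
      M.optV H h s ≤ upperV inp H st π h s ∧ upperV inp H st π h s ≤ H := by
  induction hh using Nat.decreasingInduction generalizing s with
  | self =>
    rw [upperV_self, lowerV_self, M.vValue_eq_zero le_rfl, M.optV_eq_zero le_rfl]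
    simp
  | of_succ h hh ih =>
    have hh' : h < H := hh
    have hVW := fun s => M.vValue_le_optV H π (h + 1) s
    have hUl : ∀ s a, M.optQ H h ⟨s, a⟩ ≤ upperQ inp H st π h ⟨s, a⟩ := fun s a =>
      optQ_le_upperBackup hv hh' ha hc (fun s => (ih s).2.1.trans (hVW s)) (fun s => (ih s).2.2.1)
    refine ⟨?_, ?_, ?_, ?_⟩
    · rw [lowerV_of_lt inp hh']; exact le_max_left _ _
    · rw [lowerV_of_lt inp hh']
      refine lowerBackup_le_qValue hv hh' ha hc (fun s => (ih s).2.1) (fun s => (ih s).2.2.1) ?_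
      rintro rfl s
      exact ⟨upperV_self _ _ _ _ _, lowerV_self _ _ _ _ _⟩
    -- The first action of an arbitrary competitor has an upper Q-value no larger than that of the
    -- action of π; no optimal competitor is needed.
    · refine M.optV_le_of_forall fun π' => ?_
      refine (M.qValue_le_optQ H π' h _).trans ((hUl s (π' h s)).trans ?_)
      rw [upperV_of_lt inp hh']
      exact hπ h hh' s (π' h s)
    · rw [upperV_of_lt inp hh']
      exact max_le (by positivity) ((min_le_right _ _).trans (hv.Qmax_le h hh' _))

/-- The per-step contribution to the certificate size. -/
def gapTerm (inp : AlgInput A) (M : TabularMDP S A) (H : ℕ) (st : Stats A) (π : Policy A) (Q : ℝ)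
    (h : ℕ) (x : StateAction A) : ℝ :=
  16 * (inp.phi H (st.n x) * Real.sqrt (M.meanReward x))
    + 12 * (inp.phi H (st.n x) * Real.sqrt (M.nextVar H π h x))
    + 60 * (H * (inp.phi H (st.n x) * Real.sqrt (st.epsHat x)))
    + 605 * (inp.Shat * Q * H * inp.phi H (st.n x) ^ 2) + 48 * (H * st.epsHat x)

/-- The first bound serves pairs with too few observations, the second drives the recursion. For the
latter, U ≤ Q holds at every possible successor of x, because such a successor is itself visited
with positive probability. -/
lemma gap_recursion {inp : AlgInput A} {M : TabularMDP S A} {H : ℕ} {st : Stats A}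
    {π : Policy A} (hv : inp.Valid M H) (ha : st.Admissible) (hc : st.Concentrated inp M H)
    (hπ : IsOptPlan inp H st π) {s : S} {Q : ℝ}
    (hQ : ∀ h < H, ∀ x, 0 < M.visitProb π s h x → inp.Qmax h x ≤ Q ∧ inp.VmaxNext h x ≤ Q)
    {h : ℕ} (hh : h < H) {x : StateAction A} (hx : 0 < M.visitProb π s h x) :
    upperV inp H st π h x.1 - lowerV inp H st π h x.1 ≤ Q ∧
    upperV inp H st π h x.1 - lowerV inp H st π h x.1 ≤
      (1 + 21 / H) * ∑ s', M.trans x s' *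
        (upperV inp H st π (h + 1) s' - lowerV inp H st π (h + 1) s')
      + gapTerm inp M H st π Q h x := by
  classical
  obtain ⟨hQx, hcx⟩ := hQ h hh x hx
  have hc1 := hv.one_le_VmaxNext h hh x
  have hQ1 : 1 ≤ Q := hc1.trans hcx
  have hH : (1 : ℝ) ≤ H := by exact_mod_cast (by omega : 1 ≤ H)
  have hS : (1 : ℝ) ≤ inp.Shat := by exact_mod_cast hv.one_le_Shat x
  have hbd := fun s' => confidence_bounds hv ha hc hπ (show h + 1 ≤ H from hh) s'
  set U := upperV inp H st π (h + 1) with hUd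
  set L := lowerV inp H st π (h + 1) with hLd
  have hVW := fun s => M.vValue_le_optV H π (h + 1) s
  have hVU : ∀ s, M.vValue H π (h + 1) s ≤ U s := fun s => (hVW s).trans (hbd s).2.2.1
  have hLU : ∀ s, L s ≤ U s := fun s => (hbd s).2.1.trans (hVU s)
  have hxe := M.policy_of_visitProb_pos hx
  have eU : upperV inp H st π h x.1 = upperBackup inp H st h U L x := by
    rw [upperV_of_lt inp hh, ← hxe]
  have eL : lowerV inp H st π h x.1 = lowerBackup inp H st h U L x := by
    rw [lowerV_of_lt inp hh, ← hxe]
  have hl0 : 0 ≤ lowerBackup inp H st h U L x := le_max_left _ _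
  have hfirst : upperV inp H st π h x.1 - lowerV inp H st π h x.1 ≤ Q := by
    rw [eU, eL]
    have : upperBackup inp H st h U L x ≤ Q :=
      max_le (by linarith) ((min_le_right _ _).trans hQx)
    linarith
  refine ⟨hfirst, ?_⟩
  have hP0 : 0 ≤ ∑ s', M.trans x s' * (U s' - L s') := Finset.sum_nonneg fun s' _ =>
    mul_nonneg (M.trans_nonneg x s') (by linarith [hLU s'])
  have hφ0 := inp.phi_nonneg H (st.n x)
  have hε0 := ha.eps_nonneg x
  by_cases hn : 0 < st.n x
  · obtain ⟨Pb, rb, hconc⟩ := hc x hn h hh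
    have hUQ : ∀ s', 0 < M.trans x s' → U s' ≤ Q := by
      intro s' hs'
      rcases Nat.lt_or_ge (h + 1) H with h1 | h1
      · rw [hUd, upperV_of_lt inp h1]
        exact max_le (by linarith) ((min_le_right _ _).trans
          (hQ (h + 1) h1 _ (M.visitProb_succ_pos hx hs')).1)
      · have : h + 1 = H := by omega
        rw [hUd, this, upperV_self]; linarith
    have hg := hconc.gap_le (V := M.vValue H π (h + 1)) (U := U) (L := L) (H := H) (Q := Q)
      (Sh := inp.Shat) hH hQ1 hcx hS (hv.card_support_le x) (fun s => (hbd s).1)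
      (fun s => (hbd s).2.1) hVU (fun s => (hbd s).2.2.2) hUQ
    have hdiff : upperBackup inp H st h U L x - lowerBackup inp H st h U L x ≤
        st.expect x (fun s' => U s' - L s') + 2 * bonus inp H st h U L x := by
      obtain ⟨p1, p2, p3, p4⟩ := bonus_parts_nonneg (x := x) hv hh ha hLU
      have hb0 : 0 ≤ bonus inp H st h U L x := by unfold bonus; linarith
      have he : st.expect x (fun s' => U s' - L s') = st.expect x U - st.expect x L := by
        unfold Stats.expect
        rw [← Finset.sum_sub_distrib]
        exact Finset.sum_congr rfl fun s' _ => by ring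
      have he0 : 0 ≤ st.expect x (fun s' => U s' - L s') :=
        Finset.sum_nonneg fun s _ => mul_nonneg (ha.P_nonneg x s) (by linarith [hLU s])
      unfold upperBackup lowerBackup
      have a1 := abs_max_sub_max_le_abs (min (st.rHat x + st.expect x U + bonus inp H st h U L x)
        (inp.Qmax h x)) (min (st.rHat x + st.expect x L - bonus inp H st h U L x)
        (inp.Qmax h x)) 0
      have a2 := abs_min_sub_min_le_max (st.rHat x + st.expect x U + bonus inp H st h U L x)
        (inp.Qmax h x) (st.rHat x + st.expect x L - bonus inp H st h U L x) (inp.Qmax h x)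
      rw [sub_self, abs_zero, max_eq_left (abs_nonneg _)] at a2
      rw [max_comm 0, max_comm 0]
      refine (le_abs_self _).trans (a1.trans (a2.trans (le_of_eq ?_)))
      rw [abs_of_nonneg (by linarith), he]; ring
    rw [eU, eL]
    refine hdiff.trans (le_trans hg (le_of_eq ?_))
    unfold gapTerm TabularMDP.nextVar
    ring
  · have hn0 : st.n x = 0 := by omega
    -- Without observations the width has its default value 1, and the φ² term alone exceeds Q.
    have hφ1 : inp.phi H (st.n x) = 1 := by rw [hn0, inp.phi_zero]
    have k1 : Q ≤ 605 * (inp.Shat * Q * H * inp.phi H (st.n x) ^ 2) := by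
      rw [hφ1]
      have : Q ≤ (inp.Shat * H) * Q :=
        le_mul_of_one_le_left (by linarith) (by nlinarith)
      have h0 : 0 ≤ Q := by linarith
      nlinarith
    have k2 : 0 ≤ (1 + 21 / (H : ℝ)) * ∑ s', M.trans x s' * (U s' - L s') := by positivity
    unfold gapTerm
    have k3 : 0 ≤ inp.phi H (st.n x) * Real.sqrt (M.meanReward x) := by positivity
    have k4 : 0 ≤ inp.phi H (st.n x) * Real.sqrt (M.nextVar H π h x) := by positivity
    have k5 : 0 ≤ H * (inp.phi H (st.n x) * Real.sqrt (st.epsHat x)) := by positivity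
    have k6 : 0 ≤ H * st.epsHat x := by positivity
    linarith

end Planning

/-! ### The statistics as averages of observations -/

lemma runAvg_mul (n : ℕ) (a b : ℝ) : ((n + 1 : ℕ) : ℝ) * runAvg n a b = n * a + b := by
  unfold runAvg
  have : (n : ℝ) + 1 ≠ 0 := by positivity
  push_cast
  field_simp

lemma runAvg_eq (n : ℕ) :
    ∃ t : ℝ, 0 ≤ t ∧ t ≤ 1 ∧ ∀ a b, runAvg n a b = (1 - t) * a + t * b := by
  refine ⟨1 / ((n : ℝ) + 1), by positivity, ?_, fun a b => ?_⟩
  · rw [div_le_one (by positivity)]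
    linarith [(Nat.cast_nonneg n : (0 : ℝ) ≤ n)]
  · unfold runAvg
    have : (n : ℝ) + 1 ≠ 0 := by positivity
    field_simp
    ring

section StatsSums

variable {S : Type*} [Fintype S] {A : S → Type*} [∀ s, Fintype (A s)]

/-- An update is a convex combination of old and new values, and each clause survives mixing. For
`sq_le` this is convexity of the square, with explicit defect (1 − t) t (r̂ − r)². -/
lemma Stats.Admissible.update {st : Stats A} (h : st.Admissible) (O : Set (StateAction A))
    {r : StateAction A → ℝ} (s' : StateAction A → S) {ε : StateAction A → ℝ}
    (hr : ∀ x, r x ∈ Set.Icc (0 : ℝ) 1) (hε : ∀ x, 0 ≤ ε x) : (st.update O r s' ε).Admissible := by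
  classical
  have ht : ∀ x : StateAction A, ∃ t : ℝ, 0 ≤ t ∧ t ≤ 1 ∧
      ∀ a b, runAvg (st.n x) a b = (1 - t) * a + t * b := fun x => runAvg_eq _
  choose t ht0 ht1 hta using ht
  refine ⟨fun x s => ?_, fun x => ?_, fun x => ?_, fun x => ?_, fun x => ?_, fun x => ?_,
    fun x => ?_⟩ <;> simp only [Stats.update] <;> by_cases hx : x ∈ O
  · rw [if_pos hx, hta]
    have h1 := h.P_nonneg x s
    have h2 := ht0 x
    have h3 : 0 ≤ 1 - t x := by linarith [ht1 x]
    split_ifs <;> positivity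
  · rw [if_neg hx]; exact h.P_nonneg x s
  · simp only [if_pos hx, hta]
    rw [Finset.sum_add_distrib, ← Finset.mul_sum, ← Finset.mul_sum, h.P_sum]
    simp
  · simp only [if_neg hx]; exact h.P_sum x
  · rw [if_pos hx, hta]
    have h1 := h.r_nonneg x
    have h2 := ht0 x
    have h3 : 0 ≤ 1 - t x := by linarith [ht1 x]
    have h4 := (hr x).1
    positivity
  · rw [if_neg hx]; exact h.r_nonneg x
  · rw [if_pos hx, hta]
    have h3 : 0 ≤ 1 - t x := by linarith [ht1 x]
    have h4 := mul_le_mul_of_nonneg_left (h.r_le x) h3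
    have h5 := mul_le_mul_of_nonneg_left (hr x).2 (ht0 x)
    linarith
  · rw [if_neg hx]; exact h.r_le x
  · rw [if_pos hx, if_pos hx, hta, hta]
    have h3 : 0 ≤ 1 - t x := by linarith [ht1 x]
    have h4 := mul_le_mul_of_nonneg_left (h.sq_le x) h3
    have h5 : 0 ≤ (1 - t x) * (t x * (st.rHat x - r x) ^ 2) :=
      mul_nonneg h3 (mul_nonneg (ht0 x) (sq_nonneg _))
    have h6 : ((1 - t x) * st.rHat x + t x * r x) ^ 2 = (1 - t x) * st.rHat x ^ 2 +
      t x * r x ^ 2 - (1 - t x) * (t x * (st.rHat x - r x) ^ 2) := by ring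
    linarith
  · rw [if_neg hx, if_neg hx]; exact h.sq_le x
  · rw [if_pos hx, if_pos hx, hta, hta]
    have h3 : 0 ≤ 1 - t x := by linarith [ht1 x]
    have h4 := mul_le_mul_of_nonneg_left (h.r2_le x) h3
    have h7 : r x ^ 2 ≤ r x := by nlinarith [(hr x).1, (hr x).2]
    have h5 := mul_le_mul_of_nonneg_left h7 (ht0 x)
    linarith
  · rw [if_neg hx, if_neg hx]; exact h.r2_le x
  · rw [if_pos hx, hta]
    have h1 := h.eps_nonneg x
    have h2 := ht0 x
    have h3 : 0 ≤ 1 - t x := by linarith [ht1 x]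
    have h4 := hε x
    positivity
  · rw [if_neg hx]; exact h.eps_nonneg x

namespace Interaction

variable {M : TabularMDP S A} {H : ℕ} {graphLaw : PMF (Digraph (StateAction A))}
  {Ω : Type*} {mΩ : MeasurableSpace Ω} {μ : Measure Ω} (I : Interaction M H graphLaw μ)

lemma admissible_stats (s₀ : S) (k : ℕ) (ω : Ω) : (I.stats s₀ k ω).Admissible := by
  classical
  induction k with
  | zero =>
    refine ⟨fun x s => ?_, fun x => ?_, fun x => ?_, fun x => ?_, fun x => ?_, fun x => ?_,
      fun x => ?_⟩ <;> simp only [stats, Stats.init]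
    · split_ifs <;> norm_num
    · simp
    · exact le_rfl
    · exact zero_le_one
    · norm_num
    · exact le_rfl
    · exact le_rfl
  | succ k ih =>
    have : ∀ h, (I.episodeStats k ω (I.stats s₀ k ω) h).Admissible := by
      intro h
      induction h with
      | zero => exact ih
      | succ h ih' =>
        exact ih'.update _ _ (fun x => I.obsR_mem k h x ω) (fun x => I.bias_nonneg k h x ω)
    exact this H

open Classical in
/-- Sum of `g` over the observations of `x` in the first `k` episodes. -/
def obsSum (k : ℕ) (ω : Ω) (x : StateAction A) (g : ℕ → ℕ → ℝ) : ℝ :=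
  ∑ i ∈ Finset.range k, ∑ h ∈ Finset.range H, if x ∈ I.observed i h ω then g i h else 0

/-- A statistic that is updated as a running average is the average of the observations. -/
lemma count_mul_stat (s₀ : S) (ω : Ω) (x : StateAction A) (F : Stats A → ℝ) (g : ℕ → ℕ → ℝ)
    (hF : ∀ i h st, x ∈ I.observed i h ω →
      F (st.update (I.observed i h ω) (fun x => I.obsR i h x ω)
        (fun x => I.obsS i h x ω) (fun x => I.bias i h x ω)) = runAvg (st.n x) (F st) (g i h))
    (hF' : ∀ i h st, x ∉ I.observed i h ω →
      F (st.update (I.observed i h ω) (fun x => I.obsR i h x ω)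
        (fun x => I.obsS i h x ω) (fun x => I.bias i h x ω)) = F st) (k : ℕ) :
    ((I.stats s₀ k ω).n x : ℝ) * F (I.stats s₀ k ω) = I.obsSum k ω x g := by
  classical
  induction k with
  | zero => simp [stats, Stats.init, obsSum]
  | succ k ih =>
    have key : ∀ h, ((I.episodeStats k ω (I.stats s₀ k ω) h).n x : ℝ) *
        F (I.episodeStats k ω (I.stats s₀ k ω) h) = I.obsSum k ω x g +
        ∑ j ∈ Finset.range h, if x ∈ I.observed k j ω then g k j else 0 := by
      intro h
      induction h with
      | zero => simpa [episodeStats] using ih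
      | succ h ih' =>
        rw [Finset.sum_range_succ, ← add_assoc, ← ih']
        by_cases hx : x ∈ I.observed k h ω
        · rw [if_pos hx, episodeStats, hF _ _ _ hx]
          simp only [Stats.update, if_pos hx]
          rw [runAvg_mul]
        · rw [if_neg hx, episodeStats, hF' _ _ _ hx]
          simp only [Stats.update, if_neg hx, add_zero]
    rw [stats, key H, obsSum, obsSum, Finset.sum_range_succ]

lemma count_eq (s₀ : S) (k : ℕ) (ω : Ω) (x : StateAction A) :
    ((I.stats s₀ k ω).n x : ℝ) = I.obsSum k ω x (fun _ _ => 1) := by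
  -- The constant 1 is the running average of ones, so the general identity also counts the
  -- observations.
  have := I.count_mul_stat s₀ ω x (fun _ => 1) (fun _ _ => 1)
    (fun i h st _ => by
      have := runAvg_mul (st.n x) 1 1
      have h0 : ((st.n x + 1 : ℕ) : ℝ) ≠ 0 := by positivity
      apply mul_left_cancel₀ h0
      rw [this]; push_cast; ring) (fun _ _ _ _ => rfl) k
  simpa using this

lemma count_mul_rHat (s₀ : S) (k : ℕ) (ω : Ω) (x : StateAction A) :
    ((I.stats s₀ k ω).n x : ℝ) * (I.stats s₀ k ω).rHat x =
      I.obsSum k ω x (fun i h => I.obsR i h x ω) := by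
  refine I.count_mul_stat s₀ ω x (fun st => st.rHat x) _ (fun i h st hx => ?_)
    (fun i h st hx => ?_) k
  · simp only [Stats.update, if_pos hx]
  · simp only [Stats.update, if_neg hx]

lemma count_mul_r2Hat (s₀ : S) (k : ℕ) (ω : Ω) (x : StateAction A) :
    ((I.stats s₀ k ω).n x : ℝ) * (I.stats s₀ k ω).r2Hat x =
      I.obsSum k ω x (fun i h => I.obsR i h x ω ^ 2) := by
  refine I.count_mul_stat s₀ ω x (fun st => st.r2Hat x) _ (fun i h st hx => ?_)
    (fun i h st hx => ?_) k
  · simp only [Stats.update, if_pos hx]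
  · simp only [Stats.update, if_neg hx]

lemma count_mul_epsHat (s₀ : S) (k : ℕ) (ω : Ω) (x : StateAction A) :
    ((I.stats s₀ k ω).n x : ℝ) * (I.stats s₀ k ω).epsHat x =
      I.obsSum k ω x (fun i h => I.bias i h x ω) := by
  refine I.count_mul_stat s₀ ω x (fun st => st.epsHat x) _ (fun i h st hx => ?_)
    (fun i h st hx => ?_) k
  · simp only [Stats.update, if_pos hx]
  · simp only [Stats.update, if_neg hx]

open Classical in
lemma count_mul_PHat (s₀ : S) (k : ℕ) (ω : Ω) (x : StateAction A) (y : S) :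
    ((I.stats s₀ k ω).n x : ℝ) * (I.stats s₀ k ω).PHat x y =
      I.obsSum k ω x (fun i h => if y = I.obsS i h x ω then 1 else 0) := by
  refine I.count_mul_stat s₀ ω x (fun st => st.PHat x y) _ (fun i h st hx => ?_)
    (fun i h st hx => ?_) k
  · simp only [Stats.update, if_pos hx]
  · simp only [Stats.update, if_neg hx]

/-! ### Linearity and monotonicity of sums over observations -/

section ObsSum

variable {I} {k : ℕ} {ω : Ω} {x : StateAction A} {g g' : ℕ → ℕ → ℝ}

lemma obsSum_congr (h : ∀ i < k, ∀ h < H, x ∈ I.observed i h ω → g i h = g' i h) :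
    I.obsSum k ω x g = I.obsSum k ω x g' := by
  classical
  refine Finset.sum_congr rfl fun i hi => Finset.sum_congr rfl fun j hj => ?_
  split_ifs with hx
  · exact h i (Finset.mem_range.1 hi) j (Finset.mem_range.1 hj) hx
  · rfl

lemma obsSum_mono (h : ∀ i < k, ∀ h < H, x ∈ I.observed i h ω → g i h ≤ g' i h) :
    I.obsSum k ω x g ≤ I.obsSum k ω x g' := by
  classical
  refine Finset.sum_le_sum fun i hi => Finset.sum_le_sum fun j hj => ?_
  split_ifs with hx
  · exact h i (Finset.mem_range.1 hi) j (Finset.mem_range.1 hj) hx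
  · exact le_rfl

lemma obsSum_add : I.obsSum k ω x (fun i h => g i h + g' i h) =
    I.obsSum k ω x g + I.obsSum k ω x g' := by
  classical
  simp only [obsSum, ← Finset.sum_add_distrib]
  exact Finset.sum_congr rfl fun i _ => Finset.sum_congr rfl fun j _ => by split_ifs <;> simp

lemma obsSum_const_mul (c : ℝ) : I.obsSum k ω x (fun i h => c * g i h) =
    c * I.obsSum k ω x g := by
  classical
  simp only [obsSum, Finset.mul_sum]
  exact Finset.sum_congr rfl fun i _ => Finset.sum_congr rfl fun j _ => by split_ifs <;> simp

lemma obsSum_sub : I.obsSum k ω x (fun i h => g i h - g' i h) =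
    I.obsSum k ω x g - I.obsSum k ω x g' := by
  classical
  simp only [obsSum, ← Finset.sum_sub_distrib]
  exact Finset.sum_congr rfl fun i _ => Finset.sum_congr rfl fun j _ => by split_ifs <;> simp

lemma obsSum_sum {ι : Type*} (s : Finset ι) (G : ι → ℕ → ℕ → ℝ) :
    I.obsSum k ω x (fun i h => ∑ y ∈ s, G y i h) = ∑ y ∈ s, I.obsSum k ω x (G y) := by
  classical
  simp only [obsSum]
  symm
  rw [Finset.sum_comm]
  refine Finset.sum_congr rfl fun i _ => ?_
  rw [Finset.sum_comm]
  exact Finset.sum_congr rfl fun j _ => by split_ifs <;> simp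

lemma abs_obsSum_le : |I.obsSum k ω x g| ≤ I.obsSum k ω x (fun i h => |g i h|) := by
  classical
  refine (Finset.abs_sum_le_sum_abs _ _).trans (Finset.sum_le_sum fun i _ =>
    (Finset.abs_sum_le_sum_abs _ _).trans (Finset.sum_le_sum fun j _ => ?_))
  split_ifs <;> simp

lemma obsSum_const (s₀ : S) (c : ℝ) :
    I.obsSum k ω x (fun _ _ => c) = (I.stats s₀ k ω).n x * c := by
  rw [I.count_eq s₀, mul_comm, ← obsSum_const_mul]
  simp

end ObsSum

/-- The pair `x` is observed at time `t`; the observation of step `h` of episode `k` belongs to the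
time `k * (H + 1) + (h + 1)`. -/
def obsEvent (x : StateAction A) (t : ℕ) : Set Ω :=
  {ω | t % (H + 1) ≠ 0 ∧ x ∈ I.observed (t / (H + 1)) (t % (H + 1) - 1) ω}

lemma sum_range_mul_add (f : ℕ → ℝ) (k : ℕ) :
    ∑ t ∈ Finset.range (k * (H + 1)), f t =
      ∑ i ∈ Finset.range k, ∑ j ∈ Finset.range (H + 1), f (i * (H + 1) + j) := by
  induction k with
  | zero => simp
  | succ k ih => rw [Finset.sum_range_succ, ← ih, add_mul, one_mul, Finset.sum_range_add]

/-- Sums over observations as sums over time. -/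
lemma sum_indicator_obsEvent (x : StateAction A) (g : ℕ → ℕ → Ω → ℝ) (k : ℕ) (ω : Ω) :
    ∑ t ∈ Finset.range (k * (H + 1)), (I.obsEvent x t).indicator
      (fun ω => g (t / (H + 1)) (t % (H + 1) - 1) ω) ω =
      I.obsSum k ω x (fun i h => g i h ω) := by
  classical
  rw [sum_range_mul_add, obsSum]
  refine Finset.sum_congr rfl fun i _ => ?_
  rw [Finset.sum_range_succ']
  -- The first of the H + 1 slots of an episode precedes the disclosure of the graph and carries no
  -- observation.
  have h0 : ω ∉ I.obsEvent x (i * (H + 1) + 0) := by simp [obsEvent]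
  rw [Set.indicator_of_notMem h0, add_zero]
  refine Finset.sum_congr rfl fun h hh => ?_
  have hlt : h + 1 < H + 1 := by have := Finset.mem_range.1 hh; omega
  have e1 : (i * (H + 1) + (h + 1)) / (H + 1) = i := by
    rw [mul_comm, Nat.mul_add_div (by omega), Nat.div_eq_of_lt hlt, add_zero]
  have e2 : (i * (H + 1) + (h + 1)) % (H + 1) = h + 1 := by
    rw [mul_comm, Nat.mul_add_mod, Nat.mod_eq_of_lt hlt]
  by_cases hx : x ∈ I.observed i h ω
  · have : ω ∈ I.obsEvent x (i * (H + 1) + (h + 1)) := by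
      simp only [obsEvent, Set.mem_ofPred_eq, e1, e2]
      exact ⟨by omega, by simpa using hx⟩
    rw [Set.indicator_of_mem this, if_pos hx]
    simp only [e1, e2, Nat.add_sub_cancel]
  · have : ω ∉ I.obsEvent x (i * (H + 1) + (h + 1)) := by
      simp only [obsEvent, Set.mem_ofPred_eq, e1, e2, not_and]
      intro _; simpa using hx
    rw [Set.indicator_of_notMem this, if_neg hx]

end Interaction

end StatsSums

/-! ### Conditional laws of the observations -/

namespace Interaction

variable {S : Type*} [Fintype S] {A : S → Type*} [∀ s, Fintype (A s)]
  {M : TabularMDP S A} {H : ℕ} {graphLaw : PMF (Digraph (StateAction A))}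
  {Ω : Type*} {mΩ : MeasurableSpace Ω} {μ : Measure Ω} (I : Interaction M H graphLaw μ)

/-- The information available just before the observations of step `h` of episode `k`. -/
abbrev past (k h : ℕ) : MeasurableSpace Ω := I.ℱ (k * (H + 1) + (h + 1))

lemma past_le (k h : ℕ) : I.past k h ≤ mΩ := I.ℱ.le _

lemma measurableSet_pair_zero (k : ℕ) (x : StateAction A) :
    MeasurableSet[I.ℱ (k * (H + 1))] {ω | I.pair k 0 ω = x} := by
  obtain ⟨s, a⟩ := x
  have e : {ω | I.pair k 0 ω = ⟨s, a⟩} = {ω | I.s1 k ω = s} ∩ {ω | I.π k ω 0 s = a} := by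
    ext ω
    simp only [I.pair_zero, Set.mem_ofPred_eq, Set.mem_inter_iff]
    constructor
    · intro h
      obtain ⟨h1, h2⟩ := Sigma.mk.inj_iff.1 h
      subst h1
      exact ⟨rfl, eq_of_heq h2⟩
    · rintro ⟨h1, h2⟩
      subst h1
      rw [h2]
  rw [e]
  exact (I.meas_init k s).inter (I.meas_policy k 0 s a)

lemma measurableSet_pair (k : ℕ) {h : ℕ} (hh : h ≤ H) (x : StateAction A) :
    MeasurableSet[I.past k h] {ω | I.pair k h ω = x} := by
  classical
  induction h generalizing x with
  | zero => exact I.ℱ.mono (by omega) _ (I.measurableSet_pair_zero k x)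
  | succ h ih =>
    obtain ⟨s, a⟩ := x
    have e : {ω | I.pair k (h + 1) ω = ⟨s, a⟩} =
        (⋃ z : StateAction A, {ω | I.pair k h ω = z} ∩ {ω | I.obsS k h z ω = s}) ∩
          {ω | I.π k ω (h + 1) s = a} := by
      ext ω
      simp only [I.pair_succ, Set.mem_ofPred_eq, Set.mem_inter_iff, Set.mem_iUnion]
      constructor
      · intro h'
        obtain ⟨h1, h2⟩ := Sigma.mk.inj_iff.1 h'
        refine ⟨⟨_, rfl, h1⟩, ?_⟩
        subst h1
        exact eq_of_heq h2
      · rintro ⟨⟨z, rfl, h1⟩, h2⟩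
        subst h1
        rw [h2]
    rw [e]
    refine MeasurableSet.inter (MeasurableSet.iUnion fun z => ?_) ?_
    · exact MeasurableSet.inter (I.ℱ.mono (by omega) _ (ih (by omega) z))
        (I.meas_obsS k h (by omega) z s)
    · exact I.ℱ.mono (by omega) _ (I.meas_policy k (h + 1) s a)

lemma measurableSet_adj (k h : ℕ) (P : Digraph (StateAction A) → Prop) :
    MeasurableSet[I.past k h] {ω | P (I.G k ω)} := by
  classical
  have e : {ω | P (I.G k ω)} = ⋃ g ∈ {g | P g}, {ω | I.G k ω = g} := by
    ext ω; simp
  rw [e]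
  exact MeasurableSet.biUnion (Set.to_countable _) fun g _ =>
    I.ℱ.mono (by omega) _ (I.meas_graph k g)

lemma measurableSet_observed (k : ℕ) {h : ℕ} (hh : h ≤ H) (x : StateAction A) :
    MeasurableSet[I.past k h] {ω | x ∈ I.observed k h ω} := by
  have e : {ω | x ∈ I.observed k h ω} = ⋃ z : StateAction A, {ω | I.pair k h ω = z} ∩
      {ω | x = z ∨ (I.G k ω).Adj z x} := by
    ext ω; simp [observed]
  rw [e]
  exact MeasurableSet.iUnion fun z => (I.measurableSet_pair k hh z).inter
    (I.measurableSet_adj k h fun g => x = z ∨ g.Adj z x)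

lemma time_eq {t : ℕ} (ht : t % (H + 1) ≠ 0) :
    t / (H + 1) * (H + 1) + (t % (H + 1) - 1 + 1) = t ∧ t % (H + 1) - 1 < H := by
  have h1 := Nat.div_add_mod t (H + 1)
  have h2 := Nat.mod_lt t (by omega : 0 < H + 1)
  rw [mul_comm] at h1
  constructor <;> omega

lemma measurableSet_obsEvent (x : StateAction A) (t : ℕ) :
    MeasurableSet[I.ℱ t] (I.obsEvent x t) := by
  by_cases ht : t % (H + 1) = 0
  · have : I.obsEvent x t = ∅ := by ext ω; simp [obsEvent, ht]
    rw [this]; exact @MeasurableSet.empty _ (I.ℱ t)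
  · obtain ⟨h1, h2⟩ := time_eq ht
    have e : I.obsEvent x t = {ω | x ∈ I.observed (t / (H + 1)) (t % (H + 1) - 1) ω} := by
      ext ω; simp [obsEvent, ht]
    rw [e]
    have := I.measurableSet_observed (t / (H + 1)) h2.le x
    unfold past at this
    rwa [h1] at this

variable [IsProbabilityMeasure μ]

/-- Time-uniform deviation bounds for functions of the observations of `x`. -/
lemma measure_obs_deviation (x : StateAction A) (Y : ℕ → ℕ → Ω → ℝ)
    (hY : ∀ k, ∀ h < H, Measurable[I.ℱ (k * (H + 1) + (h + 2))] (Y k h)) {z : ℝ}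
    (hYz : ∀ k h ω, |Y k h ω - z| ≤ 1) {p : ℝ} (hp : 0 < p) :
    μ {ω | ¬ ∀ k, ∀ j : ℕ,
      I.obsSum k ω x (fun i h => Y i h ω - (μ[Y i h | I.past i h]) ω) ≤
        (1 / 2) ^ (j + 1) * I.obsSum k ω x (fun i h => (Y i h ω - z) ^ 2)
          + Real.log ((j + 1) * (j + 2) / p) * 2 ^ (j + 1)} ≤ ENNReal.ofReal p := by
  classical
  -- The default z in slots without observation keeps the process adapted and bounded; `obsEvent`
  -- excludes these slots from the sums.
  set Y' : ℕ → Ω → ℝ := fun t => if t % (H + 1) = 0 then fun _ => z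
    else Y (t / (H + 1)) (t % (H + 1) - 1) with hY'
  have hY'm : ∀ t, Measurable[I.ℱ (t + 1)] (Y' t) := by
    intro t
    by_cases ht : t % (H + 1) = 0
    · simp only [hY', if_pos ht]; exact measurable_const
    · simp only [hY', if_neg ht]
      obtain ⟨h1, h2⟩ := time_eq ht
      have := hY (t / (H + 1)) _ h2
      have e : t / (H + 1) * (H + 1) + (t % (H + 1) - 1 + 2) = t + 1 := by omega
      rwa [e] at this
  have hY'z : ∀ t ω, |Y' t ω - z| ≤ 1 := by
    intro t ω
    by_cases ht : t % (H + 1) = 0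
    · simp [hY', ht]
    · simp only [hY', if_neg ht]; exact hYz _ _ _
  refine le_trans (measure_mono ?_) (measure_exists_dyadic_deviation I.ℱ Y' hY'm hY'z
    (I.obsEvent x) (I.measurableSet_obsEvent x) hp)
  intro ω hω hgood
  apply hω
  intro k j
  have hg := hgood (k * (H + 1)) j
  have e1 : ∑ t ∈ Finset.range (k * (H + 1)), (I.obsEvent x t).indicator
      (fun ω => Y' t ω - (μ[Y' t | I.ℱ t]) ω) ω =
      I.obsSum k ω x (fun i h => Y i h ω - (μ[Y i h | I.past i h]) ω) := by
    rw [← I.sum_indicator_obsEvent x (fun i h ω => Y i h ω - (μ[Y i h | I.past i h]) ω)]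
    refine Finset.sum_congr rfl fun t _ => ?_
    by_cases ht : t % (H + 1) = 0
    · have : ω ∉ I.obsEvent x t := by simp [obsEvent, ht]
      rw [Set.indicator_of_notMem this, Set.indicator_of_notMem this]
    · obtain ⟨h1, h2⟩ := time_eq ht
      have e : I.past (t / (H + 1)) (t % (H + 1) - 1) = I.ℱ t := by rw [past, h1]
      simp only [hY', if_neg ht, e]
  have e2 : ∑ t ∈ Finset.range (k * (H + 1)), (I.obsEvent x t).indicator
      (fun ω => (Y' t ω - z) ^ 2) ω = I.obsSum k ω x (fun i h => (Y i h ω - z) ^ 2) := by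
    rw [← I.sum_indicator_obsEvent x (fun i h ω => (Y i h ω - z) ^ 2)]
    refine Finset.sum_congr rfl fun t _ => ?_
    by_cases ht : t % (H + 1) = 0
    · have : ω ∉ I.obsEvent x t := by simp [obsEvent, ht]
      rw [Set.indicator_of_notMem this, Set.indicator_of_notMem this]
    · simp only [hY', if_neg ht]
  rw [e1, e2] at hg
  exact hg

lemma measurable_obsR (k : ℕ) {h : ℕ} (hh : h < H) (x : StateAction A) :
    Measurable (I.obsR k h x) := (I.meas_obsR k h hh x).mono (I.ℱ.le _) le_rfl

lemma measurableSet_obsS (k : ℕ) {h : ℕ} (hh : h < H) (x : StateAction A) (y : S) :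
    MeasurableSet {ω | I.obsS k h x ω = y} := I.ℱ.le _ _ (I.meas_obsS k h hh x y)

lemma integrable_obsR (k : ℕ) {h : ℕ} (hh : h < H) (x : StateAction A) :
    Integrable (I.obsR k h x) μ := by
  refine Integrable.of_bound (I.measurable_obsR k hh x).aestronglyMeasurable 1
    (ae_of_all _ fun ω => ?_)
  rw [Real.norm_eq_abs, abs_of_nonneg (I.obsR_mem k h x ω).1]
  exact (I.obsR_mem k h x ω).2

/-- The conditional probability that the observed successor state is `y`. -/
def condTrans (k h : ℕ) (x : StateAction A) (y : S) : Ω → ℝ :=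
  μ⟦{ω | I.obsS k h x ω = y} | I.past k h⟧

/-- The conditional expectation of the observed reward. -/
def condReward (k h : ℕ) (x : StateAction A) : Ω → ℝ := μ[I.obsR k h x | I.past k h]

/-- The conditional reward law is given one Borel set at a time, with a null set that may depend on
it. Integrating over D identifies the image of μ restricted to D with a multiple of the reward law,
which then determines the mean. -/
lemma setIntegral_obsR_eq (k : ℕ) {h : ℕ} (hh : h < H) (x : StateAction A) {D : Set Ω}
    (hD : MeasurableSet[I.past k h] D) (hDx : ∀ ω ∈ D, I.pair k h ω = x) :
    ∫ ω in D, I.obsR k h x ω ∂μ = μ.real D * M.meanReward x := by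
  have hDm : MeasurableSet D := I.past_le k h _ hD
  have hR := I.measurable_obsR k hh x
  have hprob := M.rewardLaw_prob x
  have hmap : (μ.restrict D).map (I.obsR k h x) = (μ D) • M.rewardLaw x := by
    ext B hB
    rw [Measure.map_apply hR hB, Measure.restrict_apply (hR hB), Measure.smul_apply, smul_eq_mul]
    have hBm : MeasurableSet {ω' | I.obsR k h x ω' ∈ B} := hR hB
    have h1 : ∫ ω in D, (μ⟦{ω' | I.obsR k h x ω' ∈ B} | I.past k h⟧) ω ∂μ =
        ∫ ω in D, (M.rewardLaw x).real B ∂μ := by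
      refine setIntegral_congr_ae hDm ?_
      filter_upwards [I.reward_law k h hh x B hB] with ω hω hωD
      exact hω (hDx ω hωD)
    rw [setIntegral_condExp (I.past_le k h) ((integrable_const 1).indicator hBm) hD,
      setIntegral_const, setIntegral_indicator hBm, setIntegral_const] at h1
    simp only [smul_eq_mul, mul_one, Measure.real] at h1
    have h2 := congrArg ENNReal.ofReal h1
    rw [ENNReal.ofReal_mul ENNReal.toReal_nonneg, ENNReal.ofReal_toReal (measure_ne_top _ _),
      ENNReal.ofReal_toReal (measure_ne_top _ _), ENNReal.ofReal_toReal (measure_ne_top _ _)] at h2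
    rw [← h2, Set.inter_comm]
    rfl
  have h3 : ∫ ω in D, I.obsR k h x ω ∂μ = ∫ r, r ∂((μ.restrict D).map (I.obsR k h x)) :=
    (integral_map hR.aemeasurable aestronglyMeasurable_id).symm
  rw [h3, hmap, integral_smul_measure]
  rfl

lemma condReward_of_pair (k : ℕ) {h : ℕ} (hh : h < H) (x : StateAction A) :
    ∀ᵐ ω ∂μ, I.pair k h ω = x → I.condReward k h x ω = M.meanReward x := by
  set D : Set Ω := {ω | I.pair k h ω = x} with hDdef
  have hD : MeasurableSet[I.past k h] D := I.measurableSet_pair k hh.le x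
  have hDm : MeasurableSet D := I.past_le k h _ hD
  have hint := I.integrable_obsR k hh x
  have h1 := condExp_indicator (m := I.past k h) hint hD
  have h2 : D.indicator (fun _ => M.meanReward x) =ᵐ[μ]
      μ[D.indicator (I.obsR k h x) | I.past k h] := by
    refine ae_eq_condExp_of_forall_setIntegral_eq (I.past_le k h) (hint.indicator hDm)
      (fun s _ _ => ((integrable_const _).indicator hDm).integrableOn) (fun s hs _ => ?_) ?_
    · rw [setIntegral_indicator hDm, setIntegral_indicator hDm, setIntegral_const,
        I.setIntegral_obsR_eq k hh x (hs.inter hD) (fun ω hω => hω.2)]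
      rfl
    · exact (stronglyMeasurable_const.indicator hD).aestronglyMeasurable
  filter_upwards [h1, h2] with ω e1 e2 hω
  rw [e1] at e2
  have hωD : ω ∈ D := hω
  rw [Set.indicator_of_mem hωD, Set.indicator_of_mem hωD] at e2
  exact e2.symm

/-- The observation of the current pair is unbiased and reported biases are nonnegative, so own and
side observations obey one common estimate. -/
lemma condReward_bias (k : ℕ) {h : ℕ} (hh : h < H) (x : StateAction A) :
    ∀ᵐ ω ∂μ, x ∈ I.observed k h ω →
      |I.condReward k h x ω - M.meanReward x| ≤ I.bias k h x ω := by
  filter_upwards [I.condReward_of_pair k hh x, I.side_reward k h hh x] with ω h1 h2 hx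
  rcases hx with hx | hx
  · rw [h1 hx.symm, sub_self, abs_zero]; exact I.bias_nonneg k h x ω
  · exact h2 hx

lemma condTrans_bias (k : ℕ) {h : ℕ} (hh : h < H) (x : StateAction A) :
    ∀ᵐ ω ∂μ, x ∈ I.observed k h ω →
      ∑ y, |I.condTrans k h x y ω - M.trans x y| ≤ I.bias k h x ω := by
  have h1 : ∀ᵐ ω ∂μ, ∀ y, I.pair k h ω = x → I.condTrans k h x y ω = M.trans x y :=
    ae_all_iff.2 fun y => I.trans_law k h hh x y
  filter_upwards [h1, I.side_trans k h hh x] with ω h1 h2 hx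
  rcases hx with hx | hx
  · refine le_of_eq_of_le (Finset.sum_eq_zero fun y _ => ?_) (I.bias_nonneg k h x ω)
    rw [h1 y hx.symm, sub_self, abs_zero]
  · exact h2 hx

/-- Conditional expectations of functions of the observed successor state. -/
lemma condExp_comp_obsS (k : ℕ) {h : ℕ} (hh : h < H) (x : StateAction A) (g : S → ℝ) :
    ∀ᵐ ω ∂μ, (μ[fun ω => g (I.obsS k h x ω) | I.past k h]) ω =
      ∑ y, I.condTrans k h x y ω * g y := by
  classical
  have hind : ∀ y, Integrable ({ω | I.obsS k h x ω = y}.indicator fun _ => (1 : ℝ)) μ :=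
    fun y => (integrable_const 1).indicator (I.measurableSet_obsS k hh x y)
  have e : (fun ω => g (I.obsS k h x ω)) =
      ∑ y, g y • ({ω | I.obsS k h x ω = y}.indicator fun _ => (1 : ℝ)) := by
    ext ω
    simp only [Finset.sum_apply, Pi.smul_apply, smul_eq_mul]
    rw [Finset.sum_eq_single (I.obsS k h x ω)]
    · simp
    · intro y _ hy
      rw [Set.indicator_of_notMem (by simpa using Ne.symm hy), mul_zero]
    · simp
  rw [e]
  have h1 := condExp_finsetSum (s := Finset.univ) (fun y _ => (hind y).smul (g y)) (I.past k h)
  have h2 : ∀ᵐ ω ∂μ, ∀ y, (μ[g y • ({ω | I.obsS k h x ω = y}.indicator fun _ => (1 : ℝ)) |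
      I.past k h]) ω = g y * I.condTrans k h x y ω :=
    ae_all_iff.2 fun y => condExp_smul (g y) _ (I.past k h)
  filter_upwards [h1, h2] with ω e1 e2
  rw [e1, Finset.sum_apply]
  exact Finset.sum_congr rfl fun y _ => by rw [e2 y, mul_comm]

lemma condTrans_sum (k : ℕ) {h : ℕ} (hh : h < H) (x : StateAction A) :
    ∀ᵐ ω ∂μ, ∑ y, I.condTrans k h x y ω = 1 := by
  filter_upwards [I.condExp_comp_obsS k hh x (fun _ => 1)] with ω hω
  rw [condExp_const (I.past_le k h)] at hω
  simpa using hω.symm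

end Interaction

/-! ### The concentration event -/

namespace Interaction

variable {S : Type*} [Fintype S] {A : S → Type*} [∀ s, Fintype (A s)]
  {M : TabularMDP S A} {H : ℕ} {graphLaw : PMF (Digraph (StateAction A))}
  {Ω : Type*} {mΩ : MeasurableSpace Ω} {μ : Measure Ω} (I : Interaction M H graphLaw μ)

/-- Average of the conditional successor distributions of the observations of `x`. -/
def avgTrans (s₀ : S) (k : ℕ) (ω : Ω) (x : StateAction A) (y : S) : ℝ :=
  I.obsSum k ω x (fun i h => I.condTrans i h x y ω) / (I.stats s₀ k ω).n x

/-- Average of the conditional mean rewards of the observations of `x`. -/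
def avgReward (s₀ : S) (k : ℕ) (ω : Ω) (x : StateAction A) : ℝ :=
  I.obsSum k ω x (fun i h => I.condReward i h x ω) / (I.stats s₀ k ω).n x

lemma obsSum_comp_obsS (s₀ : S) (k : ℕ) (ω : Ω) (x : StateAction A) (g : S → ℝ) :
    I.obsSum k ω x (fun i h => g (I.obsS i h x ω)) =
      (I.stats s₀ k ω).n x * ∑ y, (I.stats s₀ k ω).PHat x y * g y := by
  classical
  rw [Finset.mul_sum]
  have : ∀ y, ((I.stats s₀ k ω).n x : ℝ) * ((I.stats s₀ k ω).PHat x y * g y) =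
      I.obsSum k ω x (fun i h => g y * if y = I.obsS i h x ω then 1 else 0) := by
    intro y
    rw [obsSum_const_mul, ← I.count_mul_PHat s₀]; ring
  rw [Finset.sum_congr rfl fun y _ => this y, ← obsSum_sum]
  refine obsSum_congr fun i _ h _ _ => ?_
  simp

variable [IsProbabilityMeasure μ]

lemma ae_abs_sub_condExp_le {Y : Ω → ℝ} (hY : Measurable Y) {z : ℝ} (hYz : ∀ ω, |Y ω - z| ≤ 1)
    {m : MeasurableSpace Ω} (hm : m ≤ mΩ) : ∀ᵐ ω ∂μ, |Y ω - (μ[Y | m]) ω| ≤ 2 := by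
  have hYint : Integrable Y μ := by
    refine Integrable.of_bound hY.aestronglyMeasurable (1 + |z|) (ae_of_all _ fun ω => ?_)
    rw [Real.norm_eq_abs]
    calc |Y ω| = |(Y ω - z) + z| := by ring_nf
      _ ≤ |Y ω - z| + |z| := abs_add_le _ _
      _ ≤ _ := by linarith [hYz ω]
  have h1 := condExp_mono (μ := μ) (m := m) (integrable_const (z - 1)) hYint
    (ae_of_all _ fun ω => by have := (abs_le.1 (hYz ω)).1; linarith)
  have h2 := condExp_mono (μ := μ) (m := m) hYint (integrable_const (z + 1))
    (ae_of_all _ fun ω => by have := (abs_le.1 (hYz ω)).2; linarith)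
  rw [condExp_const hm] at h1 h2
  filter_upwards [h1, h2] with ω a b
  have := abs_le.1 (hYz ω)
  rw [abs_le]
  constructor <;> linarith [this.1, this.2]

/-- Deviation bounds in terms of the confidence width. -/
lemma exists_deviation_event (s₀ : S) (x : StateAction A) (Y : ℕ → ℕ → Ω → ℝ)
    (hY : ∀ k, ∀ h < H, Measurable[I.ℱ (k * (H + 1) + (h + 2))] (Y k h)) {z : ℝ}
    (hYz : ∀ k h ω, |Y k h ω - z| ≤ 1) {p : ℝ} (hp : 0 < p) (hp' : p ≤ 1 / 32) :
    ∃ N : Set Ω, μ N ≤ ENNReal.ofReal p ∧ ∀ ω ∉ N, ∀ k, 0 < (I.stats s₀ k ω).n x →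
      I.obsSum k ω x (fun i h => Y i h ω - (μ[Y i h | I.past i h]) ω) / (I.stats s₀ k ω).n x ≤
        3.63 * width p ((I.stats s₀ k ω).n x) *
          Real.sqrt (I.obsSum k ω x (fun i h => (Y i h ω - z) ^ 2) / (I.stats s₀ k ω).n x)
        + 5.6 * width p ((I.stats s₀ k ω).n x) ^ 2 ∧
      I.obsSum k ω x (fun i h => Y i h ω - (μ[Y i h | I.past i h]) ω) / (I.stats s₀ k ω).n x ≤
        I.obsSum k ω x (fun i h => (Y i h ω - z) ^ 2) / (I.stats s₀ k ω).n x / 2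
        + 4 * width p ((I.stats s₀ k ω).n x) ^ 2 := by
  have hae : ∀ᵐ ω ∂μ, ∀ i h, h < H → |Y i h ω - (μ[Y i h | I.past i h]) ω| ≤ 2 := by
    rw [ae_all_iff]; intro i
    rw [ae_all_iff]; intro h
    by_cases hh : h < H
    · filter_upwards [ae_abs_sub_condExp_le (μ := μ) ((hY i h hh).mono (I.ℱ.le _) le_rfl)
        (hYz i h) (I.past_le i h)] with ω hω _
      exact hω
    · exact ae_of_all _ fun ω h' => absurd h' hh
  have hdev := I.measure_obs_deviation x Y hY hYz hp
  refine ⟨_ ∪ {ω | ¬ ∀ i h, h < H → |Y i h ω - (μ[Y i h | I.past i h]) ω| ≤ 2},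
    (measure_union_le _ _).trans ((add_le_add hdev (le_of_eq (ae_iff.1 hae))).trans
      (by rw [add_zero])), ?_⟩
  intro ω hω k hn
  have h1 := not_not.1 fun h => hω (Or.inl h)
  have h2 := not_not.1 fun h => hω (Or.inr h)
  have hD : I.obsSum k ω x (fun i h => Y i h ω - (μ[Y i h | I.past i h]) ω) ≤
      2 * ((I.stats s₀ k ω).n x : ℝ) := by
    rw [mul_comm, ← obsSum_const]
    exact obsSum_mono fun i _ h hh _ => (le_abs_self _).trans (h2 i h hh)
  have hV : 0 ≤ I.obsSum k ω x (fun i h => (Y i h ω - z) ^ 2) := by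
    have := obsSum_mono (I := I) (k := k) (ω := ω) (x := x) (g := fun _ _ => 0)
      (g' := fun i h => (Y i h ω - z) ^ 2) fun i _ h _ _ => sq_nonneg _
    rwa [obsSum_const s₀, mul_zero] at this
  have hVn : I.obsSum k ω x (fun i h => (Y i h ω - z) ^ 2) ≤ ((I.stats s₀ k ω).n x : ℝ) := by
    rw [← mul_one ((I.stats s₀ k ω).n x : ℝ), ← obsSum_const]
    refine obsSum_mono fun i _ h _ _ => ?_
    rw [← sq_abs]
    exact pow_le_one₀ (abs_nonneg _) (hYz i h ω)
  exact ⟨deviation_le_width hp hp' hn hD hV hVn (h1 k),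
    deviation_le_half_add_width hp hp' hn hD hV (h1 k)⟩

/-- Deviation bounds for functions of the observed successor states. -/
lemma exists_trans_deviation_event (s₀ : S) (x : StateAction A) (g : S → ℝ) {z : ℝ}
    (hgz : ∀ s, |g s - z| ≤ 1) {p : ℝ} (hp : 0 < p) (hp' : p ≤ 1 / 32) :
    ∃ N : Set Ω, μ N ≤ ENNReal.ofReal p ∧ ∀ ω ∉ N, ∀ k, 0 < (I.stats s₀ k ω).n x →
      ∑ y, (I.stats s₀ k ω).PHat x y * g y - ∑ y, I.avgTrans s₀ k ω x y * g y ≤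
        3.63 * width p ((I.stats s₀ k ω).n x) *
          Real.sqrt (∑ y, (I.stats s₀ k ω).PHat x y * (g y - z) ^ 2)
        + 5.6 * width p ((I.stats s₀ k ω).n x) ^ 2 ∧
      ∑ y, (I.stats s₀ k ω).PHat x y * g y - ∑ y, I.avgTrans s₀ k ω x y * g y ≤
        (∑ y, (I.stats s₀ k ω).PHat x y * (g y - z) ^ 2) / 2
        + 4 * width p ((I.stats s₀ k ω).n x) ^ 2 := by
  classical
  have hmeas : ∀ k, ∀ h < H, Measurable[I.ℱ (k * (H + 1) + (h + 2))]
      (fun ω => g (I.obsS k h x ω)) := by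
    intro k h hh
    have e : (fun ω => g (I.obsS k h x ω)) =
        fun ω => ∑ y, {ω | I.obsS k h x ω = y}.indicator (fun _ => g y) ω := by
      ext ω
      rw [Finset.sum_eq_single (I.obsS k h x ω)]
      · simp
      · intro y _ hy
        rw [Set.indicator_of_notMem (by simpa using Ne.symm hy)]
      · simp
    rw [e]
    exact Finset.measurable_sum _ fun y _ =>
      measurable_const.indicator (I.meas_obsS k h hh x y)
  obtain ⟨N, hN, hdev⟩ := I.exists_deviation_event s₀ x (fun k h ω => g (I.obsS k h x ω)) hmeas
    (fun k h ω => hgz _) hp hp'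
  have hae : ∀ᵐ ω ∂μ, ∀ i h, h < H →
      (μ[fun ω => g (I.obsS i h x ω) | I.past i h]) ω = ∑ y, I.condTrans i h x y ω * g y := by
    rw [ae_all_iff]; intro i
    rw [ae_all_iff]; intro h
    by_cases hh : h < H
    · filter_upwards [I.condExp_comp_obsS i hh x g] with ω hω _
      exact hω
    · exact ae_of_all _ fun ω h' => absurd h' hh
  refine ⟨N ∪ {ω | ¬ ∀ i h, h < H →
      (μ[fun ω => g (I.obsS i h x ω) | I.past i h]) ω = ∑ y, I.condTrans i h x y ω * g y},
    (measure_union_le _ _).trans ((add_le_add hN (le_of_eq (ae_iff.1 hae))).trans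
      (by rw [add_zero])), ?_⟩
  intro ω hω k hn
  have h1 := hdev ω (fun h => hω (Or.inl h)) k hn
  have h2 := not_not.1 fun h => hω (Or.inr h)
  have hn' : ((I.stats s₀ k ω).n x : ℝ) ≠ 0 := by
    have : (0 : ℝ) < (I.stats s₀ k ω).n x := by exact_mod_cast hn
    exact this.ne'
  have e1 : I.obsSum k ω x (fun i h => g (I.obsS i h x ω) -
      (μ[fun ω => g (I.obsS i h x ω) | I.past i h]) ω) / (I.stats s₀ k ω).n x =
      ∑ y, (I.stats s₀ k ω).PHat x y * g y - ∑ y, I.avgTrans s₀ k ω x y * g y := by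
    rw [obsSum_sub, I.obsSum_comp_obsS s₀, sub_div, mul_div_cancel_left₀ _ hn']
    congr 1
    rw [obsSum_congr (g' := fun i h => ∑ y, I.condTrans i h x y ω * g y)
      fun i _ h hh _ => h2 i h hh, obsSum_sum, Finset.sum_div]
    refine Finset.sum_congr rfl fun y _ => ?_
    have : (fun i h => I.condTrans i h x y ω * g y) =
        fun i h => g y * I.condTrans i h x y ω := by ext; ring
    rw [this, obsSum_const_mul, avgTrans]; ring
  have e2 : I.obsSum k ω x (fun i h => (g (I.obsS i h x ω) - z) ^ 2) / (I.stats s₀ k ω).n x =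
      ∑ y, (I.stats s₀ k ω).PHat x y * (g y - z) ^ 2 := by
    rw [I.obsSum_comp_obsS s₀ k ω x (fun y => (g y - z) ^ 2), mul_div_cancel_left₀ _ hn']
  rwa [e1, e2] at h1

/-- Deviation bounds for the observed rewards. -/
lemma exists_reward_deviation_event (s₀ : S) (x : StateAction A) {p : ℝ} (hp : 0 < p)
    (hp' : p ≤ 1 / 32) :
    ∃ N : Set Ω, μ N ≤ ENNReal.ofReal (2 * p) ∧ ∀ ω ∉ N, ∀ k, 0 < (I.stats s₀ k ω).n x →
      |(I.stats s₀ k ω).rHat x - I.avgReward s₀ k ω x| ≤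
        3.63 * width p ((I.stats s₀ k ω).n x) *
          Real.sqrt (((I.stats s₀ k ω).r2Hat x - (I.stats s₀ k ω).rHat x ^ 2)
            + ((I.stats s₀ k ω).rHat x - M.meanReward x) ^ 2)
        + 5.6 * width p ((I.stats s₀ k ω).n x) ^ 2 := by
  have hr0 := M.meanReward_nonneg x
  have hr1 := M.meanReward_le_one x
  obtain ⟨N1, hN1, hd1⟩ := I.exists_deviation_event s₀ x (fun k h => I.obsR k h x)
    (fun k h hh => I.meas_obsR k h hh x) (z := M.meanReward x)
    (fun k h ω => by
      have := I.obsR_mem k h x ω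
      rw [abs_le]; constructor <;> linarith [this.1, this.2]) hp hp'
  -- The negated rewards supply the other side of the deviation.
  obtain ⟨N2, hN2, hd2⟩ := I.exists_deviation_event s₀ x (fun k h => -I.obsR k h x)
    (fun k h hh => (I.meas_obsR k h hh x).neg) (z := -M.meanReward x)
    (fun k h ω => by
      have := I.obsR_mem k h x ω
      simp only [Pi.neg_apply]
      rw [abs_le]; constructor <;> linarith [this.1, this.2]) hp hp'
  have hae : ∀ᵐ ω ∂μ, ∀ i h, (μ[-I.obsR i h x | I.past i h]) ω = - I.condReward i h x ω :=
    ae_all_iff.2 fun i => ae_all_iff.2 fun h => condExp_neg _ _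
  refine ⟨N1 ∪ N2 ∪ {ω | ¬ ∀ i h, (μ[-I.obsR i h x | I.past i h]) ω = - I.condReward i h x ω},
    ?_, ?_⟩
  · refine (measure_union_le _ _).trans ?_
    rw [ae_iff.1 hae, add_zero, two_mul, ENNReal.ofReal_add hp.le hp.le]
    exact (measure_union_le _ _).trans (add_le_add hN1 hN2)
  intro ω hω k hn
  have h1 := (hd1 ω (fun h => hω (Or.inl (Or.inl h))) k hn).1
  have h2 := (hd2 ω (fun h => hω (Or.inl (Or.inr h))) k hn).1
  have h3 := not_not.1 fun h => hω (Or.inr h)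
  have hn' : ((I.stats s₀ k ω).n x : ℝ) ≠ 0 := by
    have : (0 : ℝ) < (I.stats s₀ k ω).n x := by exact_mod_cast hn
    exact this.ne'
  have eD : I.obsSum k ω x (fun i h => I.obsR i h x ω - (μ[I.obsR i h x | I.past i h]) ω) /
      (I.stats s₀ k ω).n x = (I.stats s₀ k ω).rHat x - I.avgReward s₀ k ω x := by
    rw [obsSum_sub, ← I.count_mul_rHat s₀, sub_div, mul_div_cancel_left₀ _ hn']
    rfl
  have eV : I.obsSum k ω x (fun i h => (I.obsR i h x ω - M.meanReward x) ^ 2) /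
      (I.stats s₀ k ω).n x = ((I.stats s₀ k ω).r2Hat x - (I.stats s₀ k ω).rHat x ^ 2)
            + ((I.stats s₀ k ω).rHat x - M.meanReward x) ^ 2 := by
    have : (fun i h => (I.obsR i h x ω - M.meanReward x) ^ 2) = fun i h =>
        (I.obsR i h x ω ^ 2 - (2 * M.meanReward x) * I.obsR i h x ω) + M.meanReward x ^ 2 := by
      ext; ring
    rw [this, obsSum_add, obsSum_sub, obsSum_const_mul, obsSum_const s₀, ← I.count_mul_rHat s₀,
      ← I.count_mul_r2Hat s₀]
    field_simp
    ring
  have eD' : I.obsSum k ω x (fun i h => (-I.obsR i h x) ω - (μ[-I.obsR i h x | I.past i h]) ω) /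
      (I.stats s₀ k ω).n x = -((I.stats s₀ k ω).rHat x - I.avgReward s₀ k ω x) := by
    rw [← eD, ← neg_div]
    congr 1
    rw [neg_eq_neg_one_mul, ← obsSum_const_mul]
    refine obsSum_congr fun i _ h _ _ => ?_
    rw [h3 i h, Pi.neg_apply, condReward]; ring
  have eV' : I.obsSum k ω x (fun i h => ((-I.obsR i h x) ω - -M.meanReward x) ^ 2) =
      I.obsSum k ω x (fun i h => (I.obsR i h x ω - M.meanReward x) ^ 2) := by
    refine obsSum_congr fun i _ h _ _ => ?_
    rw [Pi.neg_apply]; ring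
  rw [eD, eV] at h1
  rw [eD', eV', eV] at h2
  exact abs_le.2 ⟨by linarith, h1⟩

/-- The averages of the conditional laws are close to the true quantities. -/
lemma ae_avg_bias (s₀ : S) (x : StateAction A) : ∀ᵐ ω ∂μ, ∀ k, 0 < (I.stats s₀ k ω).n x →
    |I.avgReward s₀ k ω x - M.meanReward x| ≤ (I.stats s₀ k ω).epsHat x ∧
    ∑ y, I.avgTrans s₀ k ω x y = 1 ∧
    ∑ y, |I.avgTrans s₀ k ω x y - M.trans x y| ≤ (I.stats s₀ k ω).epsHat x := by
  have hae : ∀ᵐ ω ∂μ, ∀ i h, h < H →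
      (x ∈ I.observed i h ω → |I.condReward i h x ω - M.meanReward x| ≤ I.bias i h x ω) ∧
      (x ∈ I.observed i h ω → ∑ y, |I.condTrans i h x y ω - M.trans x y| ≤ I.bias i h x ω) ∧
      ∑ y, I.condTrans i h x y ω = 1 := by
    rw [ae_all_iff]; intro i
    rw [ae_all_iff]; intro h
    by_cases hh : h < H
    · filter_upwards [I.condReward_bias i hh x, I.condTrans_bias i hh x, I.condTrans_sum i hh x]
        with ω h1 h2 h3 _
      exact ⟨h1, h2, h3⟩
    · exact ae_of_all _ fun ω h' => absurd h' hh
  filter_upwards [hae] with ω hω k hn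
  have hn0 : (0 : ℝ) < (I.stats s₀ k ω).n x := by exact_mod_cast hn
  have heps : (I.stats s₀ k ω).epsHat x =
      I.obsSum k ω x (fun i h => I.bias i h x ω) / (I.stats s₀ k ω).n x := by
    rw [← I.count_mul_epsHat s₀, mul_div_cancel_left₀ _ hn0.ne']
  refine ⟨?_, ?_, ?_⟩
  · have e : I.avgReward s₀ k ω x - M.meanReward x =
        I.obsSum k ω x (fun i h => I.condReward i h x ω - M.meanReward x) /
          (I.stats s₀ k ω).n x := by
      rw [obsSum_sub, obsSum_const s₀, avgReward]; field_simp
    rw [e, abs_div, abs_of_pos hn0, heps]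
    gcongr
    exact abs_obsSum_le.trans (obsSum_mono fun i _ h hh hx => (hω i h hh).1 hx)
  · simp only [avgTrans]
    rw [← Finset.sum_div, ← obsSum_sum,
      obsSum_congr (g' := fun _ _ => 1) fun i _ h hh _ => (hω i h hh).2.2,
      obsSum_const s₀, mul_one, div_self hn0.ne']
  · have e : ∀ y, |I.avgTrans s₀ k ω x y - M.trans x y| ≤
        I.obsSum k ω x (fun i h => |I.condTrans i h x y ω - M.trans x y|) /
          (I.stats s₀ k ω).n x := by
      intro y
      have : I.avgTrans s₀ k ω x y - M.trans x y =
          I.obsSum k ω x (fun i h => I.condTrans i h x y ω - M.trans x y) /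
          (I.stats s₀ k ω).n x := by
        rw [obsSum_sub, obsSum_const s₀, avgTrans]; field_simp
      rw [this, abs_div, abs_of_pos hn0]
      gcongr
      exact abs_obsSum_le
    refine (Finset.sum_le_sum fun y _ => e y).trans ?_
    rw [← Finset.sum_div, ← obsSum_sum, heps]
    gcongr
    exact obsSum_mono fun i _ h hh hx => (hω i h hh).2.1 hx

end Interaction

/-! ### Union bound over all confidence statements -/

lemma measure_biUnion_le_ofReal {Ω ι : Type*} {mΩ : MeasurableSpace Ω} {μ : Measure Ω}
    (s : Finset ι) {N : ι → Set Ω} {q : ℝ}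
    (h : ∀ i ∈ s, μ (N i) ≤ ENNReal.ofReal q) :
    μ (⋃ i ∈ s, N i) ≤ ENNReal.ofReal (s.card * q) := by
  refine (measure_biUnion_finset_le s N).trans ((Finset.sum_le_sum h).trans ?_)
  rw [Finset.sum_const, nsmul_eq_mul, ENNReal.ofReal_mul (by positivity), ENNReal.ofReal_natCast]

namespace Interaction

variable {S : Type*} [Fintype S] {A : S → Type*} [∀ s, Fintype (A s)]
  {M : TabularMDP S A} {H : ℕ} {graphLaw : PMF (Digraph (StateAction A))}
  {Ω : Type*} {mΩ : MeasurableSpace Ω} {μ : Measure Ω} (I : Interaction M H graphLaw μ)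
  [IsProbabilityMeasure μ]

/-- Two-sided deviation bounds for functions of the observed successor states. -/
lemma exists_trans_abs_deviation_event (s₀ : S) (x : StateAction A) (f : S → ℝ) {z c : ℝ}
    (hc : 0 < c) (hfz : ∀ s, |f s - z| ≤ c) {p : ℝ} (hp : 0 < p) (hp' : p ≤ 1 / 32) :
    ∃ N : Set Ω, μ N ≤ ENNReal.ofReal (2 * p) ∧ ∀ ω ∉ N, ∀ k, 0 < (I.stats s₀ k ω).n x →
      |∑ y, (I.stats s₀ k ω).PHat x y * f y - ∑ y, I.avgTrans s₀ k ω x y * f y| ≤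
        3.63 * width p ((I.stats s₀ k ω).n x) *
          Real.sqrt (∑ y, (I.stats s₀ k ω).PHat x y * (f y - z) ^ 2)
        + 5.6 * c * width p ((I.stats s₀ k ω).n x) ^ 2 := by
  -- Dividing by c normalises the deviation from z to at most 1; the sign σ treats both sides at
  -- once.
  have key : ∀ σ : ℝ, σ ^ 2 = 1 → ∃ N : Set Ω, μ N ≤ ENNReal.ofReal p ∧ ∀ ω ∉ N, ∀ k,
      0 < (I.stats s₀ k ω).n x →
      σ * (∑ y, (I.stats s₀ k ω).PHat x y * f y - ∑ y, I.avgTrans s₀ k ω x y * f y) ≤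
        3.63 * width p ((I.stats s₀ k ω).n x) *
          Real.sqrt (∑ y, (I.stats s₀ k ω).PHat x y * (f y - z) ^ 2)
        + 5.6 * c * width p ((I.stats s₀ k ω).n x) ^ 2 := by
    intro σ hσ
    have hσ1 : |σ| = 1 := by
      rw [← Real.sqrt_sq_eq_abs, hσ, Real.sqrt_one]
    obtain ⟨N, hN, hd⟩ := I.exists_trans_deviation_event s₀ x (fun s => σ / c * f s)
      (z := σ / c * z) (fun s => by
        rw [← mul_sub, abs_mul, abs_div, hσ1, abs_of_pos hc, one_div,
          inv_mul_le_iff₀ hc, mul_one]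
        exact hfz s) hp hp'
    refine ⟨N, hN, fun ω hω k hn => ?_⟩
    have h1 := (hd ω hω k hn).1
    have e1 : ∀ q : S → ℝ, ∑ y, q y * (σ / c * f y) = σ / c * ∑ y, q y * f y := by
      intro q
      rw [Finset.mul_sum]
      exact Finset.sum_congr rfl fun y _ => by ring
    have e2 : ∑ y, (I.stats s₀ k ω).PHat x y * (σ / c * f y - σ / c * z) ^ 2 =
        (1 / c) ^ 2 * ∑ y, (I.stats s₀ k ω).PHat x y * (f y - z) ^ 2 := by
      rw [Finset.mul_sum]
      refine Finset.sum_congr rfl fun y _ => ?_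
      have : (σ / c * f y - σ / c * z) ^ 2 = σ ^ 2 * (1 / c) ^ 2 * (f y - z) ^ 2 := by ring
      rw [this, hσ]; ring
    rw [e1, e1, e2, Real.sqrt_mul (sq_nonneg _), Real.sqrt_sq (by positivity)] at h1
    have h2 := mul_le_mul_of_nonneg_left h1 hc.le
    have e3 : ∀ a b : ℝ, c * (σ / c * a - σ / c * b) = σ * (a - b) := by
      intro a b; field_simp
    have e4 : ∀ a b d : ℝ, c * (a * (1 / c * b) + 5.6 * d) = a * b + 5.6 * c * d := by
      intro a b d; field_simp
    rwa [e3, e4] at h2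
  obtain ⟨N1, hN1, h1⟩ := key 1 (by norm_num)
  obtain ⟨N2, hN2, h2⟩ := key (-1) (by norm_num)
  refine ⟨N1 ∪ N2, ?_, fun ω hω k hn => ?_⟩
  · rw [two_mul, ENNReal.ofReal_add hp.le hp.le]
    exact (measure_union_le _ _).trans (add_le_add hN1 hN2)
  · have a := h1 ω (fun h => hω (Or.inl h)) k hn
    have b := h2 ω (fun h => hω (Or.inr h)) k hn
    exact abs_le.2 ⟨by linarith, by linarith⟩

/-- The failure probability of a single confidence statement. -/
lemma failure_prob_bounds [∀ s, Nonempty (A s)] {inp : AlgInput A} (hv : inp.Valid M H)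
    (hX : 2 ≤ Fintype.card (StateAction A)) (hH : 0 < H) :
    0 < inp.δ / (Fintype.card (StateAction A) * (4 * inp.Shat + 5 * H + 7) : ℝ) ∧
    inp.δ / (Fintype.card (StateAction A) * (4 * inp.Shat + 5 * H + 7) : ℝ) ≤ 1 / 32 := by
  have hx : Nonempty (StateAction A) := Fintype.card_pos_iff.1 (by omega)
  have hS : (1 : ℝ) ≤ inp.Shat := by exact_mod_cast hv.one_le_Shat hx.some
  have hX' : (2 : ℝ) ≤ Fintype.card (StateAction A) := by exact_mod_cast hX
  have hH' : (1 : ℝ) ≤ H := by exact_mod_cast hH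
  -- At least two pairs, Ŝ ≥ 1 and H ≥ 1 give 2 · (4 + 5 + 7); this is the origin of the condition p
  -- ≤ 1/32 in the width lemmas.
  have hden : (32 : ℝ) ≤ Fintype.card (StateAction A) * (4 * inp.Shat + 5 * H + 7) := by
    nlinarith
  have := hv.δ_pos
  refine ⟨by positivity, ?_⟩
  rw [div_le_div_iff₀ (by linarith) (by norm_num)]
  nlinarith [hv.δ_le]

/-- All confidence statements for one pair hold with high probability. -/
lemma exists_pair_concentration_event [∀ s, Nonempty (A s)] (s₀ : S) {inp : AlgInput A}
    (hv : inp.Valid M H) (x : StateAction A) {p : ℝ} (hp : 0 < p) (hp' : p ≤ 1 / 32)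
    (hφ : ∀ n, inp.phi H n = width p n) :
    ∃ N : Set Ω, μ N ≤ ENNReal.ofReal ((2 * inp.Shat + 2 * H + 3) * p) ∧ ∀ ω ∉ N, ∀ k,
      0 < (I.stats s₀ k ω).n x → ∀ h < H, ConcAt (M.trans x) (I.avgTrans s₀ k ω x)
        ((I.stats s₀ k ω).PHat x) (M.meanReward x) (I.avgReward s₀ k ω x)
        ((I.stats s₀ k ω).rHat x) ((I.stats s₀ k ω).r2Hat x) ((I.stats s₀ k ω).epsHat x)
        (inp.phi H ((I.stats s₀ k ω).n x)) (inp.VmaxNext h x)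
        (fun s => min (M.optV H (h + 1) s) (inp.VmaxNext h x)) := by
  classical
  obtain ⟨Nr, hNr, hr⟩ := I.exists_reward_deviation_event s₀ x hp hp'
  have hf : ∀ h : ℕ, ∃ N : Set Ω, μ N ≤ ENNReal.ofReal (2 * p) ∧ (h < H → ∀ ω ∉ N, ∀ k,
      0 < (I.stats s₀ k ω).n x →
      |∑ y, (I.stats s₀ k ω).PHat x y * min (M.optV H (h + 1) y) (inp.VmaxNext h x) -
        ∑ y, I.avgTrans s₀ k ω x y * min (M.optV H (h + 1) y) (inp.VmaxNext h x)| ≤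
        3.63 * width p ((I.stats s₀ k ω).n x) *
          Real.sqrt (∑ y, (I.stats s₀ k ω).PHat x y *
            (min (M.optV H (h + 1) y) (inp.VmaxNext h x) -
              ∑ y, M.trans x y * min (M.optV H (h + 1) y) (inp.VmaxNext h x)) ^ 2)
        + 5.6 * inp.VmaxNext h x * width p ((I.stats s₀ k ω).n x) ^ 2) := by
    intro h
    by_cases hh : h < H
    · have hc : 0 < inp.VmaxNext h x := by linarith [hv.one_le_VmaxNext h hh x]
      have h0 : ∀ s, 0 ≤ min (M.optV H (h + 1) s) (inp.VmaxNext h x) := fun s =>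
        le_min (M.optV_nonneg _ _ _) hc.le
      have h1 := sum_weighted_mem (M.trans_nonneg x) (M.trans_sum x) h0
        (fun s => min_le_right _ _)
      obtain ⟨N, hN, hd⟩ := I.exists_trans_abs_deviation_event s₀ x
        (fun s => min (M.optV H (h + 1) s) (inp.VmaxNext h x))
        (z := ∑ y, M.trans x y * min (M.optV H (h + 1) y) (inp.VmaxNext h x)) hc
        (fun s => by
          have := h0 s
          have := min_le_right (M.optV H (h + 1) s) (inp.VmaxNext h x)
          rw [abs_le]; constructor <;> linarith [h1.1, h1.2]) hp hp'
      exact ⟨N, hN, fun _ => hd⟩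
    · exact ⟨∅, by simp, fun h => absurd h hh⟩
  choose Nf hNf hf using hf
  have hP : ∀ y : S, ∃ N : Set Ω, μ N ≤ ENNReal.ofReal (2 * p) ∧ ∀ ω ∉ N, ∀ k,
      0 < (I.stats s₀ k ω).n x →
      |(I.stats s₀ k ω).PHat x y - I.avgTrans s₀ k ω x y| ≤
        3.63 * width p ((I.stats s₀ k ω).n x) * Real.sqrt ((I.stats s₀ k ω).PHat x y)
        + 5.6 * width p ((I.stats s₀ k ω).n x) ^ 2 := by
    intro y
    -- With centre 0, the empirical second moment of the indicator of y is the frequency of y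
    -- itself.
    obtain ⟨N, hN, hd⟩ := I.exists_trans_abs_deviation_event s₀ x
      (fun s => if s = y then 1 else 0) (z := 0) (c := 1) one_pos
      (fun s => by split_ifs <;> simp) hp hp'
    refine ⟨N, hN, fun ω hω k hn => ?_⟩
    have := hd ω hω k hn
    simpa using this
  choose NP hNP hP using hP
  obtain ⟨No, hNo, ho⟩ := I.exists_trans_deviation_event s₀ x
    (fun s => if M.trans x s = 0 then 1 else 0) (z := 0)
    (fun s => by split_ifs <;> simp) hp hp'
  have hb := I.ae_avg_bias s₀ x
  set supp := Finset.univ.filter fun s => M.trans x s ≠ 0 with hsupp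
  refine ⟨Nr ∪ (⋃ h ∈ Finset.range H, Nf h) ∪ (⋃ y ∈ supp, NP y) ∪ No ∪
    {ω | ¬ ∀ k, 0 < (I.stats s₀ k ω).n x →
    |I.avgReward s₀ k ω x - M.meanReward x| ≤ (I.stats s₀ k ω).epsHat x ∧
    ∑ y, I.avgTrans s₀ k ω x y = 1 ∧
    ∑ y, |I.avgTrans s₀ k ω x y - M.trans x y| ≤ (I.stats s₀ k ω).epsHat x}, ?_, ?_⟩
  · refine (measure_union_le _ _).trans ?_
    rw [ae_iff.1 hb, add_zero]
    have h2p : 0 ≤ 2 * p := by linarith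
    have h1 := measure_biUnion_le_ofReal (μ := μ) (Finset.range H) fun h _ => hNf h
    have h2 := measure_biUnion_le_ofReal (μ := μ) supp fun y _ => hNP y
    have h3 : ENNReal.ofReal (supp.card * (2 * p)) ≤ ENNReal.ofReal (inp.Shat * (2 * p)) :=
      ENNReal.ofReal_le_ofReal (mul_le_mul_of_nonneg_right (hv.card_support_le x) h2p)
    -- Two sides for the reward, for each of the H value functions and for each of at most Ŝ support
    -- states, and one side for the mass off the support.
    have e : (2 * inp.Shat + 2 * H + 3) * p =
        2 * p + ((Finset.range H).card * (2 * p)) + inp.Shat * (2 * p) + p := by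
      rw [Finset.card_range]; ring
    rw [e, ENNReal.ofReal_add (by positivity) hp.le, ENNReal.ofReal_add (by positivity)
      (by positivity), ENNReal.ofReal_add (by positivity) (by positivity)]
    refine (measure_union_le _ _).trans (add_le_add ?_ hNo)
    refine (measure_union_le _ _).trans (add_le_add ?_ (h2.trans h3))
    exact (measure_union_le _ _).trans (add_le_add hNr h1)
  · intro ω hω k hn h hh
    simp only [Set.mem_union, not_or] at hω
    obtain ⟨⟨⟨⟨w1, w2⟩, w3⟩, w4⟩, w5⟩ := hω
    have b := not_not.1 w5 k hn
    have ha := I.admissible_stats s₀ k ω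
    refine ⟨M.trans_nonneg x, M.trans_sum x, ha.P_nonneg x, ha.P_sum x, b.2.1,
      M.meanReward_nonneg x, M.meanReward_le_one x, ha.r_nonneg x, ha.r_le x, ha.sq_le x,
      ha.r2_le x, ha.eps_nonneg x, inp.phi_nonneg _ _, b.1, b.2.2, ?_, ?_, ?_, ?_⟩
    · rw [hφ]; exact hr ω w1 k hn
    · rw [hφ]
      refine hf h hh ω (fun h' => w2 ?_) k hn
      exact Set.mem_biUnion (Finset.mem_coe.2 (Finset.mem_range.2 hh)) h'
    · intro s hs
      rw [hφ]
      refine hP s ω (fun h' => w3 ?_) k hn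
      exact Set.mem_biUnion (Finset.mem_coe.2 (by simp [hsupp, hs])) h'
    · have := (ho ω w4 k hn).2
      have e : ∀ q : S → ℝ, ∑ y, q y * (if M.trans x y = 0 then (1 : ℝ) else 0) =
          ∑ y, if M.trans x y = 0 then q y else 0 := fun q =>
        Finset.sum_congr rfl fun y _ => by split_ifs <;> simp
      have e' : ∀ q : S → ℝ, ∑ y, q y * ((if M.trans x y = 0 then (1 : ℝ) else 0) - 0) ^ 2 =
          ∑ y, if M.trans x y = 0 then q y else 0 := fun q =>
        Finset.sum_congr rfl fun y _ => by split_ifs <;> simp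
      rw [e, e, e', ← hφ] at this
      linarith

/-- The confidence statements hold for all episodes with high probability. -/
theorem exists_concentration_event [∀ s, Nonempty (A s)] (s₀ : S) {inp : AlgInput A}
    (hv : inp.Valid M H) (hX : 2 ≤ Fintype.card (StateAction A)) (hH : 0 < H) :
    ∃ N : Set Ω, μ N ≤ ENNReal.ofReal (inp.δ / 2) ∧ ∀ ω ∉ N, ∀ k,
      (I.stats s₀ k ω).Concentrated inp M H := by
  obtain ⟨hp, hp'⟩ := failure_prob_bounds hv hX hH
  have key := fun x => I.exists_pair_concentration_event s₀ hv x hp hp'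
    (fun n => inp.phi_eq_width H n)
  choose N hN hc using key
  set p := inp.δ / (Fintype.card (StateAction A) * (4 * inp.Shat + 5 * H + 7) : ℝ) with hpdef
  refine ⟨⋃ x ∈ Finset.univ, N x, ?_, fun ω hω k x hn h hh => ?_⟩
  · refine (measure_biUnion_le_ofReal Finset.univ fun x _ => hN x).trans
      (ENNReal.ofReal_le_ofReal ?_)
    have hX0 : (0 : ℝ) < Fintype.card (StateAction A) := by
      exact_mod_cast (by omega : 0 < Fintype.card (StateAction A))
    have e : inp.δ = Fintype.card (StateAction A) * (4 * inp.Shat + 5 * H + 7) * p := by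
      rw [hpdef]; field_simp
    rw [Finset.card_univ, e]
    -- Twice 2Ŝ + 2H + 3 falls short of 4Ŝ + 5H + 7 by H + 1, so half of δ suffices for
    -- concentration; the other half is left for the counts.
    have : (0 : ℝ) ≤ Fintype.card (StateAction A) * p * (H + 1) := by positivity
    nlinarith
  · refine ⟨_, _, hc x ω (fun h' => hω ?_) k hn h hh⟩
    exact Set.mem_biUnion (Finset.mem_coe.2 (Finset.mem_univ x)) h'

end Interaction

/-! ### The number of observations -/

namespace Interaction

variable {S : Type*} [Fintype S] {A : S → Type*} [∀ s, Fintype (A s)]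
  {M : TabularMDP S A} {H : ℕ} {graphLaw : PMF (Digraph (StateAction A))}
  {Ω : Type*} {mΩ : MeasurableSpace Ω} {μ : Measure Ω} (I : Interaction M H graphLaw μ)

/-- The probability, given the past, that `y` is visited in step `h` of episode `k`. -/
def visit (k h : ℕ) (y : StateAction A) (ω : Ω) : ℝ := M.visitProb (I.π k ω) (I.s1 k ω) h y

lemma visit_nonneg (k h : ℕ) (y : StateAction A) (ω : Ω) : 0 ≤ I.visit k h y ω :=
  M.visitProb_nonneg _ _ _ _

lemma visit_sum (k h : ℕ) (ω : Ω) : ∑ y, I.visit k h y ω = 1 := M.visitProb_sum _ _ _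

lemma visit_le_one (k h : ℕ) (y : StateAction A) (ω : Ω) : I.visit k h y ω ≤ 1 := by
  rw [← I.visit_sum k h ω]
  exact Finset.single_le_sum (fun z _ => I.visit_nonneg k h z ω) (Finset.mem_univ y)

lemma visit_zero (k : ℕ) (y : StateAction A) :
    I.visit k 0 y = {ω | I.pair k 0 ω = y}.indicator 1 := by
  classical
  ext ω
  simp only [visit, TabularMDP.visitProb, TabularMDP.occ, ← I.pair_zero, Set.indicator,
    Set.mem_ofPred_eq, Pi.one_apply, eq_comm (a := y)]

lemma visit_succ (k h : ℕ) (y : StateAction A) :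
    I.visit k (h + 1) y = {ω | I.π k ω (h + 1) y.1 = y.2}.indicator
      (fun ω => ∑ z, I.visit k h z ω * M.trans z y.1) := by
  classical
  ext ω
  simp only [visit, TabularMDP.visitProb, TabularMDP.occ, Set.indicator, Set.mem_ofPred_eq,
    zero_add]
  split_ifs <;> simp

/-- Visit probabilities depend only on the policy and the initial state of the episode, so they are
known before it starts. -/
lemma measurable_visit (k h : ℕ) (y : StateAction A) :
    Measurable[I.ℱ (k * (H + 1))] (I.visit k h y) := by
  induction h generalizing y with
  | zero =>
    rw [visit_zero]
    exact Measurable.indicator (@measurable_const _ _ _ (_) 1) (I.measurableSet_pair_zero k y)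
  | succ h ih =>
    rw [visit_succ]
    exact (Finset.measurable_sum _ fun z _ => (ih z).mul_const _).indicator
      (I.meas_policy k (h + 1) y.1 y.2)

variable [IsProbabilityMeasure μ]

lemma integrable_visit (k h : ℕ) (y : StateAction A) : Integrable (I.visit k h y) μ := by
  refine Integrable.of_bound ((I.measurable_visit k h y).mono (I.ℱ.le _)
    le_rfl).aestronglyMeasurable 1 (ae_of_all _ fun ω => ?_)
  rw [Real.norm_eq_abs, abs_of_nonneg (I.visit_nonneg k h y ω)]
  exact I.visit_le_one k h y ω

lemma measureReal_inter_obsS (k : ℕ) {h : ℕ} (hh : h < H) (z : StateAction A) (s : S) {D : Set Ω}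
    (hD : MeasurableSet[I.past k h] D) (hDz : ∀ ω ∈ D, I.pair k h ω = z) :
    μ.real (D ∩ {ω | I.obsS k h z ω = s}) = μ.real D * M.trans z s := by
  have hS : MeasurableSet {ω | I.obsS k h z ω = s} := I.ℱ.le _ _ (I.meas_obsS k h hh z s)
  have h1 := setIntegral_condExp (I.past_le k h) (μ := μ)
    (f := {ω | I.obsS k h z ω = s}.indicator fun _ => (1 : ℝ))
    ((integrable_const (1 : ℝ)).indicator hS) hD
  rw [setIntegral_indicator hS] at h1
  have h2 : ∫ ω in D, (μ[{ω | I.obsS k h z ω = s}.indicator fun _ => (1 : ℝ) | I.past k h]) ω ∂μ =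
      ∫ _ in D, M.trans z s ∂μ := by
    refine setIntegral_congr_ae (I.past_le k h _ hD) ?_
    filter_upwards [I.trans_law k h hh z s] with ω hω hωD
    exact hω (hDz ω hωD)
  rw [h2] at h1
  simp at h1
  linarith

/-- The law of the visited pairs given the past and the feedback graph. -/
lemma measureReal_graph_pair (k : ℕ) {h : ℕ} (hh : h ≤ H) (g : Digraph (StateAction A))
    (y : StateAction A) {B : Set Ω} (hB : MeasurableSet[I.ℱ (k * (H + 1))] B) :
    μ.real (B ∩ {ω | I.G k ω = g} ∩ {ω | I.pair k h ω = y}) =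
      (graphLaw g).toReal * ∫ ω in B, I.visit k h y ω ∂μ := by
  classical
  induction h generalizing y B with
  | zero =>
    have hm := I.measurableSet_pair_zero k y
    rw [visit_zero, setIntegral_indicator (I.ℱ.le _ _ hm)]
    have e : B ∩ {ω | I.G k ω = g} ∩ {ω | I.pair k 0 ω = y} =
        {ω | I.G k ω = g} ∩ (B ∩ {ω | I.pair k 0 ω = y}) := by
      ext ω; simp only [Set.mem_inter_iff]; tauto
    rw [e, Measure.real, I.graph_law k g _ (hB.inter hm), ENNReal.toReal_mul]
    simp [Measure.real]
  | succ h ih =>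
    obtain ⟨s, a⟩ := y
    have hh' : h < H := by omega
    have hπ := I.meas_policy k (h + 1) s a
    -- The policy is known at the start of the episode, so its choice is absorbed into the
    -- conditioning event. This is why the induction runs over all B.
    set C := B ∩ {ω | I.π k ω (h + 1) s = a} with hCdef
    have hC : MeasurableSet[I.ℱ (k * (H + 1))] C := hB.inter hπ
    have e : B ∩ {ω | I.G k ω = g} ∩ {ω | I.pair k (h + 1) ω = ⟨s, a⟩} =
        ⋃ z ∈ (Finset.univ : Finset (StateAction A)),
          (C ∩ {ω | I.G k ω = g} ∩ {ω | I.pair k h ω = z}) ∩ {ω | I.obsS k h z ω = s} := by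
      ext ω
      simp only [hCdef, I.pair_succ, Set.mem_ofPred_eq, Set.mem_inter_iff, Set.mem_iUnion,
        Finset.mem_univ, exists_prop, true_and]
      constructor
      · rintro ⟨⟨hb, hg⟩, h'⟩
        obtain ⟨h1, h2⟩ := Sigma.mk.inj_iff.1 h'
        refine ⟨_, ⟨⟨⟨hb, ?_⟩, hg⟩, rfl⟩, h1⟩
        subst h1
        exact eq_of_heq h2
      · rintro ⟨z, ⟨⟨⟨hb, h2⟩, hg⟩, rfl⟩, h1⟩
        subst h1
        exact ⟨⟨hb, hg⟩, by rw [h2]⟩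
    have hD : ∀ z, MeasurableSet[I.past k h]
        (C ∩ {ω | I.G k ω = g} ∩ {ω | I.pair k h ω = z}) := fun z =>
      MeasurableSet.inter (MeasurableSet.inter (I.ℱ.mono (by omega) _ hC)
        (I.measurableSet_adj k h fun g' => g' = g)) (I.measurableSet_pair k hh'.le z)
    rw [e, measureReal_biUnion_finset]
    · have h1 : ∀ z, μ.real ((C ∩ {ω | I.G k ω = g} ∩ {ω | I.pair k h ω = z}) ∩
          {ω | I.obsS k h z ω = s}) =
          (graphLaw g).toReal * ∫ ω in C, I.visit k h z ω * M.trans z s ∂μ := by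
        intro z
        rw [I.measureReal_inter_obsS k hh' z s (hD z) fun ω hω => hω.2, ih hh'.le z hC,
          integral_mul_const]
        ring
      rw [Finset.sum_congr rfl fun z _ => h1 z, ← Finset.mul_sum, visit_succ,
        setIntegral_indicator (I.ℱ.le _ _ hπ), ← integral_finsetSum]
      exact fun z _ => ((I.integrable_visit k h z).mul_const _).integrableOn
    · intro z _ z' _ hzz'
      refine Set.disjoint_left.2 fun ω h1 h2 => hzz' ?_
      exact h1.1.2.symm.trans h2.1.2
    · intro z _
      exact (I.past_le k h _ (hD z)).inter (I.ℱ.le _ _ (I.meas_obsS k h hh' z s))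

open Classical in
/-- The pairs from which `x` is observed with probability at least `ν`. -/
def inNeighbors (p : PMF (Digraph (StateAction A))) (ν : ℝ) (x : StateAction A) :
    Finset (StateAction A) :=
  Finset.univ.filter fun y => y = x ∨ (thresholdGraph p ν).Adj y x

/-- Expected number of visits, in episode `k`, to pairs from which `x` is likely observed. -/
def reach (ν : ℝ) (k : ℕ) (x : StateAction A) (ω : Ω) : ℝ :=
  ∑ h ∈ Finset.range H, ∑ y ∈ inNeighbors graphLaw ν x, I.visit k h y ω

lemma reach_nonneg (ν : ℝ) (k : ℕ) (x : StateAction A) (ω : Ω) : 0 ≤ I.reach ν k x ω :=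
  Finset.sum_nonneg fun _ _ => Finset.sum_nonneg fun _ _ => I.visit_nonneg _ _ _ _

lemma reach_le (ν : ℝ) (k : ℕ) (x : StateAction A) (ω : Ω) : I.reach ν k x ω ≤ H := by
  have : ∀ h ∈ Finset.range H, ∑ y ∈ inNeighbors graphLaw ν x, I.visit k h y ω ≤ 1 := by
    intro h _
    rw [← I.visit_sum k h ω]
    exact Finset.sum_le_sum_of_subset_of_nonneg (Finset.subset_univ _)
      fun y _ _ => I.visit_nonneg k h y ω
  refine (Finset.sum_le_sum this).trans ?_
  simp

lemma measurable_reach (ν : ℝ) (k : ℕ) (x : StateAction A) :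
    Measurable[I.ℱ (k * (H + 1))] (I.reach ν k x) :=
  Finset.measurable_sum _ fun _ _ => Finset.measurable_sum _ fun _ _ => I.measurable_visit _ _ _

open Classical in
/-- Number of observations of `x` in episode `k`. -/
def episodeCount (k : ℕ) (x : StateAction A) (ω : Ω) : ℝ :=
  ∑ h ∈ Finset.range H, {ω | x ∈ I.observed k h ω}.indicator (fun _ => (1 : ℝ)) ω

/-- A visited pair observes itself with probability one; for the other in-neighbours this is the
definition of the threshold graph. -/
lemma sum_edge_prob_ge {ν : ℝ} (hν : ν ≤ 1) {x y : StateAction A}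
    (hy : y ∈ inNeighbors graphLaw ν x) [Fintype (Digraph (StateAction A))]
    [DecidablePred fun g : Digraph (StateAction A) => x = y ∨ g.Adj y x] :
    ν ≤ ∑ g ∈ Finset.univ.filter (fun g : Digraph (StateAction A) => x = y ∨ g.Adj y x),
      (graphLaw g).toReal := by
  classical
  have hsum : ∑ g, (graphLaw g).toReal = 1 := by
    rw [← ENNReal.toReal_sum fun g _ => graphLaw.apply_ne_top g]
    have := graphLaw.tsum_coe
    rw [tsum_fintype] at this
    rw [this, ENNReal.toReal_one]
  simp only [inNeighbors, Finset.mem_filter, Finset.mem_univ, true_and] at hy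
  by_cases hxy : x = y
  · rw [Finset.filter_true_of_mem fun g _ => Or.inl hxy, hsum]
    exact hν
  · have h1 := hy.resolve_left fun h => hxy h.symm
    refine (show ν ≤ edgeProb graphLaw y x from h1).trans (le_of_eq ?_)
    have e : {g : Digraph (StateAction A) | g.Adj y x} =
        (Finset.univ.filter (fun g : Digraph (StateAction A) => x = y ∨ g.Adj y x) :
          Finset _) := by
      ext g; simp [hxy]
    rw [edgeProb, e, PMF.toOuterMeasure_apply_finset,
      ENNReal.toReal_sum fun g _ => graphLaw.apply_ne_top g]

lemma integrable_observed (k : ℕ) {h : ℕ} (hh : h < H) (x : StateAction A) :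
    Integrable ({ω | x ∈ I.observed k h ω}.indicator fun _ => (1 : ℝ)) μ :=
  (integrable_const (1 : ℝ)).indicator (I.past_le k h _ (I.measurableSet_observed k hh.le x))

/-- The observation event contains the disjoint events "pair y is visited and the graph is g" with g
showing x from y. By `measureReal_graph_pair` their probabilities factor into a graph and a visit
part, and the graph parts sum to at least ν for each y. -/
lemma le_measureReal_observed {ν : ℝ} (hν : ν ≤ 1) (k : ℕ) {h : ℕ} (hh : h < H)
    (x : StateAction A) {B : Set Ω} (hB : MeasurableSet[I.ℱ (k * (H + 1))] B) :
    ν * ∑ y ∈ inNeighbors graphLaw ν x, ∫ ω in B, I.visit k h y ω ∂μ ≤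
      μ.real (B ∩ {ω | x ∈ I.observed k h ω}) := by
  classical
  have : Fintype (Digraph (StateAction A)) := Fintype.ofFinite _
  set good : StateAction A → Finset (Digraph (StateAction A)) :=
    fun y => Finset.univ.filter fun g => x = y ∨ g.Adj y x
  set J := (inNeighbors graphLaw ν x).sigma good
  have hsub : (⋃ j ∈ J, B ∩ {ω | I.G k ω = j.2} ∩ {ω | I.pair k h ω = j.1}) ⊆
      B ∩ {ω | x ∈ I.observed k h ω} := by
    intro ω hω
    simp only [Set.mem_iUnion] at hω
    obtain ⟨⟨y, g⟩, hj, ⟨hb, hg⟩, hp⟩ := hω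
    have := (Finset.mem_filter.1 (Finset.mem_sigma.1 hj).2).2
    simp only [Set.mem_ofPred_eq] at hg hp
    refine ⟨hb, ?_⟩
    change x = I.pair k h ω ∨ (I.G k ω).Adj (I.pair k h ω) x
    rw [hp, hg]
    exact this
  refine le_trans ?_ (measureReal_mono hsub)
  rw [measureReal_biUnion_finset]
  · rw [Finset.sum_sigma, Finset.mul_sum]
    refine Finset.sum_le_sum fun y hy => ?_
    simp only
    rw [Finset.sum_congr rfl fun g _ => I.measureReal_graph_pair k hh.le g y hB,
      ← Finset.sum_mul]
    exact mul_le_mul_of_nonneg_right (sum_edge_prob_ge hν hy)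
      (integral_nonneg fun ω => I.visit_nonneg k h y ω)
  · rintro ⟨y, g⟩ _ ⟨y', g'⟩ _ hne
    refine Set.disjoint_left.2 fun ω h1 h2 => hne ?_
    have e1 : y = y' := h1.2.symm.trans h2.2
    have e2 : g = g' := h1.1.2.symm.trans h2.1.2
    rw [e1, e2]
  · intro j _
    exact ((I.ℱ.le _ _ hB).inter (I.past_le k h _ (I.measurableSet_adj k h fun g' => g' = j.2))).inter
      (I.past_le k h _ (I.measurableSet_pair k hh.le j.1))

lemma episodeCount_nonneg (k : ℕ) (x : StateAction A) (ω : Ω) : 0 ≤ I.episodeCount k x ω :=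
  Finset.sum_nonneg fun _ _ => Set.indicator_nonneg (fun _ _ => zero_le_one) _

lemma episodeCount_le (k : ℕ) (x : StateAction A) (ω : Ω) : I.episodeCount k x ω ≤ H := by
  have : ∀ h ∈ Finset.range H,
      {ω | x ∈ I.observed k h ω}.indicator (fun _ => (1 : ℝ)) ω ≤ 1 := fun h _ =>
    Set.indicator_le_self' (fun _ _ => zero_le_one) ω
  refine (Finset.sum_le_sum this).trans ?_
  simp

lemma measurable_episodeCount (k : ℕ) (x : StateAction A) :
    Measurable[I.ℱ ((k + 1) * (H + 1))] (I.episodeCount k x) := by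
  refine Finset.measurable_sum _ fun h hh => measurable_const.indicator ?_
  have hh' := Finset.mem_range.1 hh
  refine I.ℱ.mono ?_ _ (I.measurableSet_observed k hh'.le x)
  rw [add_mul, one_mul]; omega

lemma sum_episodeCount (s₀ : S) (k : ℕ) (ω : Ω) (x : StateAction A) :
    ∑ i ∈ Finset.range k, I.episodeCount i x ω = (I.stats s₀ k ω).n x := by
  classical
  rw [I.count_eq s₀, obsSum]
  refine Finset.sum_congr rfl fun i _ => Finset.sum_congr rfl fun h _ => ?_
  simp only [Set.indicator, Set.mem_ofPred_eq]

/-- Lower bound for the expected number of observations in an episode. -/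
lemma le_setIntegral_episodeCount {ν : ℝ} (hν : ν ≤ 1) (k : ℕ) (x : StateAction A)
    {B : Set Ω} (hB : MeasurableSet[I.ℱ (k * (H + 1))] B) :
    ν * ∫ ω in B, I.reach ν k x ω ∂μ ≤ ∫ ω in B, I.episodeCount k x ω ∂μ := by
  unfold reach episodeCount
  rw [integral_finsetSum _ fun h _ => (integrable_finsetSum _ fun y _ =>
      I.integrable_visit k h y).integrableOn,
    integral_finsetSum _ fun h hh =>
      (I.integrable_observed k (Finset.mem_range.1 hh) x).integrableOn, Finset.mul_sum]
  refine Finset.sum_le_sum fun h hh => ?_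
  have hh' := Finset.mem_range.1 hh
  rw [integral_finsetSum _ fun y _ => (I.integrable_visit k h y).integrableOn,
    setIntegral_indicator (I.past_le k h _ (I.measurableSet_observed k hh'.le x))]
  have := I.le_measureReal_observed hν k hh' x hB
  simpa using this

/-- The information at the beginning of the episodes. -/
def episodeFiltration : Filtration ℕ mΩ where
  seq k := I.ℱ (k * (H + 1))
  mono' _ _ hij := I.ℱ.mono (Nat.mul_le_mul_right _ hij)
  le' _ := I.ℱ.le _

/-- A multiplicative Chernoff step with a whole episode as one increment, since its steps share a
graph. The count divided by H lies in [0, 1], where exp(−t) ≤ 1 − t/2; its conditional mean is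
bounded below by `le_setIntegral_episodeCount`, and (1 − v) exp v ≤ 1. -/
lemma setLIntegral_exp_count_le (hH : 0 < H) {ν : ℝ} (hν0 : 0 ≤ ν) (hν : ν ≤ 1) (k : ℕ)
    (x : StateAction A) {B : Set Ω} (hB : MeasurableSet[I.ℱ (k * (H + 1))] B) :
    ∫⁻ ω in B, ENNReal.ofReal (Real.exp (ν * I.reach ν k x ω / (2 * H) -
      I.episodeCount k x ω / H)) ∂μ ≤ μ B := by
  have hH' : (0 : ℝ) < H := by exact_mod_cast hH
  set v : Ω → ℝ := fun ω => ν * I.reach ν k x ω / (2 * H) with hv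
  set u : Ω → ℝ := fun ω => I.episodeCount k x ω / H with hu
  have hvm : Measurable[I.ℱ (k * (H + 1))] v :=
    ((I.measurable_reach ν k x).const_mul ν).div_const _
  have hvm' : Measurable v := hvm.mono (I.ℱ.le _) le_rfl
  have hum : Measurable u :=
    ((I.measurable_episodeCount k x).mono (I.ℱ.le _) le_rfl).div_const _
  have hv0 : ∀ ω, 0 ≤ v ω := fun ω => by
    have := I.reach_nonneg ν k x ω
    simp only [hv]; positivity
  have hv1 : ∀ ω, v ω ≤ 1 := fun ω => by
    have h1 := I.reach_le ν k x ω
    have h2 := I.reach_nonneg ν k x ω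
    simp only [hv]
    rw [div_le_one (by positivity)]
    nlinarith
  have hu0 : ∀ ω, 0 ≤ u ω := fun ω => div_nonneg (I.episodeCount_nonneg k x ω) hH'.le
  have hu1 : ∀ ω, u ω ≤ 1 := fun ω => (div_le_one hH').2 (I.episodeCount_le k x ω)
  have hui : Integrable u μ := Integrable.of_bound hum.aestronglyMeasurable 1
    (ae_of_all _ fun ω => by rw [Real.norm_eq_abs, abs_of_nonneg (hu0 ω)]; exact hu1 ω)
  have hvi : Integrable v μ := Integrable.of_bound hvm'.aestronglyMeasurable 1
    (ae_of_all _ fun ω => by rw [Real.norm_eq_abs, abs_of_nonneg (hv0 ω)]; exact hv1 ω)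
  have hexp : ∀ t : ℝ, 0 ≤ t → t ≤ 1 → Real.exp (-t) ≤ 1 - t / 2 := by
    intro t ht0 ht1
    rw [Real.exp_neg, inv_le_comm₀ (Real.exp_pos t) (by linarith)]
    refine le_trans ?_ (Real.add_one_le_exp t)
    rw [inv_le_iff_one_le_mul₀ (by linarith)]
    nlinarith
  have hcmp : ∀ C, MeasurableSet[I.ℱ (k * (H + 1))] C →
      ∫⁻ ω in C, ENNReal.ofReal (Real.exp (-u ω)) ∂μ ≤ ∫⁻ ω in C, ENNReal.ofReal (1 - v ω) ∂μ := by
    intro C hC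
    have h1 : ∫⁻ ω in C, ENNReal.ofReal (Real.exp (-u ω)) ∂μ ≤
        ∫⁻ ω in C, ENNReal.ofReal (1 - u ω / 2) ∂μ :=
      lintegral_mono fun ω => ENNReal.ofReal_le_ofReal (hexp _ (hu0 ω) (hu1 ω))
    refine h1.trans ?_
    rw [← ofReal_integral_eq_lintegral_ofReal (f := fun ω => 1 - u ω / 2)
        (((integrable_const (1 : ℝ)).sub (hui.div_const 2)).integrableOn)
        (ae_of_all _ fun ω => by have := hu1 ω; simp only [Pi.zero_apply]; linarith),
      ← ofReal_integral_eq_lintegral_ofReal (f := fun ω => 1 - v ω)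
        (((integrable_const (1 : ℝ)).sub hvi).integrableOn)
        (ae_of_all _ fun ω => by have := hv1 ω; simp only [Pi.zero_apply]; linarith)]
    refine ENNReal.ofReal_le_ofReal ?_
    rw [integral_sub (integrable_const _).integrableOn (hui.div_const 2).integrableOn,
      integral_sub (integrable_const _).integrableOn hvi.integrableOn]
    have h2 := I.le_setIntegral_episodeCount hν k x hC
    have h3 : ∫ ω in C, u ω / 2 ∂μ = (∫ ω in C, I.episodeCount k x ω ∂μ) / (2 * H) := by
      rw [← integral_div]
      congr 1; ext ω; simp only [hu]; field_simp
    have h4 : ∫ ω in C, v ω ∂μ = (ν * ∫ ω in C, I.reach ν k x ω ∂μ) / (2 * H) := by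
      rw [← integral_const_mul, ← integral_div]
    rw [h3, h4]
    have := div_le_div_of_nonneg_right h2 (by positivity : (0 : ℝ) ≤ 2 * H)
    linarith
  have hBm : MeasurableSet B := I.ℱ.le _ _ hB
  have hg : Measurable[I.ℱ (k * (H + 1))]
      (B.indicator fun ω => ENNReal.ofReal (Real.exp (v ω))) :=
    Measurable.indicator (ENNReal.measurable_ofReal.comp (Real.measurable_exp.comp hvm)) hB
  have key := lintegral_mul_le_of_setLIntegral_le (I.ℱ.le _) (μ := μ)
    (f := fun ω => ENNReal.ofReal (Real.exp (-u ω))) (f' := fun ω => ENNReal.ofReal (1 - v ω))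
    (ENNReal.measurable_ofReal.comp (Real.measurable_exp.comp hum.neg))
    (ENNReal.measurable_ofReal.comp (measurable_const.sub hvm')) hg hcmp
  calc ∫⁻ ω in B, ENNReal.ofReal (Real.exp (v ω - u ω)) ∂μ
      = ∫⁻ ω, ENNReal.ofReal (Real.exp (-u ω)) *
          B.indicator (fun ω => ENNReal.ofReal (Real.exp (v ω))) ω ∂μ := by
        rw [← lintegral_indicator hBm]
        refine lintegral_congr fun ω => ?_
        by_cases hω : ω ∈ B
        · rw [Set.indicator_of_mem hω, Set.indicator_of_mem hω,
            ← ENNReal.ofReal_mul (Real.exp_pos _).le, ← Real.exp_add]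
          ring_nf
        · rw [Set.indicator_of_notMem hω, Set.indicator_of_notMem hω, mul_zero]
    _ ≤ _ := key
    _ ≤ ∫⁻ ω, B.indicator (fun _ => 1) ω ∂μ := by
        refine lintegral_mono fun ω => ?_
        by_cases hω : ω ∈ B
        · rw [Set.indicator_of_mem hω, Set.indicator_of_mem hω,
            ← ENNReal.ofReal_mul (by linarith [hv1 ω]), ← ENNReal.ofReal_one]
          refine ENNReal.ofReal_le_ofReal ?_
          have h1 : 1 - v ω ≤ Real.exp (-v ω) := by linarith [Real.add_one_le_exp (-v ω)]
          calc (1 - v ω) * Real.exp (v ω) ≤ Real.exp (-v ω) * Real.exp (v ω) :=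
                mul_le_mul_of_nonneg_right h1 (Real.exp_pos _).le
            _ = 1 := by rw [← Real.exp_add]; simp
        · rw [Set.indicator_of_notMem hω, Set.indicator_of_notMem hω, mul_zero]
    _ = μ B := by rw [lintegral_indicator hBm]; simp

/-- With high probability the number of observations is comparable with its expectation. -/
theorem exists_count_event (hH : 0 < H) (s₀ : S) {ν : ℝ} (hν0 : 0 ≤ ν) (hν : ν ≤ 1) {δ : ℝ}
    (hδ : 0 < δ) (hX : 0 < Fintype.card (StateAction A)) :
    ∃ N : Set Ω, μ N ≤ ENNReal.ofReal (δ / 2) ∧ ∀ ω ∉ N, ∀ k x,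
      ν / 2 * ∑ i ∈ Finset.range k, I.reach ν i x ω -
        H * Real.log (2 * Fintype.card (StateAction A) / δ) ≤ (I.stats s₀ k ω).n x := by
  have hH' : (0 : ℝ) < H := by exact_mod_cast hH
  have hX' : (0 : ℝ) < Fintype.card (StateAction A) := by exact_mod_cast hX
  set p := δ / (2 * Fintype.card (StateAction A)) with hp
  set ξ : StateAction A → ℕ → Ω → ℝ := fun x k ω =>
    ν * I.reach ν k x ω / (2 * H) - I.episodeCount k x ω / H with hξ
  have key : ∀ x, μ {ω | ∃ t, Real.log (1 / p) ≤ ∑ i ∈ Finset.range t, ξ x i ω} ≤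
      ENNReal.ofReal p := fun x =>
    measure_exists_le_sum I.episodeFiltration (ξ x)
      (fun k => (((I.measurable_reach ν k x).const_mul ν).div_const _
        |>.mono (I.ℱ.mono (Nat.mul_le_mul_right _ (Nat.le_succ k))) le_rfl).sub
          ((I.measurable_episodeCount k x).div_const _))
      (fun k B hB => I.setLIntegral_exp_count_le hH hν0 hν k x hB) (by positivity)
  refine ⟨⋃ x ∈ Finset.univ, {ω | ∃ t, Real.log (1 / p) ≤ ∑ i ∈ Finset.range t, ξ x i ω}, ?_, ?_⟩
  · refine (measure_biUnion_le_ofReal Finset.univ fun x _ => key x).trans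
      (le_of_eq (congrArg _ ?_))
    rw [Finset.card_univ, hp]; field_simp
  · intro ω hω k x
    have h1 : ∑ i ∈ Finset.range k, ξ x i ω < Real.log (1 / p) := by
      by_contra h'
      push Not at h'
      exact hω (Set.mem_biUnion (Finset.mem_coe.2 (Finset.mem_univ x)) ⟨k, h'⟩)
    have e1 : 1 / p = 2 * Fintype.card (StateAction A) / δ := by rw [hp, one_div_div]
    have e2 : ∑ i ∈ Finset.range k, ξ x i ω =
        (ν / 2 * ∑ i ∈ Finset.range k, I.reach ν i x ω - (I.stats s₀ k ω).n x) / H := by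
      rw [← I.sum_episodeCount s₀, Finset.sum_sub_distrib, ← Finset.sum_div, sub_div,
        ← Finset.sum_div, ← Finset.mul_sum]
      congr 1
      field_simp
    rw [e1, e2, div_lt_iff₀ hH'] at h1
    linarith

end Interaction

/-! ### Cumulative weights on graphs -/

section Graph

variable {X : Type*}

/-- The new vertex receives no edge from V, so no cycle can pass through it. -/
lemma AcyclicOn.insert_of_not_adj [DecidableEq X] {G : Digraph X} {V : Finset X} (hV : AcyclicOn G V) {x : X}
    (hx : ∀ y ∈ V, ¬ G.Adj y x) : AcyclicOn G (insert x V) := by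
  set r := fun a b => a ∈ insert x V ∧ b ∈ insert x V ∧ a ≠ b ∧ G.Adj a b with hr
  have hend : ∀ a b, r a b → b ≠ x := by
    rintro a b ⟨ha, _, hab, hadj⟩ rfl
    rcases Finset.mem_insert.1 ha with h | h
    · exact hab h
    · exact hx a h hadj
  have hstep : ∀ a b, a ≠ x → r a b → a ∈ V ∧ b ∈ V ∧ a ≠ b ∧ G.Adj a b := by
    intro a b ha h
    exact ⟨(Finset.mem_insert.1 h.1).resolve_left ha,
      (Finset.mem_insert.1 h.2.1).resolve_left (hend a b h), h.2.2⟩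
  have key : ∀ a b, Relation.TransGen r a b → b ≠ x ∧ (a ≠ x →
      Relation.TransGen (fun a b => a ∈ V ∧ b ∈ V ∧ a ≠ b ∧ G.Adj a b) a b) := by
    intro a b h
    induction h with
    | single h => exact ⟨hend _ _ h, fun ha => .single (hstep _ _ ha h)⟩
    | tail _ h ih => exact ⟨hend _ _ h, fun ha => .tail (ih.2 ha) (hstep _ _ ih.1 h)⟩
  intro v hv
  obtain ⟨h1, h2⟩ := key v v hv
  exact hV v (h2 h1)

lemma AcyclicOn.empty (G : Digraph X) : AcyclicOn G ∅ := by
  intro v hv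
  rw [Relation.transGen_iff] at hv
  rcases hv with h | ⟨_, _, h⟩
  · exact absurd h.1 (Finset.notMem_empty _)
  · exact absurd h.1 (Finset.notMem_empty _)

variable [Fintype X]

lemma AcyclicOn.card_le_masNumber {G : Digraph X} {V : Finset X} (hV : AcyclicOn G V) :
    V.card ≤ masNumber G :=
  le_csSup ⟨Fintype.card X, by rintro n ⟨W, _, rfl⟩; exact Finset.card_le_univ W⟩ ⟨V, hV, rfl⟩

lemma one_le_masNumber [Nonempty X] (G : Digraph X) : 1 ≤ masNumber G := by
  classical
  have := ((AcyclicOn.empty G).insert_of_not_adj (x := Classical.arbitrary X) (by simp)).card_le_masNumber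
  simpa using this

variable {G : Digraph X} {N : X → Finset X} {w : ℕ → X → ℝ} {H : ℝ} (T : ℕ)

open Classical in
/-- The weight that is put on nodes while the weight of their in-neighborhoods is small is
controlled by the mas-number. -/
lemma sum_weight_small_le (hN : ∀ x y, y ∈ N x ↔ y = x ∨ G.Adj y x) (hw : ∀ k x, 0 ≤ w k x)
    (hH0 : 0 ≤ H) (hH : ∀ k x, ∑ y ∈ N x, w k y ≤ H) {B : ℝ} (hB : 0 ≤ B) :
    ∑ x, ∑ k ∈ Finset.range T,
      (if ∑ i ∈ Finset.range k, ∑ y ∈ N x, w i y ≤ B then w k x else 0) ≤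
      masNumber G * (B + H) := by
  set a : ℕ → X → ℝ := fun k x => ∑ i ∈ Finset.range k, ∑ y ∈ N x, w i y with ha
  set F : X → ℝ := fun x => ∑ k ∈ Finset.range T, (if a k x ≤ B then w k x else 0) with hF
  set τ : X → ℕ := fun x => ((Finset.range T).filter fun k => a k x ≤ B).sup (· + 1) with hτ
  have hFτ : ∀ x n, τ x ≤ n → F x ≤ ∑ k ∈ Finset.range n, w k x := by
    intro x n hn
    simp only [hF]
    rw [← Finset.sum_filter]
    refine Finset.sum_le_sum_of_subset_of_nonneg (fun k hk => ?_) fun k _ _ => hw k x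
    have h1 : k + 1 ≤ τ x := Finset.le_sup (f := (· + 1)) hk
    exact Finset.mem_range.2 (by omega)
  have haτ : ∀ x, a (τ x) x ≤ B + H := by
    intro x
    rcases ((Finset.range T).filter fun k => a k x ≤ B).eq_empty_or_nonempty with h0 | h0
    · have : τ x = 0 := by simp only [hτ, h0, Finset.sup_empty]; rfl
      rw [this]
      simp only [ha, Finset.range_zero, Finset.sum_empty]
      linarith
    · obtain ⟨k, hk, hk'⟩ := Finset.exists_mem_eq_sup _ h0 (· + 1)
      have h1 : τ x = k + 1 := hk'
      have h2 := (Finset.mem_filter.1 hk).2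
      rw [h1]
      simp only [ha] at h2 ⊢
      rw [Finset.sum_range_succ]
      linarith [hH k x]
  -- Here τ x is one past the last counted time at which the in-neighbourhood of x has cumulative
  -- weight at most B. The greedy step takes x in Z with maximal τ and removes N x. Removed vertices
  -- have stopped counting by time τ x, so together they hold at most the weight of N x up to then,
  -- which is at most B + H. No remaining vertex points to x, so adding x to the set chosen later
  -- keeps it acyclic.
  have key : ∀ (n : ℕ) (Z : Finset X), Z.card = n → ∃ V ⊆ Z, AcyclicOn G V ∧
      ∑ x ∈ Z, F x ≤ V.card * (B + H) := by
    intro n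
    induction n using Nat.strong_induction_on with
    | _ n ih =>
      intro Z hZ
      rcases Z.eq_empty_or_nonempty with rfl | hne
      · exact ⟨∅, subset_rfl, AcyclicOn.empty G, by simp⟩
      obtain ⟨x, hxZ, hmax⟩ := Finset.exists_max_image Z τ hne
      have hxN : x ∈ N x := (hN x x).2 (Or.inl rfl)
      have hlt : (Z \ N x).card < n := by
        rw [← hZ]
        exact Finset.card_lt_card ⟨Finset.sdiff_subset, fun h =>
          (Finset.mem_sdiff.1 (h hxZ)).2 hxN⟩
      obtain ⟨V, hVZ, hV, hsum⟩ := ih _ hlt (Z \ N x) rfl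
      have hxV : x ∉ V := fun h => (Finset.mem_sdiff.1 (hVZ h)).2 hxN
      refine ⟨insert x V, ?_, hV.insert_of_not_adj fun y hy hadj => ?_, ?_⟩
      · exact Finset.insert_subset hxZ (hVZ.trans Finset.sdiff_subset)
      · exact (Finset.mem_sdiff.1 (hVZ hy)).2 ((hN x y).2 (Or.inr hadj))
      · rw [Finset.card_insert_of_notMem hxV, ← Finset.sum_inter_add_sum_sdiff Z (N x)]
        have h1 : ∑ y ∈ Z ∩ N x, F y ≤ B + H := by
          calc ∑ y ∈ Z ∩ N x, F y ≤ ∑ y ∈ Z ∩ N x, ∑ k ∈ Finset.range (τ x), w k y :=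
                Finset.sum_le_sum fun y hy => hFτ y _ (hmax y (Finset.mem_inter.1 hy).1)
            _ ≤ ∑ y ∈ N x, ∑ k ∈ Finset.range (τ x), w k y :=
                Finset.sum_le_sum_of_subset_of_nonneg Finset.inter_subset_right
                  fun y _ _ => Finset.sum_nonneg fun k _ => hw k y
            _ = a (τ x) x := Finset.sum_comm
            _ ≤ B + H := haτ x
        push_cast
        linarith
  obtain ⟨V, _, hV, hsum⟩ := key _ Finset.univ rfl
  refine hsum.trans (mul_le_mul_of_nonneg_right ?_ (by linarith))
  exact_mod_cast hV.card_le_masNumber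

open Classical in
-- Layers that replace 1/a by indicators of smallness, to which `sum_weight_small_le` applies. The
-- smallest active level already suffices.
lemma inv_le_sum_dyadic {a B : ℝ} (hB : 0 < B) (ha : B ≤ a) (J : ℕ) (haJ : a ≤ 2 ^ (J + 1) * B) :
    1 / a ≤ ∑ j ∈ Finset.range (J + 1), if a ≤ 2 ^ (j + 1) * B then 1 / (2 ^ j * B) else 0 := by
  induction J with
  | zero =>
    simp only [zero_add, Finset.range_one, Finset.sum_singleton]
    rw [if_pos (by simpa using haJ)]
    exact one_div_le_one_div_of_le (by positivity) (by simpa using ha)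
  | succ J ih =>
    rw [Finset.sum_range_succ]
    by_cases h : a ≤ 2 ^ (J + 1) * B
    · refine (ih h).trans (le_add_of_nonneg_right ?_)
      split_ifs
      all_goals positivity
    · push Not at h
      rw [if_pos haJ]
      refine le_trans ?_ (le_add_of_nonneg_left (Finset.sum_nonneg fun j _ => ?_))
      · exact one_div_le_one_div_of_le (by positivity) h.le
      · split_ifs <;> positivity

open Classical in
/-- Sum of the weights divided by the cumulative weight of the in-neighborhood. -/
lemma sum_weight_div_le (hN : ∀ x y, y ∈ N x ↔ y = x ∨ G.Adj y x) (hw : ∀ k x, 0 ≤ w k x)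
    (hH0 : 0 ≤ H) (hH : ∀ k x, ∑ y ∈ N x, w k y ≤ H) {B : ℝ} (hB : 0 < B) (hHB : H ≤ B) (J : ℕ)
    (hJ : T * H ≤ 2 ^ (J + 1) * B) :
    ∑ x, ∑ k ∈ Finset.range T,
      (if B ≤ ∑ i ∈ Finset.range k, ∑ y ∈ N x, w i y then
        w k x * (1 / ∑ i ∈ Finset.range k, ∑ y ∈ N x, w i y) else 0) ≤
      3 * (J + 1) * masNumber G := by
  set a : ℕ → X → ℝ := fun k x => ∑ i ∈ Finset.range k, ∑ y ∈ N x, w i y with ha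
  have haT : ∀ k ∈ Finset.range T, ∀ x, a k x ≤ 2 ^ (J + 1) * B := by
    intro k hk x
    refine le_trans ?_ hJ
    calc a k x ≤ ∑ i ∈ Finset.range k, H := Finset.sum_le_sum fun i _ => hH i x
      _ = k * H := by simp
      _ ≤ T * H := by
        refine mul_le_mul_of_nonneg_right ?_ hH0
        exact_mod_cast (Finset.mem_range.1 hk).le
  have h1 : ∑ x, ∑ k ∈ Finset.range T, (if B ≤ a k x then w k x * (1 / a k x) else 0) ≤
      ∑ x, ∑ k ∈ Finset.range T, ∑ j ∈ Finset.range (J + 1),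
        1 / (2 ^ j * B) * (if a k x ≤ 2 ^ (j + 1) * B then w k x else 0) := by
    refine Finset.sum_le_sum fun x _ => Finset.sum_le_sum fun k hk => ?_
    split_ifs with h
    · refine (mul_le_mul_of_nonneg_left (inv_le_sum_dyadic hB h J (haT k hk x)) (hw k x)).trans
        (le_of_eq ?_)
      rw [Finset.mul_sum]
      refine Finset.sum_congr rfl fun j _ => ?_
      split_ifs <;> ring
    · refine Finset.sum_nonneg fun j _ => mul_nonneg (by positivity) ?_
      split_ifs
      · exact hw k x
      · exact le_rfl
  refine h1.trans ?_
  have h2 : ∑ x, ∑ k ∈ Finset.range T, ∑ j ∈ Finset.range (J + 1),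
        1 / (2 ^ j * B) * (if a k x ≤ 2 ^ (j + 1) * B then w k x else 0) =
      ∑ j ∈ Finset.range (J + 1), 1 / (2 ^ j * B) *
        ∑ x, ∑ k ∈ Finset.range T, (if a k x ≤ 2 ^ (j + 1) * B then w k x else 0) := by
    simp only [Finset.mul_sum]
    rw [Finset.sum_congr rfl fun x _ => Finset.sum_comm, Finset.sum_comm]
  rw [h2]
  -- Every dyadic level costs the same, because 2^(j+1) B + H ≤ 3 · 2^j B when H ≤ B.
  have h3 : ∀ j ∈ Finset.range (J + 1), 1 / (2 ^ j * B) *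
        ∑ x, ∑ k ∈ Finset.range T, (if a k x ≤ 2 ^ (j + 1) * B then w k x else 0) ≤
      3 * masNumber G := by
    intro j _
    have h4 := sum_weight_small_le T hN hw hH0 hH (B := 2 ^ (j + 1) * B) (by positivity)
    have h5 : (2 : ℝ) ^ (j + 1) * B + H ≤ 3 * (2 ^ j * B) := by
      have : B ≤ 2 ^ j * B := le_mul_of_one_le_left hB.le (one_le_pow₀ (by norm_num))
      rw [pow_succ]; linarith
    rw [one_div, inv_mul_le_iff₀ (by positivity)]
    refine h4.trans ?_
    have : (0 : ℝ) ≤ masNumber G := by positivity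
    nlinarith
  refine (Finset.sum_le_sum h3).trans (le_of_eq ?_)
  simp; ring

/-- Some threshold nearly attains the infimum in the definition of `masBar`. -/
lemma exists_threshold_le_masBar [Nonempty X] (p : PMF (Digraph X)) :
    1 ≤ masBar p ∧ ∃ ν : ℝ, 0 < ν ∧ ν ≤ 1 ∧
      (masNumber (thresholdGraph p ν) : ℝ) / ν ≤ 2 * masBar p := by
  have hne : Nonempty (Set.Ioc (0 : ℝ) 1) := ⟨⟨1, by norm_num⟩⟩
  have h1 : 1 ≤ masBar p := by
    refine le_ciInf fun ν => ?_
    have h2 : (1 : ℝ) ≤ masNumber (thresholdGraph p ν) := by exact_mod_cast one_le_masNumber _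
    rw [le_div_iff₀ ν.2.1]
    linarith [ν.2.2]
  refine ⟨h1, ?_⟩
  -- Positivity of the infimum makes its double strictly larger, so some threshold lies below it.
  have h2 : masBar p < 2 * masBar p := by linarith
  obtain ⟨ν, hν⟩ := exists_lt_of_ciInf_lt h2
  exact ⟨ν, ν.2.1, ν.2.2, hν.le⟩

end Graph

/-! ### The cumulative certificate size -/

section LogBounds

variable {a h t δ : ℝ}

lemma log_two_mul_le (ha : 2 ≤ a) (hh : 1 ≤ h) (ht : 1 ≤ t) (hδ : 0 < δ) (hδ1 : δ ≤ 1) :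
    Real.log (2 * (h * t)) ≤ Real.log (a * h * t / δ) := by
  refine Real.log_le_log (by positivity) ?_
  rw [le_div_iff₀ hδ]
  have h1 : 0 < h * t := by positivity
  calc 2 * (h * t) * δ ≤ 2 * (h * t) * 1 := mul_le_mul_of_nonneg_left hδ1 (by positivity)
    _ ≤ a * (h * t) := by rw [mul_one]; exact mul_le_mul_of_nonneg_right ha h1.le
    _ = a * h * t := by ring

lemma log_two_le (ha : 2 ≤ a) (hh : 1 ≤ h) (ht : 1 ≤ t) (hδ : 0 < δ) (hδ1 : δ ≤ 1) :
    Real.log 2 ≤ Real.log (a * h * t / δ) := by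
  refine le_trans (Real.log_le_log (by norm_num) ?_) (log_two_mul_le ha hh ht hδ hδ1)
  have : 1 ≤ h * t := one_le_mul_of_one_le_of_one_le hh ht
  linarith

lemma log_two_mul_div_le (ha : 2 ≤ a) (hh : 1 ≤ h) (ht : 1 ≤ t) (hδ : 0 < δ) (hδ1 : δ ≤ 1) :
    Real.log (2 * a / δ) ≤ 2 * Real.log (a * h * t / δ) := by
  have h1 := log_two_le ha hh ht hδ hδ1
  have h2 : Real.log (a / δ) ≤ Real.log (a * h * t / δ) := by
    refine Real.log_le_log (by positivity) ?_
    gcongr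
    calc a = a * 1 * 1 := by ring
      _ ≤ a * h * t := by gcongr
  have h3 : Real.log (2 * a / δ) = Real.log 2 + Real.log (a / δ) := by
    rw [mul_div_assoc, Real.log_mul (by norm_num) (by positivity)]
  linarith

lemma log_poly_le (ha : 2 ≤ a) (hh : 1 ≤ h) (ht : 1 ≤ t) (hδ : 0 < δ) (hδ1 : δ ≤ 1) :
    Real.log (64 * (a ^ 2 * h) / δ) ≤ 8 * Real.log (a * h * t / δ) := by
  have h1 := log_two_le ha hh ht hδ hδ1
  have h2 : Real.log (a ^ 2 * h / δ) ≤ 2 * Real.log (a * h * t / δ) := by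
    have : 2 * Real.log (a * h * t / δ) = Real.log ((a * h * t / δ) ^ 2) := by
      rw [Real.log_pow]; norm_num
    rw [this]
    refine Real.log_le_log (by positivity) ?_
    rw [div_pow, div_le_div_iff₀ hδ (by positivity)]
    have e1 : δ ^ 2 ≤ δ := by nlinarith
    have e2 : a ^ 2 * h ≤ (a * h * t) ^ 2 := by
      calc a ^ 2 * h = a ^ 2 * (h * 1) * 1 := by ring
        _ ≤ a ^ 2 * (h * h) * (t ^ 2) := by
          have : 1 ≤ t ^ 2 := one_le_pow₀ ht
          gcongr
        _ = (a * h * t) ^ 2 := by ring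
    exact mul_le_mul e2 e1 (by positivity) (by positivity)
  have h3 : Real.log (64 * (a ^ 2 * h) / δ) = 6 * Real.log 2 + Real.log (a ^ 2 * h / δ) := by
    rw [mul_div_assoc, Real.log_mul (by norm_num) (by positivity),
      show (64 : ℝ) = 2 ^ 6 by norm_num, Real.log_pow]
    norm_num
  linarith

/-- L is bounded away from zero, so lower powers can be absorbed into the L³ of the final bound. -/
lemma log_pow_bounds {L : ℝ} (hL : Real.log 2 ≤ L) :
    0 < L ∧ 1 ≤ 1.45 * L ∧ L ≤ 2.2 * L ^ 3 ∧ L ^ 2 ≤ 1.45 * L ^ 3 := by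
  have h2 := Real.log_two_gt_d9
  have h1 : 1 ≤ 1.45 * L := by linarith
  have h0 : 0 < L := by linarith
  refine ⟨h0, h1, ?_, ?_⟩
  · have h3 : 1 ≤ 2.2 * L ^ 2 := by nlinarith
    calc L = 1 * L := by ring
      _ ≤ 2.2 * L ^ 2 * L := mul_le_mul_of_nonneg_right h3 h0.le
      _ = _ := by ring
  · calc L ^ 2 = 1 * L ^ 2 := by ring
      _ ≤ 1.45 * L * L ^ 2 := mul_le_mul_of_nonneg_right h1 (by positivity)
      _ = _ := by ring

end LogBounds

/-- Cauchy–Schwarz with the weights w, in the form that separates squared widths from variances. -/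
lemma sum_mul_sqrt_le {ι : Type*} (s : Finset ι) {w c f : ι → ℝ} (hw : ∀ i ∈ s, 0 ≤ w i)
    (hf : ∀ i ∈ s, 0 ≤ f i) :
    ∑ i ∈ s, w i * (c i * Real.sqrt (f i)) ≤
      Real.sqrt (∑ i ∈ s, w i * c i ^ 2) * Real.sqrt (∑ i ∈ s, w i * f i) := by
  have h := Real.sum_mul_le_sqrt_mul_sqrt s (fun i => Real.sqrt (w i) * c i)
    (fun i => Real.sqrt (w i) * Real.sqrt (f i))
  refine le_of_eq_of_le (Finset.sum_congr rfl fun i hi => ?_) (h.trans (le_of_eq ?_))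
  · have := Real.mul_self_sqrt (hw i hi)
    calc w i * (c i * Real.sqrt (f i))
        = (Real.sqrt (w i) * Real.sqrt (w i)) * (c i * Real.sqrt (f i)) := by rw [this]
      _ = _ := by ring
  · congr 2
    · refine Finset.sum_congr rfl fun i hi => ?_
      rw [mul_pow, Real.sq_sqrt (hw i hi)]
    · refine Finset.sum_congr rfl fun i hi => ?_
      rw [mul_pow, Real.sq_sqrt (hw i hi), Real.sq_sqrt (hf i hi)]

/-! ### The confidence width on the logarithmic scale of the final bound -/

section Width

variable {S : Type*} [Fintype S] {A : S → Type*} [∀ s, Fintype (A s)] [∀ s, Nonempty (A s)]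
  {M : TabularMDP S A} {H : ℕ}

lemma card_state_le : Fintype.card S ≤ Fintype.card (StateAction A) :=
  Fintype.card_le_of_surjective (fun x : StateAction A => x.1)
    fun s => ⟨⟨s, Classical.arbitrary _⟩, rfl⟩

/-- Since Ŝ ≤ |S| ≤ |𝒳|, the argument of the logarithm in φ is polynomial in |𝒳| and H and costs at
most 8L; the iterated logarithm costs at most L. Finally 0.52 · (1.4 + 8) < 7. -/
lemma phi_sq_mul_count_le {inp : AlgInput A} (hv : inp.Valid M H)
    (hX : 2 ≤ Fintype.card (StateAction A)) (hH : 0 < H) {T : ℕ} (hT : 1 ≤ T) {n : ℕ} (hn : 0 < n)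
    (hnT : n ≤ H * T) :
    inp.phi H n ^ 2 * n ≤
      7 * Real.log (Fintype.card (StateAction A) * H * T / inp.δ) := by
  obtain ⟨hp, hp'⟩ := Interaction.failure_prob_bounds hv hX hH
  have hX' : (2 : ℝ) ≤ Fintype.card (StateAction A) := by exact_mod_cast hX
  have hH' : (1 : ℝ) ≤ H := by exact_mod_cast hH
  have hT' : (1 : ℝ) ≤ T := by exact_mod_cast hT
  have hS : (inp.Shat : ℝ) ≤ Fintype.card (StateAction A) := by
    exact_mod_cast hv.Shat_le.trans card_state_le
  rw [inp.phi_eq_width]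
  refine (width_sq_mul_le hp hp' hn).trans ?_
  set a : ℝ := ((Fintype.card (StateAction A) : ℕ) : ℝ)
  have hL2 := log_two_le hX' hH' hT' hv.δ_pos hv.δ_le
  obtain ⟨hL0, _, _, _⟩ := log_pow_bounds hL2
  have h1 : Real.log (5.2 / (inp.δ / (a * (4 * inp.Shat + 5 * H + 7)))) ≤
      8 * Real.log (a * H * T / inp.δ) := by
    refine le_trans ?_ (log_poly_le hX' hH' hT' hv.δ_pos hv.δ_le)
    have hδ := hv.δ_pos
    refine Real.log_le_log (by positivity) ?_
    rw [div_div_eq_mul_div]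
    refine div_le_div_of_nonneg_right ?_ hδ.le
    have e : 4 * (inp.Shat : ℝ) + 5 * H + 7 ≤ 10 * (a * H) := by nlinarith
    calc 5.2 * (a * (4 * inp.Shat + 5 * H + 7)) ≤ 5.2 * (a * (10 * (a * H))) := by gcongr
      _ = 52 * (a ^ 2 * H) := by ring
      _ ≤ 64 * (a ^ 2 * H) := by gcongr; norm_num
  have h2 : Real.log (Real.log (max (Real.exp 1) (2 * n))) ≤ Real.log (a * H * T / inp.δ) := by
    have h3 := one_le_log_max n
    refine (Real.log_le_sub_one_of_pos (by linarith)).trans ?_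
    rcases le_total (Real.exp 1) (2 * n) with h4 | h4
    · rw [max_eq_right h4]
      have h5 : Real.log (2 * n) ≤ Real.log (2 * (H * T)) := by
        have : (n : ℝ) ≤ H * T := by exact_mod_cast hnT
        exact Real.log_le_log (by positivity) (by linarith)
      have h6 := log_two_mul_le hX' hH' hT' hv.δ_pos hv.δ_le
      linarith
    · rw [max_eq_left h4, Real.log_exp]; linarith
  unfold lilLog
  linarith

end Width

namespace Interaction

variable {S : Type*} [Fintype S] {A : S → Type*} [∀ s, Fintype (A s)] [∀ s, Nonempty (A s)]
  {M : TabularMDP S A} {H : ℕ} {graphLaw : PMF (Digraph (StateAction A))}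
  {Ω : Type*} {mΩ : MeasurableSpace Ω} {μ : Measure Ω} (I : Interaction M H graphLaw μ)

open Classical in
/-- The certificate size in terms of the gap terms of well observed pairs and the visits to the
other ones. -/
lemma certificate_le {inp : AlgInput A} (hv : inp.Valid M H) {s₀ : S} {k : ℕ} {ω : Ω}
    (hH : 0 < H) (hc : (I.stats s₀ k ω).Concentrated inp M H)
    (hπ : IsOptPlan inp H (I.stats s₀ k ω) (I.π k ω)) {Q : ℝ}
    (hQ : ∀ h < H, ∀ x, 0 < M.visitProb (I.π k ω) (I.s1 k ω) h x →
      inp.Qmax h x ≤ Q ∧ inp.VmaxNext h x ≤ Q) (good : StateAction A → Prop) :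
    I.certUpper inp s₀ k ω - I.certLower inp s₀ k ω ≤
      Real.exp 21 * ∑ h ∈ Finset.range H, ∑ x, I.visit k h x ω *
        (if good x then gapTerm inp M H (I.stats s₀ k ω) (I.π k ω) Q h x else Q) := by
  have ha := I.admissible_stats s₀ k ω
  set st := I.stats s₀ k ω
  set π := I.π k ω
  set s := I.s1 k ω
  have hH' : (0 : ℝ) < H := by exact_mod_cast hH
  set Δ : ℕ → S → ℝ := fun h s => upperV inp H st π h s - lowerV inp H st π h s with hΔ
  have hΔ0 : ∀ h ≤ H, ∀ s, 0 ≤ Δ h s := by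
    intro h hh s
    have h1 := confidence_bounds hv ha hc hπ hh s
    have h2 := M.vValue_le_optV H π h s
    simp only [hΔ]; linarith [h1.2.1, h1.2.2.1]
  have hQ1 : 1 ≤ Q := (hv.one_le_VmaxNext 0 hH _).trans
    (hQ 0 hH _ (M.visitProb_zero_pos π s)).2
  set Bt : ℕ → StateAction A → ℝ := fun h x => if good x then gapTerm inp M H st π Q h x else Q
  have hφ := fun x => inp.phi_nonneg H (st.n x)
  have hBt : ∀ h x, 0 ≤ Bt h x := by
    intro h x
    simp only [Bt]
    split_ifs
    · have h1 := hφ x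
      have h2 := ha.eps_nonneg x
      unfold gapTerm
      positivity
    · linarith
  have hκ : (0 : ℝ) ≤ 1 + 21 / H := by positivity
  have h1 := M.le_sum_visitProb_of_recursion π s Δ Bt hκ
    (fun s' => by simp only [hΔ]; rw [upperV_self, lowerV_self, sub_self])
    (fun h hh x hx => by
      obtain ⟨g1, g2⟩ := gap_recursion hv ha hc hπ hQ hh hx
      simp only [Bt]
      split_ifs
      · exact g2
      · refine g1.trans (le_add_of_nonneg_left (mul_nonneg hκ ?_))
        exact Finset.sum_nonneg fun s' _ => mul_nonneg (M.trans_nonneg x s') (hΔ0 _ hh s'))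
  refine h1.trans ?_
  rw [Finset.mul_sum]
  refine Finset.sum_le_sum fun h hh => mul_le_mul_of_nonneg_right ?_
    (Finset.sum_nonneg fun x _ => mul_nonneg (M.visitProb_nonneg _ _ _ _) (hBt h x))
  -- The loss factor of the recursion compounds over at most H steps.
  calc (1 + 21 / (H : ℝ)) ^ h ≤ (Real.exp (21 / H)) ^ h := by
        refine pow_le_pow_left₀ hκ ?_ h
        linarith [Real.add_one_le_exp (21 / (H : ℝ))]
    _ = Real.exp (h * (21 / H)) := by rw [← Real.exp_nat_mul]
    _ ≤ Real.exp 21 := by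
        refine Real.exp_le_exp.2 ?_
        have : (h : ℝ) ≤ H := by exact_mod_cast (Finset.mem_range.1 hh).le
        calc (h : ℝ) * (21 / H) ≤ H * (21 / H) := by gcongr
          _ = 21 := by field_simp

lemma epsHat_le (s₀ : S) {T : ℕ} {ω : Ω} {ε : ℝ}
    (hε : ∀ k < T, ∀ h < H, ∀ x ∈ I.observed k h ω, I.bias k h x ω ≤ ε) {k : ℕ} (hk : k < T)
    {x : StateAction A} (hn : 0 < (I.stats s₀ k ω).n x) : (I.stats s₀ k ω).epsHat x ≤ ε := by
  have hn' : (0 : ℝ) < (I.stats s₀ k ω).n x := by exact_mod_cast hn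
  have h1 : ((I.stats s₀ k ω).n x : ℝ) * (I.stats s₀ k ω).epsHat x ≤
      (I.stats s₀ k ω).n x * ε := by
    rw [I.count_mul_epsHat, ← obsSum_const s₀]
    exact obsSum_mono fun i hi h hh hx => hε i (by omega) h hh x hx
  exact le_of_mul_le_mul_left h1 hn'

lemma count_le (s₀ : S) (k : ℕ) (ω : Ω) (x : StateAction A) :
    (I.stats s₀ k ω).n x ≤ H * k := by
  classical
  have h1 : ((I.stats s₀ k ω).n x : ℝ) ≤ (H * k : ℕ) := by
    rw [I.count_eq s₀, obsSum]
    calc ∑ i ∈ Finset.range k, ∑ h ∈ Finset.range H,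
          (if x ∈ I.observed i h ω then (1 : ℝ) else 0)
        ≤ ∑ i ∈ Finset.range k, ∑ h ∈ Finset.range H, (1 : ℝ) :=
          Finset.sum_le_sum fun i _ => Finset.sum_le_sum fun h _ => by split_ifs <;> norm_num
      _ = _ := by simp; ring
  exact_mod_cast h1

end Interaction

/-! ### Visit-weighted sums over the episodes -/

namespace Interaction

variable {S : Type*} [Fintype S] {A : S → Type*} [∀ s, Fintype (A s)] [∀ s, Nonempty (A s)]
  {M : TabularMDP S A} {H : ℕ} {graphLaw : PMF (Digraph (StateAction A))}
  {Ω : Type*} {mΩ : MeasurableSpace Ω} {μ : Measure Ω} (I : Interaction M H graphLaw μ)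
  [IsProbabilityMeasure μ]

/-- Expected number of visits in the first `k` episodes to pairs from which `x` is likely
observed. -/
def cumReach (ν : ℝ) (k : ℕ) (x : StateAction A) (ω : Ω) : ℝ :=
  ∑ i ∈ Finset.range k, I.reach ν i x ω

/-- Expected number of visits of `x` in episode `k`. -/
def episodeVisits (k : ℕ) (x : StateAction A) (ω : Ω) : ℝ :=
  ∑ h ∈ Finset.range H, I.visit k h x ω

lemma episodeVisits_nonneg (k : ℕ) (x : StateAction A) (ω : Ω) : 0 ≤ I.episodeVisits k x ω :=
  Finset.sum_nonneg fun _ _ => I.visit_nonneg _ _ _ _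

lemma sum_episodeVisits (ν : ℝ) (k : ℕ) (x : StateAction A) (ω : Ω) :
    ∑ y ∈ inNeighbors graphLaw ν x, I.episodeVisits k y ω = I.reach ν k x ω :=
  Finset.sum_comm

lemma mem_inNeighbors (ν : ℝ) (x y : StateAction A) :
    y ∈ inNeighbors graphLaw ν x ↔ y = x ∨ (thresholdGraph graphLaw ν).Adj y x := by
  simp [inNeighbors]

lemma sum_visit_comm (T : ℕ) (ω : Ω) (f : ℕ → StateAction A → ℝ) :
    ∑ k ∈ Finset.range T, ∑ h ∈ Finset.range H, ∑ x, I.visit k h x ω * f k x =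
      ∑ x, ∑ k ∈ Finset.range T, I.episodeVisits k x ω * f k x := by
  rw [Finset.sum_comm (s := Finset.univ)]
  refine Finset.sum_congr rfl fun k _ => ?_
  rw [Finset.sum_comm]
  refine Finset.sum_congr rfl fun x _ => ?_
  rw [episodeVisits, Finset.sum_mul]

lemma sum_visit_mul (k h : ℕ) (ω : Ω) (c : ℝ) : ∑ x, I.visit k h x ω * c = c := by
  rw [← Finset.sum_mul, I.visit_sum, one_mul]

open Classical in
/-- Visits to pairs that are not yet well observed. -/
lemma sum_visit_small_le {ν : ℝ} (hν0 : 0 < ν) (hν : ν ≤ 1)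
    (hmas : (masNumber (thresholdGraph graphLaw ν) : ℝ) / ν ≤ 2 * masBar graphLaw) {L : ℝ}
    (hL : Real.log 2 ≤ L) (T : ℕ) (ω : Ω) :
    ∑ k ∈ Finset.range T, ∑ h ∈ Finset.range H, ∑ x, I.visit k h x ω *
      (if 8 * H * L / ν ≤ I.cumReach ν k x ω then 0 else 1) ≤ 20 * (masBar graphLaw * H * L) := by
  obtain ⟨hL0, hL1, _, _⟩ := log_pow_bounds hL
  rw [I.sum_visit_comm T ω fun k x => if 8 * H * L / ν ≤ I.cumReach ν k x ω then 0 else 1]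
  have key := sum_weight_small_le T (G := thresholdGraph graphLaw ν)
    (N := inNeighbors graphLaw ν) (w := fun k x => I.episodeVisits k x ω) (H := H)
    (fun x y => mem_inNeighbors ν x y) (fun k x => I.episodeVisits_nonneg k x ω) (by positivity)
    (fun k x => by rw [I.sum_episodeVisits]; exact I.reach_le ν k x ω)
    (B := 8 * H * L / ν) (by positivity)
  refine le_trans (Finset.sum_le_sum fun x _ => Finset.sum_le_sum fun k _ => ?_) (key.trans ?_)
  · simp only [I.sum_episodeVisits]
    change _ ≤ if I.cumReach ν k x ω ≤ 8 * H * L / ν then _ else _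
    by_cases h : 8 * H * L / ν ≤ I.cumReach ν k x ω
    · rw [if_pos h, mul_zero]
      split_ifs
      · exact I.episodeVisits_nonneg k x ω
      · exact le_rfl
    · rw [if_neg h, mul_one, if_pos (not_le.1 h).le]
  · have h1 : 8 * H * L / ν + H ≤ (10 * H * L) / ν := by
      have e : (H : ℝ) ≤ 2 * H * L / ν := by
        rw [le_div_iff₀ hν0]
        have : (0 : ℝ) ≤ H := by positivity
        have h2 : H * ν ≤ H * 1 := mul_le_mul_of_nonneg_left hν this
        nlinarith
      have e' : (10 * H * L) / ν = 8 * H * L / ν + 2 * H * L / ν := by ring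
      linarith
    calc (masNumber (thresholdGraph graphLaw ν) : ℝ) * (8 * H * L / ν + H)
        ≤ masNumber (thresholdGraph graphLaw ν) * ((10 * H * L) / ν) := by gcongr
      _ = masNumber (thresholdGraph graphLaw ν) / ν * (10 * H * L) := by ring
      _ ≤ 2 * masBar graphLaw * (10 * H * L) := by gcongr
      _ = _ := by ring

open Classical in
/-- Sum of the squared confidence widths of well observed pairs. -/
lemma sum_visit_width_sq_le {inp : AlgInput A} (hv : inp.Valid M H)
    (hX : 2 ≤ Fintype.card (StateAction A)) (hH : 0 < H) (s₀ : S) {ν : ℝ} (hν0 : 0 < ν)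
    (hν : ν ≤ 1)
    (hmas : (masNumber (thresholdGraph graphLaw ν) : ℝ) / ν ≤ 2 * masBar graphLaw) {ω : Ω}
    {T : ℕ} (hT : 1 ≤ T) {L : ℝ}
    (hL : L = Real.log (Fintype.card (StateAction A) * H * T / inp.δ))
    (hcount : ∀ k x, 8 * H * L / ν ≤ I.cumReach ν k x ω →
      ν / 4 * I.cumReach ν k x ω ≤ (I.stats s₀ k ω).n x) :
    ∑ k ∈ Finset.range T, ∑ h ∈ Finset.range H, ∑ x, I.visit k h x ω *
      (if 8 * H * L / ν ≤ I.cumReach ν k x ω then inp.phi H ((I.stats s₀ k ω).n x) else 0) ^ 2 ≤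
      256 * (masBar graphLaw * L ^ 2) := by
  have hX' : (2 : ℝ) ≤ Fintype.card (StateAction A) := by exact_mod_cast hX
  have hH' : (1 : ℝ) ≤ H := by exact_mod_cast hH
  have hT' : (1 : ℝ) ≤ T := by exact_mod_cast hT
  have hL2 : Real.log 2 ≤ L := by rw [hL]; exact log_two_le hX' hH' hT' hv.δ_pos hv.δ_le
  obtain ⟨hL0, hL1, _, _⟩ := log_pow_bounds hL2
  have hB0 : 0 < 8 * H * L / ν := by positivity
  have hHB : (H : ℝ) ≤ 8 * H * L / ν := by
    rw [le_div_iff₀ hν0]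
    have h2 : H * ν ≤ H * 1 := mul_le_mul_of_nonneg_left hν (by positivity)
    nlinarith
  have hTJ : (T : ℝ) ≤ 2 ^ (Nat.log 2 T + 1) := by
    exact_mod_cast (Nat.lt_pow_succ_log_self (by norm_num) T).le
  -- The number of dyadic levels; it supplies the second factor L.
  have hJ : ((Nat.log 2 T : ℕ) : ℝ) + 1 ≤ 1.45 * L := by
    have h1 : (2 : ℝ) ^ (Nat.log 2 T + 1) ≤ 2 * (H * T) := by
      have h2 : ((2 ^ Nat.log 2 T : ℕ) : ℝ) ≤ T := by
        exact_mod_cast Nat.pow_log_le_self 2 (by omega)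
      push_cast at h2
      rw [pow_succ]
      nlinarith
    have h2 := Real.log_le_log (by positivity) h1
    rw [Real.log_pow] at h2
    have h3 := log_two_mul_le hX' hH' hT' hv.δ_pos hv.δ_le
    rw [← hL] at h3
    have h4 := Real.log_two_gt_d9
    push_cast at h2
    have h5 : (0 : ℝ) ≤ (Nat.log 2 T : ℕ) := by positivity
    nlinarith
  rw [I.sum_visit_comm T ω fun k x =>
    (if 8 * H * L / ν ≤ I.cumReach ν k x ω then inp.phi H ((I.stats s₀ k ω).n x) else 0) ^ 2]
  have key := sum_weight_div_le T (G := thresholdGraph graphLaw ν)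
    (N := inNeighbors graphLaw ν) (w := fun k x => I.episodeVisits k x ω) (H := H)
    (fun x y => mem_inNeighbors ν x y) (fun k x => I.episodeVisits_nonneg k x ω) (by positivity)
    (fun k x => by rw [I.sum_episodeVisits]; exact I.reach_le ν k x ω)
    hB0 hHB (Nat.log 2 T) (mul_le_mul hTJ hHB (by positivity) (by positivity))
  have hstep : ∀ x, ∀ k ∈ Finset.range T, I.episodeVisits k x ω *
      (if 8 * H * L / ν ≤ I.cumReach ν k x ω then inp.phi H ((I.stats s₀ k ω).n x) else 0) ^ 2 ≤
      28 * L / ν * (if 8 * H * L / ν ≤ I.cumReach ν k x ω then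
        I.episodeVisits k x ω * (1 / I.cumReach ν k x ω) else 0) := by
    intro x k hk
    by_cases hg : 8 * H * L / ν ≤ I.cumReach ν k x ω
    · rw [if_pos hg, if_pos hg]
      have hr : 0 < I.cumReach ν k x ω := hB0.trans_le hg
      have h1 := hcount k x hg
      have hn : (0 : ℝ) < (I.stats s₀ k ω).n x := lt_of_lt_of_le (by positivity) h1
      have h2 := phi_sq_mul_count_le hv hX hH hT (by exact_mod_cast hn)
        ((I.count_le s₀ k ω x).trans (Nat.mul_le_mul_left _ (Finset.mem_range.1 hk).le))
      rw [← hL] at h2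
      -- φ² ≤ 7L/n combined with n at least ν/4 times the cumulative reach.
      have h3 : inp.phi H ((I.stats s₀ k ω).n x) ^ 2 ≤ 28 * L / ν * (1 / I.cumReach ν k x ω) := by
        rw [div_mul_div_comm, le_div_iff₀ (by positivity)]
        have h4 : inp.phi H ((I.stats s₀ k ω).n x) ^ 2 * (ν / 4 * I.cumReach ν k x ω) ≤
          inp.phi H ((I.stats s₀ k ω).n x) ^ 2 * (I.stats s₀ k ω).n x :=
            mul_le_mul_of_nonneg_left h1 (sq_nonneg _)
        linarith
      have h5 := mul_le_mul_of_nonneg_left h3 (I.episodeVisits_nonneg k x ω)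
      linarith
    · rw [if_neg hg, if_neg hg]; simp
  refine (Finset.sum_le_sum fun x _ => Finset.sum_le_sum (hstep x)).trans ?_
  simp only [← Finset.mul_sum]
  have key' : ∑ x, ∑ k ∈ Finset.range T, (if 8 * H * L / ν ≤ I.cumReach ν k x ω then
        I.episodeVisits k x ω * (1 / I.cumReach ν k x ω) else 0) ≤
      3 * ((Nat.log 2 T : ℕ) + 1) * masNumber (thresholdGraph graphLaw ν) := by
    refine le_of_eq_of_le (Finset.sum_congr rfl fun x _ => Finset.sum_congr rfl fun k _ => ?_) key
    have e : I.cumReach ν k x ω = ∑ i ∈ Finset.range k, ∑ y ∈ inNeighbors graphLaw ν x,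
        I.episodeVisits i y ω :=
      Finset.sum_congr rfl fun i _ => (I.sum_episodeVisits ν i x ω).symm
    rw [e]
  calc 28 * L / ν * _ ≤ 28 * L / ν *
        (3 * ((Nat.log 2 T : ℕ) + 1) * masNumber (thresholdGraph graphLaw ν)) :=
        mul_le_mul_of_nonneg_left key' (by positivity)
    _ ≤ 28 * L / ν * (3 * (1.45 * L) * masNumber (thresholdGraph graphLaw ν)) := by gcongr
    _ = 121.8 * L ^ 2 * (masNumber (thresholdGraph graphLaw ν) / ν) := by ring
    _ ≤ 121.8 * L ^ 2 * (2 * masBar graphLaw) := by gcongr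
    _ ≤ 256 * (masBar graphLaw * L ^ 2) := by
      have h0 : 0 ≤ masBar graphLaw := by
        have : (0 : ℝ) ≤ masNumber (thresholdGraph graphLaw ν) / ν := by positivity
        linarith
      have : 0 ≤ masBar graphLaw * L ^ 2 := by positivity
      linarith

end Interaction

lemma sqrt_mul_sqrt_le {m L Φ F Y c : ℝ} (hL : 0 ≤ L) (hm : 0 ≤ m) (hc : 0 ≤ c)
    (hΦ : Φ ≤ 256 * (m * L ^ 2)) (hF : F ≤ c ^ 2 * Y) :
    Real.sqrt Φ * Real.sqrt F ≤ 16 * c * (Real.sqrt (m * Y) * L) := by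
  have h1 : Real.sqrt Φ ≤ 16 * L * Real.sqrt m := by
    refine (Real.sqrt_le_sqrt hΦ).trans (le_of_eq ?_)
    rw [show 256 * (m * L ^ 2) = (16 * L) ^ 2 * m by ring, Real.sqrt_mul (sq_nonneg _),
      Real.sqrt_sq (by positivity)]
  have h2 : Real.sqrt F ≤ c * Real.sqrt Y := by
    refine (Real.sqrt_le_sqrt hF).trans (le_of_eq ?_)
    rw [Real.sqrt_mul (sq_nonneg _), Real.sqrt_sq hc]
  refine (mul_le_mul h1 h2 (Real.sqrt_nonneg _) (by positivity)).trans (le_of_eq ?_)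
  rw [Real.sqrt_mul hm]; ring

namespace Interaction

variable {S : Type*} [Fintype S] {A : S → Type*} [∀ s, Fintype (A s)] [∀ s, Nonempty (A s)]
  {M : TabularMDP S A} {H : ℕ} {graphLaw : PMF (Digraph (StateAction A))}
  {Ω : Type*} {mΩ : MeasurableSpace Ω} {μ : Measure Ω} (I : Interaction M H graphLaw μ)
  [IsProbabilityMeasure μ]

lemma sum_visit_mul_sqrt_le (T : ℕ) (ω : Ω) (c : ℕ → StateAction A → ℝ)
    {f : ℕ → ℕ → StateAction A → ℝ} (hf : ∀ k h x, 0 ≤ f k h x) :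
    ∑ k ∈ Finset.range T, ∑ h ∈ Finset.range H, ∑ x,
        I.visit k h x ω * (c k x * Real.sqrt (f k h x)) ≤
      Real.sqrt (∑ k ∈ Finset.range T, ∑ h ∈ Finset.range H, ∑ x, I.visit k h x ω * c k x ^ 2) *
      Real.sqrt (∑ k ∈ Finset.range T, ∑ h ∈ Finset.range H, ∑ x, I.visit k h x ω * f k h x) := by
  have h := sum_mul_sqrt_le
    (Finset.range T ×ˢ (Finset.range H ×ˢ (Finset.univ : Finset (StateAction A))))
    (w := fun i => I.visit i.1 i.2.1 i.2.2 ω) (c := fun i => c i.1 i.2.2)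
    (f := fun i => f i.1 i.2.1 i.2.2) (fun i _ => I.visit_nonneg _ _ _ _) (fun i _ => hf _ _ _)
  simpa only [Finset.sum_product] using h

open Classical in
-- The case distinction moves into the coefficients, so that each term can be summed on its own:
-- products of width and root by Cauchy–Schwarz, the last term by `sum_visit_small_le`.
lemma gap_or_trivial_le {inp : AlgInput A} {M : TabularMDP S A} {st : Stats A} {π : Policy A}
    {Q ε : ℝ} {h : ℕ} {x : StateAction A} {good : Prop} (hε : 0 ≤ ε)
    (hgood : good → st.epsHat x ≤ ε) :
    (if good then gapTerm inp M H st π Q h x else Q) ≤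
      16 * ((if good then inp.phi H (st.n x) else 0) * Real.sqrt (M.meanReward x))
      + 12 * ((if good then inp.phi H (st.n x) else 0) * Real.sqrt (M.nextVar H π h x))
      + 60 * H * ((if good then inp.phi H (st.n x) else 0) * Real.sqrt ε)
      + 605 * (inp.Shat * Q * H) * (if good then inp.phi H (st.n x) else 0) ^ 2
      + 48 * H * ε + Q * (if good then 0 else 1) := by
  by_cases hg : good
  · simp only [if_pos hg]
    have h1 := hgood hg
    have h2 := inp.phi_nonneg H (st.n x)
    have h3 : inp.phi H (st.n x) * Real.sqrt (st.epsHat x) ≤ inp.phi H (st.n x) * Real.sqrt ε :=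
      mul_le_mul_of_nonneg_left (Real.sqrt_le_sqrt h1) h2
    have h4 := mul_le_mul_of_nonneg_left h3 (by positivity : (0 : ℝ) ≤ 60 * H)
    have h5 := mul_le_mul_of_nonneg_left h1 (by positivity : (0 : ℝ) ≤ 48 * H)
    unfold gapTerm
    linarith
  · simp only [if_neg hg]
    have : 0 ≤ 48 * H * ε := by positivity
    linarith

/-- The bound on the cumulative certificate size on the event that the confidence statements hold
and all pairs are observed often enough. -/
theorem sum_certificate_le {inp : AlgInput A} (hv : inp.Valid M H)
    (hX : 2 ≤ Fintype.card (StateAction A)) (hH : 0 < H) {s₀ : S} {ν : ℝ} (hν0 : 0 < ν)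
    (hν : ν ≤ 1)
    (hmas : (masNumber (thresholdGraph graphLaw ν) : ℝ) / ν ≤ 2 * masBar graphLaw) {ω : Ω}
    (hc : ∀ k, (I.stats s₀ k ω).Concentrated inp M H)
    (hπ : ∀ k, IsOptPlan inp H (I.stats s₀ k ω) (I.π k ω))
    (hcount : ∀ k x, ν / 2 * ∑ i ∈ Finset.range k, I.reach ν i x ω -
        H * Real.log (2 * Fintype.card (StateAction A) / inp.δ) ≤ (I.stats s₀ k ω).n x)
    {T : ℕ} (hT : 1 ≤ T) {Q ε : ℝ}
    (hQ : ∀ k < T, ∀ h < H, ∀ x, 0 < M.visitProb (I.π k ω) (I.s1 k ω) h x →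
      inp.Qmax h x ≤ Q ∧ inp.VmaxNext h x ≤ Q)
    (hε : ∀ k < T, ∀ h < H, ∀ x ∈ I.observed k h ω, I.bias k h x ω ≤ ε) :
    ∑ k ∈ Finset.range T, (I.certUpper inp s₀ k ω - I.certLower inp s₀ k ω) ≤
      (225000 * Real.exp 21) * ipocBound (masBar graphLaw) H (Fintype.card (StateAction A))
        inp.Shat T inp.δ Q ε (∑ k ∈ Finset.range T, I.return1 k ω) := by
  classical
  have hX' : (2 : ℝ) ≤ Fintype.card (StateAction A) := by exact_mod_cast hX
  have hH' : (1 : ℝ) ≤ H := by exact_mod_cast hH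
  have hT' : (1 : ℝ) ≤ T := by exact_mod_cast hT
  have hne : Nonempty (StateAction A) := Fintype.card_pos_iff.1 (by omega)
  have hS : (1 : ℝ) ≤ inp.Shat := by exact_mod_cast hv.one_le_Shat hne.some
  have hM1 := (exists_threshold_le_masBar graphLaw).1
  unfold ipocBound
  set m := masBar graphLaw
  set L := Real.log (Fintype.card (StateAction A) * H * T / inp.δ) with hL
  set V := ∑ k ∈ Finset.range T, I.return1 k ω with hV
  have hL2 : Real.log 2 ≤ L := log_two_le hX' hH' hT' hv.δ_pos hv.δ_le
  obtain ⟨hL0, hL1, hL3, hL23⟩ := log_pow_bounds hL2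
  have hε0 : 0 ≤ ε := (I.bias_nonneg 0 0 (I.pair 0 0 ω) ω).trans
    (hε 0 (by omega) 0 hH _ (Or.inl rfl))
  have hQ1 : 1 ≤ Q := (hv.one_le_VmaxNext 0 hH _).trans
    (hQ 0 (by omega) 0 hH _ (M.visitProb_zero_pos (I.π 0 ω) (I.s1 0 ω))).2
  -- Above the threshold 8HL/ν, the subtracted logarithmic term, at most 2HL, takes no more than
  -- half of ν/2 times the cumulative reach.
  have hcount' : ∀ k x, 8 * H * L / ν ≤ I.cumReach ν k x ω →
      ν / 4 * I.cumReach ν k x ω ≤ (I.stats s₀ k ω).n x := by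
    intro k x hg
    have h1 := hcount k x
    have h2 := log_two_mul_div_le hX' hH' hT' hv.δ_pos hv.δ_le
    have h3 := mul_le_mul_of_nonneg_left h2 (by positivity : (0 : ℝ) ≤ H)
    rw [div_le_iff₀ hν0] at hg
    change ν / 2 * I.cumReach ν k x ω - _ ≤ _ at h1
    linarith
  set good : ℕ → StateAction A → Prop := fun k x => 8 * H * L / ν ≤ I.cumReach ν k x ω
  set c : ℕ → StateAction A → ℝ := fun k x =>
    if good k x then inp.phi H ((I.stats s₀ k ω).n x) else 0 with hcdef
  set b : ℕ → StateAction A → ℝ := fun k x => if good k x then 0 else 1 with hbdef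
  have hpos : ∀ k x, good k x → 0 < (I.stats s₀ k ω).n x := by
    intro k x hg
    have h1 := hcount' k x hg
    have h2 : 0 < 8 * H * L / ν := by positivity
    have h3 : 0 < I.cumReach ν k x ω := h2.trans_le hg
    have h4 : (0 : ℝ) < (I.stats s₀ k ω).n x := lt_of_lt_of_le (by positivity) h1
    exact_mod_cast h4
  have hΦ : ∑ k ∈ Finset.range T, ∑ h ∈ Finset.range H, ∑ x, I.visit k h x ω * c k x ^ 2 ≤
      256 * (m * L ^ 2) :=
    I.sum_visit_width_sq_le hv hX hH s₀ hν0 hν hmas hT hL hcount'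
  have hb : ∑ k ∈ Finset.range T, ∑ h ∈ Finset.range H, ∑ x, I.visit k h x ω * b k x ≤
      20 * (m * H * L) := I.sum_visit_small_le hν0 hν hmas hL2 T ω
  have hvar : ∀ k h x, 0 ≤ M.nextVar H (I.π k ω) h x := fun k h x =>
    variance_nonneg' (M.trans_nonneg x) (M.trans_sum x) _
  have hr := fun (_ _ : ℕ) x => M.meanReward_nonneg x
  have hV0 : 0 ≤ V := Finset.sum_nonneg fun k _ => M.vValue_nonneg _ _ _ _
  have hsumr : ∑ k ∈ Finset.range T, ∑ h ∈ Finset.range H, ∑ x,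
      I.visit k h x ω * M.meanReward x = V := rfl
  -- Like the rewards, the variances are charged to the values of the played policies; this keeps T
  -- out of the leading term.
  have hsumvar : ∑ k ∈ Finset.range T, ∑ h ∈ Finset.range H, ∑ x,
      I.visit k h x ω * M.nextVar H (I.π k ω) h x ≤ 2 * H * V := by
    rw [hV, Finset.mul_sum]
    exact Finset.sum_le_sum fun k _ => M.sum_visitProb_nextVar_le H (I.π k ω) (I.s1 k ω)
  have hsumε : ∑ k ∈ Finset.range T, ∑ h ∈ Finset.range H, ∑ x, I.visit k h x ω * ε =
      H * T * ε := by
    simp only [I.sum_visit_mul]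
    simp; ring
  have hm0 : 0 ≤ m := by linarith
  have t1 := (I.sum_visit_mul_sqrt_le T ω c hr).trans
    (sqrt_mul_sqrt_le (c := 1) (Y := H * V) hL0.le hm0 zero_le_one hΦ (by
      rw [hsumr, one_pow, one_mul]; exact le_mul_of_one_le_left hV0 hH'))
  have t2 := (I.sum_visit_mul_sqrt_le T ω c hvar).trans
    (sqrt_mul_sqrt_le (c := 3 / 2) (Y := H * V) hL0.le hm0 (by norm_num) hΦ
      (hsumvar.trans (by
        have : 0 ≤ H * V := by positivity
        linarith)))
  have t3 := (I.sum_visit_mul_sqrt_le T ω c (f := fun _ _ _ => ε) fun _ _ _ => hε0).trans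
    (sqrt_mul_sqrt_le (c := 1) (Y := H * T * ε) hL0.le hm0 zero_le_one hΦ (by
      rw [hsumε, one_pow, one_mul]))
  have e3 : H * Real.sqrt (m * (H * T * ε)) = Real.sqrt (m * H ^ 3 * T * ε) := by
    rw [show m * (H : ℝ) ^ 3 * T * ε = (H : ℝ) ^ 2 * (m * (H * T * ε)) by ring,
      Real.sqrt_mul (sq_nonneg _), Real.sqrt_sq (by positivity)]
  have hcert : ∑ k ∈ Finset.range T, (I.certUpper inp s₀ k ω - I.certLower inp s₀ k ω) ≤
      Real.exp 21 * ∑ k ∈ Finset.range T, ∑ h ∈ Finset.range H, ∑ x, I.visit k h x ω *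
        (if good k x then gapTerm inp M H (I.stats s₀ k ω) (I.π k ω) Q h x else Q) := by
    rw [Finset.mul_sum]
    exact Finset.sum_le_sum fun k hk => I.certificate_le hv hH (hc k) (hπ k)
      (hQ k (Finset.mem_range.1 hk)) (good k)
  have hsplit : ∑ k ∈ Finset.range T, ∑ h ∈ Finset.range H, ∑ x, I.visit k h x ω *
        (if good k x then gapTerm inp M H (I.stats s₀ k ω) (I.π k ω) Q h x else Q) ≤
      16 * (∑ k ∈ Finset.range T, ∑ h ∈ Finset.range H, ∑ x,
        I.visit k h x ω * (c k x * Real.sqrt (M.meanReward x)))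
      + 12 * (∑ k ∈ Finset.range T, ∑ h ∈ Finset.range H, ∑ x,
        I.visit k h x ω * (c k x * Real.sqrt (M.nextVar H (I.π k ω) h x)))
      + 60 * H * (∑ k ∈ Finset.range T, ∑ h ∈ Finset.range H, ∑ x,
        I.visit k h x ω * (c k x * Real.sqrt ε))
      + 605 * (inp.Shat * Q * H) * (∑ k ∈ Finset.range T, ∑ h ∈ Finset.range H, ∑ x,
        I.visit k h x ω * c k x ^ 2)
      + 48 * H * (∑ k ∈ Finset.range T, ∑ h ∈ Finset.range H, ∑ x, I.visit k h x ω * ε)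
      + Q * (∑ k ∈ Finset.range T, ∑ h ∈ Finset.range H, ∑ x, I.visit k h x ω * b k x) := by
    simp only [Finset.mul_sum, ← Finset.sum_add_distrib]
    refine Finset.sum_le_sum fun k hk => Finset.sum_le_sum fun h _ => Finset.sum_le_sum fun x _ => ?_
    have h1 := gap_or_trivial_le (inp := inp) (M := M) (H := H) (st := I.stats s₀ k ω)
      (π := I.π k ω) (Q := Q) (h := h) (x := x) (good := good k x) hε0
      fun hg => I.epsHat_le s₀ hε (Finset.mem_range.1 hk) (hpos k x hg)
    refine (mul_le_mul_of_nonneg_left h1 (I.visit_nonneg k h x ω)).trans (le_of_eq ?_)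
    simp only [hcdef, hbdef]
    ring
  refine hcert.trans ?_
  -- The constant is dictated by the L³ term: 605 · 256 · 1.45 < 224600 from the squared widths and
  -- 20 · 2.2 = 44 from the poorly observed pairs.
  refine (mul_le_mul_of_nonneg_left (hsplit.trans (c := 225000 * (Real.sqrt (m * H * V) * L
    + m * inp.Shat * Q * H * L ^ 3 + Real.sqrt (m * H ^ 3 * T * ε) * L + H ^ 2 * T * ε)) ?_)
    (Real.exp_pos 21).le).trans (le_of_eq (by ring))
  rw [hsumε]
  have hZ : 0 ≤ inp.Shat * Q * H := by positivity
  have u4 := mul_le_mul_of_nonneg_left hΦ (by positivity : 0 ≤ 605 * (inp.Shat * Q * H))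
  have u4' : 605 * (inp.Shat * Q * H) * (256 * (m * L ^ 2)) ≤
      224600 * (m * inp.Shat * Q * H * L ^ 3) := by
    have := mul_le_mul_of_nonneg_left hL23
      (by positivity : 0 ≤ 605 * 256 * (m * inp.Shat * Q * H))
    have h0 : 0 ≤ m * inp.Shat * Q * H * L ^ 3 := by positivity
    nlinarith
  have u6 := mul_le_mul_of_nonneg_left hb (by linarith : 0 ≤ Q)
  have u6' : Q * (20 * (m * H * L)) ≤ 44 * (m * inp.Shat * Q * H * L ^ 3) := by
    have h1 := mul_le_mul_of_nonneg_left hL3 (by positivity : 0 ≤ 20 * (m * Q * H))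
    have h2 : 44 * (m * Q * H * L ^ 3) ≤ inp.Shat * (44 * (m * Q * H * L ^ 3)) :=
      le_mul_of_one_le_left (by positivity) hS
    linarith
  have u3 := mul_le_mul_of_nonneg_left t3 (by positivity : (0 : ℝ) ≤ 60 * H)
  have u3' : 60 * H * (16 * 1 * (Real.sqrt (m * (H * T * ε)) * L)) =
      960 * (Real.sqrt (m * H ^ 3 * T * ε) * L) := by rw [← e3]; ring
  have u1 : Real.sqrt (m * (H * V)) = Real.sqrt (m * H * V) := by rw [mul_assoc]
  rw [u1] at t1 t2
  have n1 : 0 ≤ Real.sqrt (m * H * V) * L := by positivity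
  have n3 : 0 ≤ Real.sqrt (m * H ^ 3 * T * ε) * L := by positivity
  have n4 : 0 ≤ H ^ 2 * T * ε := by positivity
  have n2 : 0 ≤ m * inp.Shat * Q * H * L ^ 3 := by positivity
  linarith

end Interaction

end FeedbackRL

end

/-! ### Combination of the concentration and counting events -/

theorem theorem6 :
    ∃ C : ℝ, 0 < C ∧
      ∀ (S : Type*) [Fintype S] (A : S → Type*) [∀ s, Fintype (A s)] [∀ s, Nonempty (A s)]
        (M : FeedbackRL.TabularMDP S A) (H : ℕ)
        (graphLaw : PMF (Digraph (FeedbackRL.StateAction A)))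
        (inp : FeedbackRL.AlgInput A) (s₀ : S)
        (Ω : Type*) (mΩ : MeasurableSpace Ω) (μ : MeasureTheory.Measure Ω)
        [MeasureTheory.IsProbabilityMeasure μ]
        (I : FeedbackRL.Interaction M H graphLaw μ),
        0 < H → 2 ≤ Fintype.card (FeedbackRL.StateAction A) →
        inp.Valid M H → I.RunsAlgorithm inp s₀ →
        ∃ E : Set Ω, MeasurableSet E ∧ ENNReal.ofReal (1 - inp.δ) ≤ μ E ∧ ∀ ω ∈ E,
          (∀ k, I.certLower inp s₀ k ω ≤ I.return1 k ω ∧ I.return1 k ω ≤ I.optReturn k ω ∧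
            I.optReturn k ω ≤ I.certUpper inp s₀ k ω) ∧
          ∀ T : ℕ, 1 ≤ T → ∀ Q ε : ℝ, Q ≤ H →
            (∀ k < T, ∀ h < H, ∀ x, 0 < M.visitProb (I.π k ω) (I.s1 k ω) h x →
              inp.Qmax h x ≤ Q ∧ inp.VmaxNext h x ≤ Q) →
            (∀ k < T, ∀ h < H, ∀ x ∈ I.observed k h ω, I.bias k h x ω ≤ ε) →
            ∑ k ∈ Finset.range T, (I.certUpper inp s₀ k ω - I.certLower inp s₀ k ω) ≤
                C * FeedbackRL.ipocBound (FeedbackRL.masBar graphLaw) H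
                  (Fintype.card (FeedbackRL.StateAction A)) inp.Shat T inp.δ Q ε
                  (∑ k ∈ Finset.range T, I.return1 k ω) ∧
            ∑ k ∈ Finset.range T, (I.optReturn k ω - I.return1 k ω) ≤
                C * FeedbackRL.ipocBound (FeedbackRL.masBar graphLaw) H
                  (Fintype.card (FeedbackRL.StateAction A)) inp.Shat T inp.δ Q ε
                  (∑ k ∈ Finset.range T, I.return1 k ω) := by
  refine ⟨225000 * Real.exp 21, by positivity, ?_⟩
  intro S _ A _ _ M H graphLaw inp s₀ Ω mΩ μ _ I hH hX hv hrun
  have hne : Nonempty (FeedbackRL.StateAction A) := Fintype.card_pos_iff.1 (by omega)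
  obtain ⟨_, ν, hν0, hν, hmas⟩ := FeedbackRL.exists_threshold_le_masBar graphLaw
  obtain ⟨N₁, hN₁, hc⟩ := I.exists_concentration_event s₀ hv hX hH
  obtain ⟨N₂, hN₂, hn⟩ := I.exists_count_event hH s₀ hν0.le hν hv.δ_pos
    (by omega : 0 < Fintype.card (FeedbackRL.StateAction A))
  -- The exceptional sets come without a measurability claim, so their measurable hull is removed.
  have hN : μ (toMeasurable μ (N₁ ∪ N₂)) ≤ ENNReal.ofReal inp.δ := by
    have hδ : 0 ≤ inp.δ / 2 := by linarith [hv.δ_pos]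
    rw [measure_toMeasurable, ← add_halves inp.δ, ENNReal.ofReal_add hδ hδ]
    exact (measure_union_le _ _).trans (add_le_add hN₁ hN₂)
  refine ⟨(toMeasurable μ (N₁ ∪ N₂))ᶜ, (measurableSet_toMeasurable _ _).compl, ?_, ?_⟩
  · rw [prob_compl_eq_one_sub (measurableSet_toMeasurable _ _),
      ENNReal.ofReal_sub _ hv.δ_pos.le, ENNReal.ofReal_one]
    exact tsub_le_tsub_left hN 1
  intro ω hω
  have hω' : ω ∉ N₁ ∪ N₂ := fun h => hω (subset_toMeasurable μ _ h)
  have hcω := hc ω fun h => hω' (Or.inl h)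
  have hnω := hn ω fun h => hω' (Or.inr h)
  have hbounds : ∀ k, I.certLower inp s₀ k ω ≤ I.return1 k ω ∧
      I.return1 k ω ≤ I.optReturn k ω ∧ I.optReturn k ω ≤ I.certUpper inp s₀ k ω := by
    intro k
    have h := FeedbackRL.confidence_bounds hv (I.admissible_stats s₀ k ω) (hcω k) (hrun k ω)
      (Nat.zero_le H) (I.s1 k ω)
    exact ⟨h.2.1, M.vValue_le_optV H _ 0 _, h.2.2.1⟩
  refine ⟨hbounds, fun T hT Q ε _ hQ hε => ?_⟩
  have hcert := I.sum_certificate_le hv hX hH hν0 hν hmas hcω (fun k => hrun k ω) hnω hT hQ hε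
  refine ⟨hcert, le_trans (Finset.sum_le_sum fun k _ => ?_) hcert⟩
  -- The certificate contains both the optimal and the actual return, so the regret inherits its
  -- bound.
  linarith [(hbounds k).1, (hbounds k).2.2]
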